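/- Let $\alpha\in[1,2]$, $\kappa_1,\kappa_2\in\mathbb R$, $\gamma>0$, $T>0$ and $r\ge\alpha+2$. For $2\pi$-periodic functions put $\hat v(k)=\frac1{2\pi}\int_{-\pi}^{\pi}v(x)e^{-ikx}\,dx$, $(v,w)=\int_{-\pi}^{\pi}v\overline{w}\,dx$, $\|v\|_{L^2}=(v,v)^{1/2}$, $\|v\|_{H^s}^2=\sum_{k\in\mathbb Z}(1+k^2)^s|\hat v(k)|^2$, $\mathcal D^\alpha v=\sum_{k\in\mathbb Z}|k|^\alpha\hat v(k)e^{ikx}$, and $f(v)=\kappa_1v+\tfrac32\gamma v^2$; let $H^s$ be the space of $2\pi$-periodic functions, square-integrable over a period, with finite $\|\cdot\|_{H^s}$. Consider the fractional Camassa–Holm equation $$u_t+f(u)_x+\mathcal D^\alpha u_t=-\kappa_2\left[2\mathcal D^\alpha(uu_x)+u\,\mathcal D^\alpha u_x\right],\qquad u(0)=u_0,\tag{1}$$ on $(0,T]$. A real-valued $u\in C([0,T];H^r)$ is a solution of (1) if $u(0)=u_0$ and, for every smooth $2\pi$-periodic $\varphi:\mathbb R\to\mathbb C$ and every $t\in(0,T]$,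 $$\frac{d}{dt}\left[(u,\varphi)+(u,\mathcal D^\alpha\varphi)\right]=(f(u),\varphi_x)-\kappa_2\left[2(uu_x,\mathcal D^\alpha\varphi)+(u\,\mathcal D^\alpha u_x,\varphi)\right].\tag{2}$$ Let $V_N=\operatorname{span}_{\mathbb C}\{e^{ikx}:|k|\le N\}$. For an integer $N\ge1$, a Fourier spectral Galerkin (FSG) semi-discrete solution with datum $u_0$ is a continuous curve $u_N:[0,T]\to V_N$ that satisfies (2), with $u_N$ in place of $u$, for all $\varphi\in V_N$ and $t\in(0,T]$, and $u_N(0)=\sum_{|k|\le N}\hat u_0(k)e^{ikx}$. Theorem 4.1 (Spectral convergence). (i) For every $M$ there is a constant $C>0$, depending only on $M$, $T$, $r$ and the parameters $\alpha,\kappa_1,\kappa_2,\gamma$ of the equation, such that for every solution $u\in C([0,T];H^r)$ of (1), with any initial datum $u_0$, satisfying $\sup_{0\le t\le T}\|u(t)\|_{H^r}\le M$, every integer $N\ge1$ and every FSG solution $u_N$ with datum $u_0$, $$\|u(t)-u_N(t)\|_{L^2}\le C\,N^{-r}\qquad\text{for all }t\in[0,T].$$ (ii) If $u\in C([0,T];H^r)$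 is a solution of (1) and the initial datum $u_0$ is real-analytic on $\mathbb R$, then there are constants $C,c>0$ such that for every integer $N\ge1$ and every FSG solution $u_N$ with datum $u_0$, $$\|u(t)-u_N(t)\|_{L^2}\le C\,e^{-cN}\qquad\text{for all }t\in[0,T].$$ -/

import Mathlib

open Set Filter Topology MeasureTheory

namespace FCH

noncomputable section

/-- The character `x ↦ e^{ikx}`. -/
def e (k : ℤ) : ℝ → ℂ := fun x => Complex.exp (Complex.I * k * x)

/-- The inner product `(f, g) = ∫_{-π}^{π} f(x) conj(g(x)) dx`. -/
def ip (f g : ℝ → ℂ) : ℂ := ∫ x in (-Real.pi)..Real.pi, f x * (starRingEnd ℂ) (g x)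

/-- The `L²` norm over one period, `‖f‖ = (∫_{-π}^{π} |f(x)|² dx)^{1/2}`. -/
def l2Norm (f : ℝ → ℂ) : ℝ := Real.sqrt (∫ x in (-Real.pi)..Real.pi, ‖f x‖ ^ 2)

/-- The Fourier coefficient `(1/2π) ∫_{-π}^{π} f(x) e^{-ikx} dx`. -/
def fc (f : ℝ → ℂ) (k : ℤ) : ℂ :=
  (1 / (2 * (Real.pi : ℂ))) *
    ∫ x in (-Real.pi)..Real.pi, f x * Complex.exp (-(Complex.I * k * x))

/-- Membership in the periodic Sobolev space `H^s`: a `2π`-periodic function, square-integrable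
over a period, with `∑_k (1 + k²)^s |f̂(k)|² < ∞`. -/
structure MemHs (s : ℝ) (f : ℝ → ℂ) : Prop where
  periodic : Function.Periodic f (2 * Real.pi)
  memLp : MemLp f 2 (volume.restrict (Ioc (-Real.pi) Real.pi))
  summable : Summable fun k : ℤ => (1 + (k : ℝ) ^ 2) ^ s * ‖fc f k‖ ^ 2

/-- The norm of `H^s`. -/
def hsNorm (s : ℝ) (f : ℝ → ℂ) : ℝ :=
  Real.sqrt (∑' k : ℤ, (1 + (k : ℝ) ^ 2) ^ s * ‖fc f k‖ ^ 2)

/-- `u ∈ C([0,T]; H^s)`. -/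
structure ContInHs (s T : ℝ) (u : ℝ → ℝ → ℂ) : Prop where
  mem : ∀ t ∈ Icc 0 T, MemHs s (u t)
  cont : ∀ t₀ ∈ Icc 0 T,
    Tendsto (fun t => hsNorm s (fun x => u t x - u t₀ x)) (𝓝[Icc 0 T] t₀) (𝓝 0)

/-- The fractional Laplacian `D^α f (x) = ∑_k |k|^α f̂(k) e^{ikx}`. In this development it is applied
only to functions for which the series converges absolutely: smooth periodic functions, and `u_x`
for `u ∈ H^r`, `r ≥ α + 2`. -/
def fracLap (α : ℝ) (f : ℝ → ℂ) : ℝ → ℂ :=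
  fun x => ∑' k : ℤ, (((|(k : ℝ)| ^ α : ℝ) : ℂ) * fc f k) * e k x

/-- The spatial derivative `f_x (x) = ∑_k i k f̂(k) e^{ikx}` of a periodic function. It depends only
on the almost-everywhere class of `f`, and is the classical derivative of the continuous
representative whenever `∑_k |k| |f̂(k)| < ∞`, as for `f ∈ H^s` with `s > 3/2`. -/
def dx (f : ℝ → ℂ) : ℝ → ℂ :=
  fun x => ∑' k : ℤ, (Complex.I * k * fc f k) * e k x

/-- The trigonometric polynomials of degree at most `N`. -/
def V (N : ℕ) : Submodule ℂ (ℝ → ℂ) := Submodule.span ℂ (e '' Icc (-(N : ℤ)) N)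

/-- The `L²`-orthogonal projection onto `V N`. -/
def P (N : ℕ) (f : ℝ → ℂ) : ℝ → ℂ := fun x => ∑ k ∈ Finset.Icc (-(N : ℤ)) N, fc f k * e k x

/-- The smooth `2π`-periodic complex functions. -/
def smoothPer : Set (ℝ → ℂ) :=
  {φ | Function.Periodic φ (2 * Real.pi) ∧ ContDiff ℝ (⊤ : ℕ∞) φ}

/-- The flux `f(v) = κ₁ v + (3/2) γ v²`. -/
def flux (κ₁ γ : ℝ) (v : ℝ → ℂ) : ℝ → ℂ := fun x => κ₁ * v x + 3 / 2 * γ * v x ^ 2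

/-- The right-hand side of the variational form,
`(f(v), φ_x) - κ₂ [2 (v v_x, D^α φ) + (v D^α v_x, φ)]`. -/
def rhs (α κ₁ κ₂ γ : ℝ) (v φ : ℝ → ℂ) : ℂ :=
  ip (flux κ₁ γ v) (dx φ) -
    κ₂ * (2 * ip (fun x => v x * dx v x) (fracLap α φ) +
      ip (fun x => v x * fracLap α (dx v) x) φ)

/-- The variational form `(v_t, φ) + (v_t, D^α φ) = rhs v φ` on `(0,T]`, for all `φ` in the set `S`
of test functions. -/
def Variational (α κ₁ κ₂ γ T : ℝ) (S : Set (ℝ → ℂ)) (v : ℝ → ℝ → ℂ) : Prop :=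
  ∀ φ ∈ S, ∀ t ∈ Ioc 0 T,
    HasDerivWithinAt (fun s => ip (v s) φ + ip (v s) (fracLap α φ))
      (rhs α κ₁ κ₂ γ (v t) φ) (Icc 0 T) t

/-- `u` is a real solution in `C([0,T]; H^r)` of the fractional Camassa-Holm equation
`u_t + f(u)_x + D^α u_t = -κ₂ [2 D^α (u u_x) + u D^α u_x]` with `u(0) = u₀`. The equation is
understood weakly, through smooth periodic test functions. -/
structure IsExactSolution (α κ₁ κ₂ γ T r : ℝ) (u₀ : ℝ → ℝ) (u : ℝ → ℝ → ℝ) : Prop where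
  cont : ContInHs r T (fun t x => (u t x : ℂ))
  eqn : Variational α κ₁ κ₂ γ T smoothPer (fun t x => (u t x : ℂ))
  init : u 0 = u₀

/-- `uN` solves the Fourier spectral Galerkin scheme on `[0,T]`: it is a continuous curve in `V N`,
satisfies the variational form for all test functions in `V N`, and starts at the projection of
`u₀`. -/
structure IsFSG (α κ₁ κ₂ γ T : ℝ) (N : ℕ) (u₀ : ℝ → ℝ) (uN : ℝ → ℝ → ℂ) : Prop where
  mem : ∀ t ∈ Icc 0 T, uN t ∈ V N
  cont : ContInHs 0 T uN
  eqn : Variational α κ₁ κ₂ γ T (V N : Set (ℝ → ℂ)) uN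
  init : uN 0 = P N (fun x => (u₀ x : ℂ))

end

end FCH

/-! Tested against `e k`, the weak equation becomes an infinite system for the Fourier coefficients,
`a' k = -i (κ₁ k qm(k) a k + ∑ l, sig(k,l) a (k-l) a l)`. The Galerkin coefficients solve the same
equations for `|k| ≤ N` and vanish elsewhere. The structural fact is that `sig(k,l) = 3 κ₂ l +
rho(k,l)`: after inverting `1 + D^α` the nonlinearity is the transport term `3 κ₂ u u_x` plus a
remainder of order zero (`abs_rho_le_wt_sub`). Transport by a real function is skew-adjoint up to
order zero, so the antisymmetric part of `sig` costs no derivative of the transported function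
(`abs_sig_sub_sig_le`, `abs_im_bil_le`). For the optimal power of `N`, the Galerkin coefficients `y`
are compared with a Lipschitz truncation `cut N k * a k` and not with the sharp projection. The
Lipschitz constant `2 / N` compensates the derivative in the transport term, so the residual is
bounded by the part of `a` at frequencies at least `N / 4`, without loss of a power of `N`
(`abs_mul_cut_defect_le`, `norm_residual_le`). The error energy `E` then satisfies a Gronwall
inequality, except for a quadratic term that an inverse inequality bounds by `N ^ (α + 3 / 2) * √E *
E`. A barrier argument absorbs this term if the tail `δ` satisfies `N ^ (α + 3 / 2) * δ ≤ ε`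
(`galerkin_error_bound`). Since `r ≥ α + 2`, the tail `N ^ (-r)` is admissible for large `N`. For
small `N` a bound on the Galerkin solution uniform over the data is enough. It comes from the
conservation of `∑ (1 + |k|^α) |y k|²`, which uses that the Galerkin solution is real; reality
follows from uniqueness for the finite system. For analytic data, (i) and the inverse inequality
bound `∑ wt k ^ (α + 1) * ‖y k‖` uniformly in large `N`. This controls a Gevrey norm of `y` whose
radius shrinks exponentially in time, the shrinking absorbing the half derivatives lost
(`ModeSol.gevrey_bound`). All sums there are finite, so no regularity of `u` is presupposed. Letting
`N → ∞` gives exponential decay of the coefficients of `u`; the tail `δ` is then exponentially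
small, and the error bound is applied again with this `δ`. -/

namespace FCH

/-! ### Fourier coefficients -/

/-- Integrability over one period. -/
abbrev PerInt (f : ℝ → ℂ) : Prop := IntervalIntegrable f volume (-Real.pi) Real.pi

/-- The trigonometric series with coefficients `b`. -/
noncomputable def ser (b : ℤ → ℂ) : ℝ → ℂ := fun x => ∑' l : ℤ, b l * e l x

theorem neg_pi_lt_pi : -Real.pi < Real.pi := by linarith [Real.pi_pos]

theorem norm_e (k : ℤ) (x : ℝ) : ‖e k x‖ = 1 := by
  have : Complex.I * k * x = ((k * x : ℝ) : ℂ) * Complex.I := by push_cast; ring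
  rw [e, this, Complex.norm_exp_ofReal_mul_I]

theorem continuous_e (k : ℤ) : Continuous (e k) := by unfold e; fun_prop

theorem e_add (k l : ℤ) (x : ℝ) : e (k + l) x = e k x * e l x := by
  simp only [e, ← Complex.exp_add]; push_cast; ring_nf

theorem e_neg (k : ℤ) (x : ℝ) : e (-k) x = Complex.exp (-(Complex.I * k * x)) := by
  simp only [e]; push_cast; ring_nf

theorem conj_e (k : ℤ) (x : ℝ) : (starRingEnd ℂ) (e k x) = e (-k) x := by
  simp only [e, ← Complex.exp_conj]; simp

theorem e_periodic (k : ℤ) : Function.Periodic (e k) (2 * Real.pi) := by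
  intro x
  have : Complex.I * k * ((x + 2 * Real.pi : ℝ) : ℂ)
      = Complex.I * k * x + k * (2 * Real.pi * Complex.I) := by push_cast; ring
  simp only [e, this, Complex.exp_add, Complex.exp_int_mul_two_pi_mul_I, mul_one]

theorem fc_eq (f : ℝ → ℂ) (k : ℤ) :
    fc f k = (1 / (2 * (Real.pi : ℂ))) * ∫ x in (-Real.pi)..Real.pi, f x * e (-k) x := by
  simp only [fc, e_neg]

theorem perInt_mul_e {f : ℝ → ℂ} (hf : PerInt f) (k : ℤ) : PerInt fun x => f x * e k x :=
  hf.mul_continuousOn (continuous_e k).continuousOn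

theorem fc_add {f g : ℝ → ℂ} (hf : PerInt f) (hg : PerInt g) (k : ℤ) :
    fc (fun x => f x + g x) k = fc f k + fc g k := by
  simp only [fc_eq, add_mul]
  rw [intervalIntegral.integral_add (perInt_mul_e hf _) (perInt_mul_e hg _), mul_add]

theorem fc_sub {f g : ℝ → ℂ} (hf : PerInt f) (hg : PerInt g) (k : ℤ) :
    fc (fun x => f x - g x) k = fc f k - fc g k := by
  simp only [fc_eq, sub_mul]
  rw [intervalIntegral.integral_sub (perInt_mul_e hf _) (perInt_mul_e hg _), mul_sub]

theorem fc_const_mul (c : ℂ) (f : ℝ → ℂ) (k : ℤ) : fc (fun x => c * f x) k = c * fc f k := by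
  simp only [fc_eq, mul_assoc, intervalIntegral.integral_const_mul]
  ring

theorem ip_e (v : ℝ → ℂ) (k : ℤ) : ip v (e k) = 2 * Real.pi * fc v k := by
  have : (Real.pi : ℂ) ≠ 0 := by exact_mod_cast Real.pi_ne_zero
  simp only [ip, conj_e, fc_eq]
  field_simp

theorem ip_const_mul_e (v : ℝ → ℂ) (c : ℂ) (k : ℤ) :
    ip v (fun x => c * e k x) = (starRingEnd ℂ) c * (2 * Real.pi * fc v k) := by
  rw [← ip_e]
  simp only [ip, map_mul, ← intervalIntegral.integral_const_mul]
  congr 1; ext x; ring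

theorem fc_neg_of_real {u : ℝ → ℂ} (hu : ∀ x, (starRingEnd ℂ) (u x) = u x) (k : ℤ) :
    fc u (-k) = (starRingEnd ℂ) (fc u k) := by
  simp only [fc_eq, map_mul, map_div₀, neg_neg, intervalIntegral.integral_of_le neg_pi_lt_pi.le,
    ← integral_conj, conj_e, hu]
  simp only [map_one, map_ofNat, Complex.conj_ofReal]

theorem norm_fc_le (f : ℝ → ℂ) (k : ℤ) :
    ‖fc f k‖ ≤ 1 / (2 * Real.pi) * ∫ x in (-Real.pi)..Real.pi, ‖f x‖ := by
  rw [fc_eq, norm_mul]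
  have h1 : ‖(1 / (2 * (Real.pi : ℂ)))‖ = 1 / (2 * Real.pi) := by
    simp [abs_of_pos Real.pi_pos]
  rw [h1]
  gcongr
  refine (intervalIntegral.norm_integral_le_integral_norm neg_pi_lt_pi.le).trans (le_of_eq ?_)
  simp [norm_e]

theorem fc_one (k : ℤ) : fc (fun _ => 1) k = if k = 0 then 1 else 0 := by
  have hpi : (Real.pi : ℂ) ≠ 0 := by exact_mod_cast Real.pi_ne_zero
  split_ifs with h
  · subst h
    simp only [fc, Int.cast_zero, mul_zero, zero_mul, neg_zero, Complex.exp_zero, one_mul]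
    simp only [intervalIntegral.integral_const, Complex.real_smul]
    push_cast
    field_simp
    ring
  · have hk : (Complex.I * ((-k : ℤ) : ℂ)) ≠ 0 := by
      simp [h]
    rw [fc_eq]
    simp only [e, one_mul]
    rw [integral_exp_mul_complex hk]
    have : e (-k) Real.pi = e (-k) (-Real.pi) := by
      have := e_periodic (-k) (-Real.pi)
      rw [← this]; congr 1; ring
    simp only [e] at this
    rw [this]; simp

/-! ### Products with absolutely convergent trigonometric series -/

theorem continuous_ser {b : ℤ → ℂ} (hb : Summable fun l => ‖b l‖) : Continuous (ser b) := by
  refine continuous_tsum (fun l => (continuous_e l).const_mul (b l) ) hb fun l x => ?_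
  simp [norm_e]

/-- The sum and the integral are exchanged because `∑ ‖b l‖ * ∫ ‖v‖` converges. Only integrability
of `v` is needed, so `v` may be an arbitrary representative. -/
theorem fc_mul_ser {v : ℝ → ℂ} (hv : PerInt v) {b : ℤ → ℂ} (hb : Summable fun l => ‖b l‖) (k : ℤ) :
    HasSum (fun l => b l * fc v (k - l)) (fc (fun x => v x * ser b x) k) := by
  have key : HasSum (fun l => ∫ x in (-Real.pi)..Real.pi, b l * (v x * e (l - k) x))
      (∫ x in (-Real.pi)..Real.pi, ∑' l, b l * (v x * e (l - k) x)) := by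
    simp only [intervalIntegral.integral_of_le neg_pi_lt_pi.le]
    refine hasSum_integral_of_summable_integral_norm (fun l => ?_) ?_
    · exact ((perInt_mul_e hv (l - k)).const_mul (b l)).1
    · have : ∀ l, ∫ x in Ioc (-Real.pi) Real.pi, ‖b l * (v x * e (l - k) x)‖
          = ‖b l‖ * ∫ x in Ioc (-Real.pi) Real.pi, ‖v x‖ := by
        intro l
        rw [← integral_const_mul]
        simp [norm_e]
      simp only [this]
      exact hb.mul_right _
  have h1 : ∀ l, b l * fc v (k - l)
      = 1 / (2 * (Real.pi : ℂ)) * ∫ x in (-Real.pi)..Real.pi, b l * (v x * e (l - k) x) := by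
    intro l
    rw [fc_eq, intervalIntegral.integral_const_mul, neg_sub]
    ring
  have h2 : fc (fun x => v x * ser b x) k = 1 / (2 * (Real.pi : ℂ)) *
      ∫ x in (-Real.pi)..Real.pi, ∑' l, b l * (v x * e (l - k) x) := by
    rw [fc_eq]
    congr 2
    ext x
    rw [ser, ← tsum_mul_left, ← tsum_mul_right]
    congr 1; ext l
    rw [sub_eq_add_neg, e_add]
    ring
  simp only [h1, h2]
  exact key.mul_left _

theorem fc_ser {b : ℤ → ℂ} (hb : Summable fun l => ‖b l‖) (k : ℤ) : fc (ser b) k = b k := by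
  have h := fc_mul_ser (v := fun _ => 1) (by simp [PerInt]) hb k
  simp only [one_mul, fc_one, sub_eq_zero, mul_ite, mul_one, mul_zero] at h
  refine (h.unique ?_)
  convert hasSum_ite_eq k (b k) using 2 with l
  by_cases h : k = l
  · simp [h]
  · simp [h, Ne.symm h]

/-! ### Characters as eigenfunctions and test functions -/

theorem fc_e (k l : ℤ) : fc (e k) l = if l = k then 1 else 0 := by
  have : fc (e k) l = fc (fun _ => 1) (l - k) := by
    simp only [fc_eq, one_mul, ← e_add, neg_sub]
    congr 2
  rw [this, fc_one]; simp [sub_eq_zero]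

theorem ser_mul_fc_e (m : ℤ → ℂ) (k : ℤ) :
    ser (fun l => m l * fc (e k) l) = fun x => m k * e k x := by
  ext x
  rw [ser, tsum_eq_single k]
  · simp [fc_e]
  · intro l hl; simp [fc_e, hl]

theorem dx_e (k : ℤ) : dx (e k) = fun x => (Complex.I * k) * e k x :=
  ser_mul_fc_e (fun l => Complex.I * l) k

theorem fracLap_e (α : ℝ) (k : ℤ) :
    fracLap α (e k) = fun x => ((|(k : ℝ)| ^ α : ℝ) : ℂ) * e k x :=
  ser_mul_fc_e (fun l => ((|(l : ℝ)| ^ α : ℝ) : ℂ)) k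

theorem e_mem_smoothPer (k : ℤ) : e k ∈ smoothPer := by
  refine ⟨e_periodic k, ?_⟩
  unfold e
  refine Complex.contDiff_exp.comp (contDiff_const.mul ?_)
  exact Complex.ofRealCLM.contDiff

theorem e_mem_V {N : ℕ} {k : ℤ} (hk : k ∈ Finset.Icc (-(N : ℤ)) N) : e k ∈ V N :=
  Submodule.subset_span ⟨k, by simpa using hk, rfl⟩

/-! ### Parseval -/

/-- Square integrability over one period. -/
abbrev PerL2 (f : ℝ → ℂ) : Prop := MemLp f 2 (volume.restrict (Ioc (-Real.pi) Real.pi))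

theorem PerL2.perInt {f : ℝ → ℂ} (hf : PerL2 f) : PerInt f := by
  rw [PerInt, intervalIntegrable_iff_integrableOn_Ioc_of_le neg_pi_lt_pi.le]
  exact hf.integrable (by norm_num)

theorem perL2_of_continuous {f : ℝ → ℂ} (hf : Continuous f) : PerL2 f := by
  rw [PerL2, memLp_two_iff_integrable_sq_norm hf.aestronglyMeasurable]
  exact ((hf.norm.pow 2).integrableOn_Icc (a := -Real.pi) (b := Real.pi)).mono_set Ioc_subset_Icc_self

theorem fourierCoeffOn_eq_fc (f : ℝ → ℂ) (k : ℤ) : fourierCoeffOn neg_pi_lt_pi f k = fc f k := by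
  rw [fourierCoeffOn_eq_integral, fc_eq]
  have : ∀ x : ℝ, (fourier (-k) (x : AddCircle (Real.pi - -Real.pi)) : ℂ) = e (-k) x := by
    intro x
    rw [fourier_coe_apply, e]
    congr 1
    have hpi : (Real.pi : ℂ) ≠ 0 := by exact_mod_cast Real.pi_ne_zero
    push_cast
    field_simp
    ring
  simp only [this, smul_eq_mul, mul_comm]
  rw [Complex.real_smul]
  push_cast
  ring

theorem hasSum_sq_fc {f : ℝ → ℂ} (hf : PerL2 f) :
    HasSum (fun k => ‖fc f k‖ ^ 2)
      ((2 * Real.pi)⁻¹ * ∫ x in (-Real.pi)..Real.pi, ‖f x‖ ^ 2) := by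
  have := hasSum_sq_fourierCoeffOn neg_pi_lt_pi hf
  simp only [fourierCoeffOn_eq_fc, smul_eq_mul] at this
  convert this using 2
  ring

theorem l2Norm_sq {f : ℝ → ℂ} (hf : PerL2 f) :
    l2Norm f ^ 2 = 2 * Real.pi * ∑' k, ‖fc f k‖ ^ 2 := by
  rw [(hasSum_sq_fc hf).tsum_eq, l2Norm, Real.sq_sqrt]
  · field_simp
  · exact intervalIntegral.integral_nonneg neg_pi_lt_pi.le fun x _ => by positivity

theorem ae_eq_zero_of_fc {f : ℝ → ℂ} (hf : PerL2 f) (h : ∀ k, fc f k = 0) :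
    f =ᵐ[volume.restrict (Ioc (-Real.pi) Real.pi)] 0 := by
  have h1 := (hasSum_sq_fc hf)
  simp only [h, norm_zero, ne_eq, OfNat.ofNat_ne_zero, not_false_eq_true, zero_pow] at h1
  have h2 := h1.unique hasSum_zero
  have h3 : ∫ x in (-Real.pi)..Real.pi, ‖f x‖ ^ 2 = 0 := by
    rcases mul_eq_zero.1 h2 with h | h
    · exact absurd h (by positivity)
    · exact h
  rw [intervalIntegral.integral_of_le neg_pi_lt_pi.le] at h3
  have h4 := (integral_eq_zero_iff_of_nonneg (fun x => by positivity)
    ((memLp_two_iff_integrable_sq_norm hf.1).1 hf)).1 h3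
  filter_upwards [h4] with x hx
  simpa using hx

theorem ae_eq_ser {f : ℝ → ℂ} (hf : PerL2 f) (hs : Summable fun k => ‖fc f k‖) :
    f =ᵐ[volume.restrict (Ioc (-Real.pi) Real.pi)] ser (fc f) := by
  have hg := perL2_of_continuous (continuous_ser hs)
  have := ae_eq_zero_of_fc (f := fun x => f x - ser (fc f) x) (hf.sub hg) fun k => by
    rw [fc_sub hf.perInt hg.perInt, fc_ser hs, sub_self]
  filter_upwards [this] with x hx
  exact sub_eq_zero.1 hx

theorem fc_congr_ae {f g : ℝ → ℂ} (h : f =ᵐ[volume.restrict (Ioc (-Real.pi) Real.pi)] g) (k : ℤ) :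
    fc f k = fc g k := by
  simp only [fc_eq, intervalIntegral.integral_of_le neg_pi_lt_pi.le]
  congr 1
  refine integral_congr_ae ?_
  filter_upwards [h] with x hx
  rw [hx]

theorem fc_sq {f : ℝ → ℂ} (hf : PerL2 f) (hs : Summable fun k => ‖fc f k‖) (k : ℤ) :
    HasSum (fun l => fc f l * fc f (k - l)) (fc (fun x => f x ^ 2) k) := by
  convert fc_mul_ser hf.perInt hs k using 1
  -- `f` agrees with its Fourier series only almost everywhere, which suffices for coefficients.
  refine fc_congr_ae ?_ k
  filter_upwards [ae_eq_ser hf hs] with x hx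
  rw [← hx, sq]

theorem perInt_sq {f : ℝ → ℂ} (hf : PerL2 f) : PerInt fun x => f x ^ 2 := by
  rw [PerInt, intervalIntegrable_iff_integrableOn_Ioc_of_le neg_pi_lt_pi.le]
  have := MemLp.integrable_mul hf hf
  simp only [sq]
  exact this

/-! ### The equation in Fourier modes -/

/-- The weight `1 + |k|`. -/
noncomputable def wt (k : ℤ) : ℝ := 1 + |(k : ℝ)|

/-- The multiplier `(1 + |k|^α)⁻¹`. -/
noncomputable def qm (α : ℝ) (k : ℤ) : ℝ := (1 + |(k : ℝ)| ^ α)⁻¹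

/-- The quadratic symbol of the variational form. -/
noncomputable def sym (α κ₂ γ : ℝ) (k l : ℤ) : ℝ :=
  3 / 2 * γ * k + κ₂ * (2 * |(k : ℝ)| ^ α * l + |(l : ℝ)| ^ α * l)

/-- The quadratic symbol of the evolution equation. -/
noncomputable def sig (α κ₂ γ : ℝ) (k l : ℤ) : ℝ := qm α k * sym α κ₂ γ k l

/-- The vector field of the evolution equation on sequences of Fourier coefficients. -/
noncomputable def fld (α κ₁ κ₂ γ : ℝ) (a : ℤ → ℂ) (k : ℤ) : ℂ :=
  -Complex.I * ((κ₁ * k * qm α k : ℝ) * a k +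
    ∑' l : ℤ, (sig α κ₂ γ k l : ℂ) * (a (k - l) * a l))

/-- The coefficients `a` evolve by the mode equations for the indices in `F`. -/
structure ModeSol (α κ₁ κ₂ γ T : ℝ) (F : Set ℤ) (a : ℝ → ℤ → ℂ) : Prop where
  cont : ∀ k, ContinuousOn (fun t => a t k) (Icc 0 T)
  deriv : ∀ k ∈ F, ∀ t ∈ Ioc 0 T,
    HasDerivWithinAt (fun s => a s k) (fld α κ₁ κ₂ γ (a t) k) (Icc 0 T) t

theorem one_le_wt (k : ℤ) : 1 ≤ wt k := by unfold wt; linarith [abs_nonneg (k : ℝ)]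

theorem wt_pos (k : ℤ) : 0 < wt k := one_pos.trans_le (one_le_wt k)

theorem abs_le_wt (k : ℤ) : |(k : ℝ)| ≤ wt k := by unfold wt; linarith

theorem qm_pos (α : ℝ) (k : ℤ) : 0 < qm α k := by unfold qm; positivity

theorem abs_rpow_le_wt {α : ℝ} (hα : 0 ≤ α) (k : ℤ) : |(k : ℝ)| ^ α ≤ wt k ^ α :=
  Real.rpow_le_rpow (abs_nonneg _) (abs_le_wt k) hα

theorem abs_rpow_mul_abs_le_wt {α : ℝ} (hα : 0 ≤ α) (k : ℤ) :
    |(k : ℝ)| ^ α * |(k : ℝ)| ≤ wt k ^ (α + 1) := by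
  rw [Real.rpow_add_one (wt_pos k).ne']
  exact mul_le_mul (abs_rpow_le_wt hα k) (abs_le_wt k) (abs_nonneg _)
    (Real.rpow_nonneg (wt_pos k).le _)

theorem wt_le_wt_rpow {α : ℝ} (hα : 0 ≤ α) (k : ℤ) : wt k ≤ wt k ^ (α + 1) := by
  conv_lhs => rw [← Real.rpow_one (wt k)]
  exact Real.rpow_le_rpow_of_exponent_le (one_le_wt k) (by linarith)

theorem one_le_wt_rpow {β : ℝ} (hβ : 0 ≤ β) (k : ℤ) : 1 ≤ wt k ^ β :=
  Real.one_le_rpow (one_le_wt k) hβ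

theorem summable_of_wt {α : ℝ} {a m : ℤ → ℂ}
    (hs : Summable fun k => wt k ^ (α + 1) * ‖a k‖) {C : ℝ}
    (hm : ∀ k, ‖m k‖ ≤ C * wt k ^ (α + 1)) : Summable fun k => ‖m k * a k‖ := by
  refine Summable.of_nonneg_of_le (fun _ => norm_nonneg _) (fun k => ?_) (hs.mul_left C)
  rw [norm_mul, ← mul_assoc]
  gcongr
  exact hm k

/-- The weight `wt ^ (α + 1)` makes the series of `v_x` and `D^α v_x` absolutely convergent, so
every product turns into a convolution. The multiplier on the test function becomes the factor
`|k|^α` in `sym`. -/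
theorem rhs_e {α : ℝ} (hα : 0 ≤ α) (κ₁ κ₂ γ : ℝ) {v : ℝ → ℂ} (hv : PerL2 v)
    (hs : Summable fun k => wt k ^ (α + 1) * ‖fc v k‖) (k : ℤ) :
    rhs α κ₁ κ₂ γ v (e k) = 2 * Real.pi * ((1 + |(k : ℝ)| ^ α : ℝ) : ℂ) *
      fld α κ₁ κ₂ γ (fc v) k := by
  have s0 : Summable fun l => ‖fc v l‖ := by
    simpa using summable_of_wt hs (m := fun _ => 1) (C := 1) fun l => by
      simpa using one_le_wt_rpow (by linarith) l
  have s1 : Summable fun l : ℤ => ‖Complex.I * l * fc v l‖ :=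
    summable_of_wt hs (m := fun l : ℤ => Complex.I * l) (C := 1) fun l => by
      have := (abs_le_wt l).trans (wt_le_wt_rpow hα l)
      simpa using this
  have s2 : Summable fun l : ℤ =>
      ‖((|(l : ℝ)| ^ α : ℝ) : ℂ) * (Complex.I * l * fc v l)‖ := by
    have := summable_of_wt hs
      (m := fun l : ℤ => ((|(l : ℝ)| ^ α : ℝ) : ℂ) * (Complex.I * l)) (C := 1) fun l => by
      have := abs_rpow_mul_abs_le_wt hα l
      simpa [abs_of_nonneg (Real.rpow_nonneg (abs_nonneg (l : ℝ)) α)] using this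
    simpa only [mul_assoc] using this
  have hdx : ∀ l, fc (dx v) l = Complex.I * l * fc v l := fun l => fc_ser s1 l
  have hfl : fracLap α (dx v) = ser fun l : ℤ =>
      ((|(l : ℝ)| ^ α : ℝ) : ℂ) * (Complex.I * l * fc v l) := by
    ext x
    simp only [fracLap, hdx, ser]
  have h0 := fc_sq hv s0 k
  have h1 := fc_mul_ser hv.perInt s1 k
  have h2 := fc_mul_ser hv.perInt s2 k
  rw [← hfl] at h2
  change HasSum _ (fc (fun x => v x * dx v x) k) at h1
  have hflux : fc (flux κ₁ γ v) k = κ₁ * fc v k + 3 / 2 * γ * fc (fun x => v x ^ 2) k := by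
    unfold flux
    rw [fc_add (hv.perInt.const_mul _) ((perInt_sq hv).const_mul _), fc_const_mul, fc_const_mul]
  have key : HasSum (fun l => (sym α κ₂ γ k l : ℂ) * (fc v (k - l) * fc v l))
      (3 / 2 * γ * k * fc (fun x => v x ^ 2) k - Complex.I * (κ₂ *
        (2 * (((|(k : ℝ)| ^ α : ℝ) : ℂ) * fc (fun x => v x * dx v x) k) +
          fc (fun x => v x * fracLap α (dx v) x) k))) := by
    have := (h0.mul_left (3 / 2 * γ * k : ℂ)).sub ((((h1.mul_left
      (((|(k : ℝ)| ^ α : ℝ) : ℂ))).mul_left 2).add h2).mul_left (κ₂ : ℂ) |>.mul_left Complex.I)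
    have e1 : ∀ l : ℤ, (sym α κ₂ γ k l : ℂ) * (fc v (k - l) * fc v l) =
        3 / 2 * γ * k * (fc v l * fc v (k - l)) - Complex.I * (κ₂ *
        (2 * (((|(k : ℝ)| ^ α : ℝ) : ℂ) * (Complex.I * l * fc v l * fc v (k - l))) +
          ((|(l : ℝ)| ^ α : ℝ) : ℂ) * (Complex.I * l * fc v l) * fc v (k - l))) := by
      intro l
      rw [sym]
      push_cast
      linear_combination (κ₂ * (2 * ((|(k : ℝ)| ^ α : ℝ) : ℂ) + ((|(l : ℝ)| ^ α : ℝ) : ℂ)) * l *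
        fc v l * fc v (k - l)) * Complex.I_sq
    simpa only [e1] using this
  have hq : ((1 + |(k : ℝ)| ^ α : ℝ) : ℂ) * (qm α k : ℂ) = 1 := by
    rw [← Complex.ofReal_mul, qm, mul_inv_cancel₀ (by positivity), Complex.ofReal_one]
  have hsig : ∑' l, (sig α κ₂ γ k l : ℂ) * (fc v (k - l) * fc v l) = qm α k *
      ∑' l, (sym α κ₂ γ k l : ℂ) * (fc v (k - l) * fc v l) := by
    rw [← tsum_mul_left]
    congr 1; ext l
    simp only [sig]; push_cast; ring
  rw [fld, hsig, key.tsum_eq, rhs, dx_e, fracLap_e, ip_const_mul_e, ip_const_mul_e, ip_e, hflux]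
  have hI : (starRingEnd ℂ) (Complex.I * k) = -Complex.I * k := by simp
  rw [hI, Complex.conj_ofReal]
  set Q : ℂ := ((1 + |(k : ℝ)| ^ α : ℝ) : ℂ)
  set R : ℂ := ((|(k : ℝ)| ^ α : ℝ) : ℂ)
  set A := fc (fun x => v x ^ 2) k
  set B := fc (fun x => v x * dx v x) k
  set D := fc (fun x => v x * fracLap α (dx v) x) k
  push_cast
  linear_combination (2 * Real.pi * Complex.I * (κ₁ * k * fc v k + 3 / 2 * γ * k * A)
    + 2 * Real.pi * κ₂ * (2 * (R * B) + D)) * hq -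
    2 * Real.pi * Q * qm α k * κ₂ * (2 * (R * B) + D) * Complex.I_sq

/-- Characters are the only test functions used. The left side of the weak equation is `2π (1 +
|k|^α)` times the coefficient, and this nonzero factor is divided out. -/
theorem modeSol_of_variational {α : ℝ} (hα : 0 ≤ α) {κ₁ κ₂ γ T : ℝ} {S : Set (ℝ → ℂ)}
    {F : Set ℤ} (hF : ∀ k ∈ F, e k ∈ S) {v : ℝ → ℝ → ℂ} (hv : ∀ t ∈ Icc 0 T, PerL2 (v t))
    (hs : ∀ t ∈ Icc 0 T, Summable fun k => wt k ^ (α + 1) * ‖fc (v t) k‖)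
    (hc : ∀ k, ContinuousOn (fun t => fc (v t) k) (Icc 0 T))
    (h : Variational α κ₁ κ₂ γ T S v) : ModeSol α κ₁ κ₂ γ T F (fun t => fc (v t)) := by
  refine ⟨hc, fun k hk t ht => ?_⟩
  have ht' : t ∈ Icc 0 T := Ioc_subset_Icc_self ht
  have h1 := h (e k) (hF k hk) t ht
  have hQ : ((1 + |(k : ℝ)| ^ α : ℝ) : ℂ) ≠ 0 := by
    rw [Complex.ofReal_ne_zero]; positivity
  have hpi : (Real.pi : ℂ) ≠ 0 := by exact_mod_cast Real.pi_ne_zero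
  rw [rhs_e hα κ₁ κ₂ γ (hv t ht') (hs t ht')] at h1
  simp only [fracLap_e, ip_const_mul_e, ip_e, Complex.conj_ofReal] at h1
  have h2 := h1.const_mul (2 * Real.pi * ((1 + |(k : ℝ)| ^ α : ℝ) : ℂ))⁻¹
  have hne := mul_ne_zero (mul_ne_zero (two_ne_zero (α := ℂ)) hpi) hQ
  rw [inv_mul_cancel_left₀ hne] at h2
  refine h2.congr_of_mem (fun s _ => ?_) ht'
  rw [eq_inv_mul_iff_mul_eq₀ hne]
  push_cast
  ring

/-! ### Sobolev norms -/

theorem hsNorm_sq {s : ℝ} {f : ℝ → ℂ} :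
    hsNorm s f ^ 2 = ∑' k : ℤ, (1 + (k : ℝ) ^ 2) ^ s * ‖fc f k‖ ^ 2 :=
  Real.sq_sqrt (tsum_nonneg fun k => by positivity)

theorem MemHs.sub {s : ℝ} {f g : ℝ → ℂ} (hf : MemHs s f) (hg : MemHs s g) :
    MemHs s fun x => f x - g x := by
  refine ⟨hf.periodic.sub hg.periodic, hf.memLp.sub hg.memLp, ?_⟩
  refine Summable.of_nonneg_of_le (fun _ => by positivity) (fun k => ?_)
    ((hf.summable.mul_left 2).add (hg.summable.mul_left 2))
  rw [fc_sub (PerL2.perInt hf.memLp) (PerL2.perInt hg.memLp)]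
  have h : ‖fc f k - fc g k‖ ^ 2 ≤ 2 * ‖fc f k‖ ^ 2 + 2 * ‖fc g k‖ ^ 2 := by
    have := norm_sub_le (fc f k) (fc g k)
    nlinarith [sq_nonneg (‖fc f k‖ - ‖fc g k‖), norm_nonneg (fc f k - fc g k)]
  have hp : 0 ≤ (1 + (k : ℝ) ^ 2) ^ s := by positivity
  nlinarith [mul_le_mul_of_nonneg_left h hp]

theorem one_le_bracket {s : ℝ} (hs : 0 ≤ s) (k : ℤ) : 1 ≤ (1 + (k : ℝ) ^ 2) ^ s :=
  Real.one_le_rpow (by nlinarith [sq_nonneg (k : ℝ)]) hs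

theorem norm_fc_le_hsNorm {s : ℝ} (hs : 0 ≤ s) {f : ℝ → ℂ} (hf : MemHs s f) (k : ℤ) :
    ‖fc f k‖ ≤ hsNorm s f := by
  refine le_of_sq_le_sq ?_ (Real.sqrt_nonneg _)
  rw [hsNorm_sq]
  refine le_trans ?_ (hf.summable.le_tsum k fun _ _ => by positivity)
  exact le_mul_of_one_le_left (by positivity) (one_le_bracket hs k)

theorem ContInHs.continuousOn_fc {s T : ℝ} (hs : 0 ≤ s) {u : ℝ → ℝ → ℂ} (hu : ContInHs s T u)
    (k : ℤ) : ContinuousOn (fun t => fc (u t) k) (Icc 0 T) := by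
  intro t₀ ht₀
  rw [ContinuousWithinAt, tendsto_iff_norm_sub_tendsto_zero]
  refine squeeze_zero' (Eventually.of_forall fun _ => norm_nonneg _) ?_ (hu.cont t₀ ht₀)
  filter_upwards [self_mem_nhdsWithin] with t ht
  rw [← fc_sub (PerL2.perInt (hu.mem t ht).memLp) (PerL2.perInt (hu.mem t₀ ht₀).memLp)]
  exact norm_fc_le_hsNorm hs ((hu.mem t ht).sub (hu.mem t₀ ht₀)) k

/-! ### Bounds for the quadratic symbol -/

/-- Bernoulli's inequality for `(p / q) ^ α`, that is, the tangent line of `x ^ α` at `q` lies below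
the graph. -/
theorem rpow_sub_rpow_le {α p q : ℝ} (hα : 1 ≤ α) (hp : 0 ≤ p) (hpq : p ≤ q) :
    q ^ α - p ^ α ≤ α * (q - p) * q ^ (α - 1) := by
  rcases (hp.trans hpq).eq_or_lt with h | hq
  · have : p = 0 := le_antisymm (h ▸ hpq) hp
    subst h; subst this; simp
  · have h1 := one_add_mul_self_le_rpow_one_add (s := p / q - 1) (p := α)
      (by linarith [div_nonneg hp hq.le]) hα
    rw [add_sub_cancel, Real.div_rpow hp hq.le, le_div_iff₀ (by positivity)] at h1
    have h2 : q ^ α = q * q ^ (α - 1) := by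
      rw [mul_comm, ← Real.rpow_add_one hq.ne']; ring_nf
    have h3 : (1 + α * (p / q - 1)) * q ^ α = q ^ α + α * (p - q) * q ^ (α - 1) := by
      rw [h2]; field_simp
    linarith

theorem abs_rpow_sub_rpow_le {α p q m : ℝ} (hα : 1 ≤ α) (hp : 0 ≤ p) (hq : 0 ≤ q)
    (hpm : p ≤ m) (hqm : q ≤ m) : |q ^ α - p ^ α| ≤ α * |q - p| * m ^ (α - 1) := by
  rcases le_total p q with h | h
  · rw [abs_of_nonneg (by linarith [Real.rpow_le_rpow hp h (by linarith : 0 ≤ α)]),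
      abs_of_nonneg (by linarith)]
    refine (rpow_sub_rpow_le hα hp h).trans ?_
    have := Real.rpow_le_rpow hq hqm (by linarith : 0 ≤ α - 1)
    exact mul_le_mul_of_nonneg_left this (mul_nonneg (by linarith) (by linarith))
  · rw [abs_sub_comm, abs_sub_comm q, abs_of_nonneg
      (by linarith [Real.rpow_le_rpow hq h (by linarith : 0 ≤ α)]), abs_of_nonneg (by linarith)]
    refine (rpow_sub_rpow_le hα hq h).trans ?_
    have := Real.rpow_le_rpow hp hpm (by linarith : 0 ≤ α - 1)
    exact mul_le_mul_of_nonneg_left this (mul_nonneg (by linarith) (by linarith))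

/-- The part of order zero of the quadratic symbol. -/
noncomputable def rho (α κ₂ γ : ℝ) (k l : ℤ) : ℝ := sig α κ₂ γ k l - 3 * κ₂ * l

/-- The constant in the symbol bounds. -/
noncomputable def symC (κ₂ γ : ℝ) : ℝ := 2 * |γ| + 40 * |κ₂|

theorem symC_nonneg (κ₂ γ : ℝ) : 0 ≤ symC κ₂ γ := by unfold symC; positivity

/-- Multiplying `3 κ₂ l` by `qm(k) (1 + |k|^α) = 1` cancels the leading terms and leaves the
difference `|l|^α - |k|^α`. -/
theorem rho_eq (α κ₂ γ : ℝ) (k l : ℤ) : rho α κ₂ γ k l =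
    3 / 2 * γ * (qm α k * k) +
      κ₂ * (qm α k * (l * (|(l : ℝ)| ^ α - |(k : ℝ)| ^ α)) - 3 * (qm α k * l)) := by
  have : qm α k * (1 + |(k : ℝ)| ^ α) = 1 := inv_mul_cancel₀ (by positivity)
  rw [rho, sig, sym]
  linear_combination (3 * κ₂ * l) * this

theorem abs_le_one_add_rpow {α : ℝ} (hα : 1 ≤ α) {p : ℝ} (hp : 0 ≤ p) : p ≤ 1 + p ^ α := by
  rcases le_total p 1 with h | h
  · linarith [Real.rpow_nonneg hp α]
  · linarith [Real.self_le_rpow_of_one_le h hα]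

theorem one_add_rpow_le {α : ℝ} (hα : α ∈ Icc (1 : ℝ) 2) {p : ℝ} (hp : 0 ≤ p) :
    (1 + p) ^ α ≤ 4 * (1 + p ^ α) := by
  have h4 : (2 : ℝ) ^ α ≤ 4 := by
    calc (2 : ℝ) ^ α ≤ 2 ^ (2 : ℝ) := Real.rpow_le_rpow_of_exponent_le (by norm_num) hα.2
      _ = 4 := by norm_num
  have hα0 : 0 ≤ α := by linarith [hα.1]
  rcases le_total p 1 with h | h
  · have := Real.rpow_le_rpow (by linarith) (by linarith : 1 + p ≤ 2) hα0
    linarith [Real.rpow_nonneg hp α]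
  · have := Real.rpow_le_rpow (by linarith) (by linarith : 1 + p ≤ 2 * p) hα0
    rw [Real.mul_rpow (by norm_num) hp] at this
    nlinarith [Real.rpow_nonneg hp α]

theorem qm_mul_abs_le {α : ℝ} (hα : 1 ≤ α) (k : ℤ) : qm α k * |(k : ℝ)| ≤ 1 := by
  rw [qm, inv_mul_le_iff₀ (by positivity), mul_one]
  exact abs_le_one_add_rpow hα (abs_nonneg _)

theorem qm_le_one (α : ℝ) (k : ℤ) : qm α k ≤ 1 := by
  rw [qm]
  exact inv_le_one_of_one_le₀ (by linarith [Real.rpow_nonneg (abs_nonneg (k : ℝ)) α])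

theorem abs_cast_le_add_sub (k l : ℤ) : |(l : ℝ)| ≤ |(k : ℝ)| + |((k - l : ℤ) : ℝ)| := by
  have := abs_sub (k : ℝ) ((k - l : ℤ) : ℝ)
  push_cast at this ⊢
  simpa using this

/-- By the mean value bound, `|l|^α - |k|^α` gains a factor `|k - l|` and loses one power of the
larger frequency, which the prefactor `l` restores. The resulting power `α` is then killed by
`qm(k)` at the cost of powers of `wt (k - l)`. The margin `3 * |κ₂|` left below `symC` pays for
adding the transport part back later. -/
theorem abs_rho_le_wt_sub {α : ℝ} (hα : α ∈ Icc (1 : ℝ) 2) (κ₂ γ : ℝ) (k l : ℤ) :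
    |rho α κ₂ γ k l| ≤ (symC κ₂ γ - 3 * |κ₂|) * wt (k - l) ^ (α + 1) := by
  have hα0 : 0 ≤ α := by linarith [hα.1]
  have hq := qm_pos α k
  have hl := abs_cast_le_add_sub k l
  set p := |(k : ℝ)| with hp
  set q := |(l : ℝ)| with hqd
  set D := |((k - l : ℤ) : ℝ)| with hD
  have hp0 : 0 ≤ p := abs_nonneg _
  have hq0 : 0 ≤ q := abs_nonneg _
  have hD0 : 0 ≤ D := abs_nonneg _
  have hW1 : 1 ≤ wt (k - l) ^ (α + 1) := one_le_wt_rpow (by linarith) _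
  have hDW : wt (k - l) ≤ wt (k - l) ^ (α + 1) := wt_le_wt_rpow hα0 _
  have hwt : wt (k - l) = 1 + D := rfl
  have hqp : |q - p| ≤ D := by
    have := abs_abs_sub_abs_le (l : ℝ) k
    rwa [abs_sub_comm (l : ℝ), ← Int.cast_sub] at this
  have t1 : |qm α k * k| ≤ 1 := by
    rw [abs_mul, abs_of_pos hq]; exact qm_mul_abs_le hα.1 k
  have t2 : |qm α k * l| ≤ wt (k - l) ^ (α + 1) := by
    rw [abs_mul, abs_of_pos hq, ← hqd]
    have h1 := qm_mul_abs_le hα.1 k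
    have h2 : qm α k * q ≤ qm α k * (p + D) := mul_le_mul_of_nonneg_left hl hq.le
    have h3 : qm α k * D ≤ D := mul_le_of_le_one_left hD0 (qm_le_one α k)
    rw [← hp] at h1
    rw [hwt] at hDW
    rw [hwt]
    linarith
  have t3 : |qm α k * (l * (q ^ α - p ^ α))| ≤ 16 * wt (k - l) ^ (α + 1) := by
    rw [abs_mul, abs_of_pos hq, abs_mul, ← hqd]
    have h1 := abs_rpow_sub_rpow_le hα.1 hp0 hq0 (by linarith : p ≤ p + D) hl
    have h2 : q * |q ^ α - p ^ α| ≤ α * D * (p + D) ^ α := by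
      rcases (add_nonneg hp0 hD0).eq_or_lt with h0 | h0
      · have e1 : q = 0 := by linarith
        rw [e1, zero_mul]; positivity
      · have e2 : (p + D) ^ α = (p + D) ^ (α - 1) * (p + D) := by
          rw [← Real.rpow_add_one h0.ne']; ring_nf
        have hnn := Real.rpow_nonneg h0.le (α - 1)
        calc q * |q ^ α - p ^ α| ≤ (p + D) * (α * |q - p| * (p + D) ^ (α - 1)) := by
              gcongr
          _ ≤ (p + D) * (α * D * (p + D) ^ (α - 1)) := by gcongr
          _ = _ := by rw [e2]; ring
    -- Peetre-type splitting `p + D ≤ (1 + p) (1 + D)`; the first factor is absorbed by `qm α k`.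
    have h3 : (p + D) ^ α ≤ 4 * (1 + p ^ α) * (1 + D) ^ α := by
      calc (p + D) ^ α ≤ ((1 + p) * (1 + D)) ^ α :=
            Real.rpow_le_rpow (by positivity) (by nlinarith) hα0
        _ = (1 + p) ^ α * (1 + D) ^ α := Real.mul_rpow (by positivity) (by positivity)
        _ ≤ _ := by gcongr; exact one_add_rpow_le hα hp0
    have hW : wt (k - l) ^ (α + 1) = (1 + D) ^ α * (1 + D) := by
      rw [hwt, Real.rpow_add_one (by positivity)]
    rw [qm, inv_mul_le_iff₀ (by positivity), ← hp, hW]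
    have hpa : 0 ≤ p ^ α := by positivity
    calc q * |q ^ α - p ^ α| ≤ α * D * (p + D) ^ α := h2
      _ ≤ 2 * (1 + D) * (4 * (1 + p ^ α) * (1 + D) ^ α) := by
          gcongr
          · exact hα.2
          · linarith
      _ ≤ _ := by
          have : 0 ≤ (1 + p ^ α) * ((1 + D) ^ α * (1 + D)) := by positivity
          linarith
  rw [rho_eq, ← hp, ← hqd]
  have hA := abs_add_le (3 / 2 * γ * (qm α k * k))
    (κ₂ * (qm α k * (l * (q ^ α - p ^ α)) - 3 * (qm α k * l)))
  have hB := abs_sub (qm α k * (l * (q ^ α - p ^ α))) (3 * (qm α k * l))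
  have hC : |3 / 2 * γ * (qm α k * k)| ≤ 2 * |γ| * wt (k - l) ^ (α + 1) := by
    rw [abs_mul, abs_mul, abs_of_pos (by norm_num : (0 : ℝ) < 3 / 2)]
    have : 3 / 2 * |γ| ≤ 2 * |γ| := by linarith [abs_nonneg γ]
    exact mul_le_mul this (t1.trans hW1) (abs_nonneg _) (by positivity)
  rw [abs_mul κ₂] at hA
  rw [abs_mul 3, abs_of_pos (by norm_num : (0 : ℝ) < 3)] at hB
  have hE : |κ₂| * |qm α k * (l * (q ^ α - p ^ α)) - 3 * (qm α k * l)| ≤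
      |κ₂| * (19 * wt (k - l) ^ (α + 1)) :=
    mul_le_mul_of_nonneg_left (by linarith) (abs_nonneg _)
  have hF : 0 ≤ |κ₂| * wt (k - l) ^ (α + 1) := by positivity
  rw [symC]
  linarith

/-- Here no cancellation is used: `qm(k) |k|^α ≤ 1` and all powers are placed on `l`. This serves
the interactions in which `l` is the low frequency. -/
theorem abs_rho_le_wt_right {α : ℝ} (hα : α ∈ Icc (1 : ℝ) 2) (κ₂ γ : ℝ) (k l : ℤ) :
    |rho α κ₂ γ k l| ≤ (symC κ₂ γ - 3 * |κ₂|) * wt l ^ (α + 1) := by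
  have hα0 : 0 ≤ α := by linarith [hα.1]
  have hq := qm_pos α k
  have hq1 := qm_le_one α k
  have hW1 : 1 ≤ wt l ^ (α + 1) := one_le_wt_rpow (by linarith) _
  have hDW := (abs_le_wt l).trans (wt_le_wt_rpow hα0 l)
  have hla := abs_rpow_mul_abs_le_wt hα0 l
  set p := |(k : ℝ)| with hp
  set q := |(l : ℝ)| with hqd
  have hp0 : 0 ≤ p := abs_nonneg _
  have hq0 : 0 ≤ q := abs_nonneg _
  have t1 : |qm α k * k| ≤ 1 := by
    rw [abs_mul, abs_of_pos hq]; exact qm_mul_abs_le hα.1 k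
  have t2 : |qm α k * l| ≤ wt l ^ (α + 1) := by
    rw [abs_mul, abs_of_pos hq, ← hqd]
    exact (mul_le_of_le_one_left hq0 hq1).trans hDW
  have t3 : |qm α k * (l * (q ^ α - p ^ α))| ≤ 2 * wt l ^ (α + 1) := by
    rw [abs_mul, abs_of_pos hq, abs_mul, ← hqd]
    have h1 : |q ^ α - p ^ α| ≤ q ^ α + p ^ α := by
      refine (abs_sub _ _).trans (le_of_eq ?_)
      rw [abs_of_nonneg (by positivity), abs_of_nonneg (by positivity)]
    have h2 : qm α k * p ^ α ≤ 1 := by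
      rw [qm, inv_mul_le_iff₀ (by positivity)]; linarith
    calc qm α k * (q * |q ^ α - p ^ α|) ≤ qm α k * (q * (q ^ α + p ^ α)) := by gcongr
      _ = qm α k * (q ^ α * q) + (qm α k * p ^ α) * q := by ring
      _ ≤ 1 * (q ^ α * q) + 1 * q := by gcongr
      _ ≤ _ := by linarith
  rw [rho_eq, ← hp, ← hqd]
  have hA := abs_add_le (3 / 2 * γ * (qm α k * k))
    (κ₂ * (qm α k * (l * (q ^ α - p ^ α)) - 3 * (qm α k * l)))
  have hB := abs_sub (qm α k * (l * (q ^ α - p ^ α))) (3 * (qm α k * l))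
  have hC : |3 / 2 * γ * (qm α k * k)| ≤ 2 * |γ| * wt l ^ (α + 1) := by
    rw [abs_mul, abs_mul, abs_of_pos (by norm_num : (0 : ℝ) < 3 / 2)]
    have : 3 / 2 * |γ| ≤ 2 * |γ| := by linarith [abs_nonneg γ]
    exact mul_le_mul this (t1.trans hW1) (abs_nonneg _) (by positivity)
  rw [abs_mul κ₂] at hA
  rw [abs_mul 3, abs_of_pos (by norm_num : (0 : ℝ) < 3)] at hB
  have hE : |κ₂| * |qm α k * (l * (q ^ α - p ^ α)) - 3 * (qm α k * l)| ≤
      |κ₂| * (19 * wt l ^ (α + 1)) :=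
    mul_le_mul_of_nonneg_left (by linarith) (abs_nonneg _)
  have hF : 0 ≤ |κ₂| * wt l ^ (α + 1) := by positivity
  rw [symC]
  linarith

theorem abs_sig_le {α : ℝ} (hα : α ∈ Icc (1 : ℝ) 2) (κ₂ γ : ℝ) (k l : ℤ) :
    |sig α κ₂ γ k l| ≤ symC κ₂ γ * wt l ^ (α + 1) := by
  have h1 := abs_rho_le_wt_right hα κ₂ γ k l
  have h2 := (abs_le_wt l).trans (wt_le_wt_rpow (by linarith [hα.1] : 0 ≤ α) l)
  have h3 : sig α κ₂ γ k l = rho α κ₂ γ k l + 3 * κ₂ * l := by rw [rho]; ring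
  have h4 : |3 * κ₂ * l| ≤ 3 * |κ₂| * wt l ^ (α + 1) := by
    rw [abs_mul, abs_mul, abs_of_pos (by norm_num : (0 : ℝ) < 3)]
    gcongr
  rw [h3]
  linarith [abs_add_le (rho α κ₂ γ k l) (3 * κ₂ * l)]

theorem wt_neg (k : ℤ) : wt (-k) = wt k := by simp [wt]

theorem wt_sub_comm (k l : ℤ) : wt (k - l) = wt (l - k) := by rw [← wt_neg, neg_sub]

/-- The transport parts differ by `3 κ₂ (l - k)`, so antisymmetrization removes the only part of
order one. -/
theorem abs_sig_sub_sig_le {α : ℝ} (hα : α ∈ Icc (1 : ℝ) 2) (κ₂ γ : ℝ) (k l : ℤ) :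
    |sig α κ₂ γ k l - sig α κ₂ γ l k| ≤ 2 * symC κ₂ γ * wt (k - l) ^ (α + 1) := by
  have h1 := abs_rho_le_wt_sub hα κ₂ γ k l
  have h1' := abs_rho_le_wt_sub hα κ₂ γ l k
  rw [wt_sub_comm l k] at h1'
  have h2 := (abs_le_wt (k - l)).trans (wt_le_wt_rpow (by linarith [hα.1] : 0 ≤ α) (k - l))
  have h3 : sig α κ₂ γ k l - sig α κ₂ γ l k = rho α κ₂ γ k l - rho α κ₂ γ l k
      - 3 * κ₂ * ((k - l : ℤ) : ℝ) := by rw [rho, rho]; push_cast; ring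
  have h4 : |3 * κ₂ * ((k - l : ℤ) : ℝ)| ≤ 3 * |κ₂| * wt (k - l) ^ (α + 1) := by
    rw [abs_mul, abs_mul, abs_of_pos (by norm_num : (0 : ℝ) < 3)]
    gcongr
  rw [h3]
  have h5 : 0 ≤ |κ₂| * wt (k - l) ^ (α + 1) :=
    mul_nonneg (abs_nonneg _) (Real.rpow_nonneg (wt_pos _).le _)
  have h6 := abs_sub (rho α κ₂ γ k l - rho α κ₂ γ l k) (3 * κ₂ * ((k - l : ℤ) : ℝ))
  have h7 := abs_sub (rho α κ₂ γ k l) (rho α κ₂ γ l k)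
  linarith

theorem sig_neg (α κ₂ γ : ℝ) (k l : ℤ) : sig α κ₂ γ (-k) (-l) = -sig α κ₂ γ k l := by
  simp only [sig, sym, qm]; push_cast; simp only [abs_neg]; ring

/-! ### Trilinear sums -/

theorem trilinear_aux (F : Finset ℤ) {f h : ℤ → ℝ} (hs : Summable fun k => h k ^ 2) (l : ℤ) :
    ∑ k ∈ F, f k * h (k - l) ≤ √(∑ k ∈ F, f k ^ 2) * √(∑' k, h k ^ 2) := by
  refine (Real.sum_mul_le_sqrt_mul_sqrt F f fun k => h (k - l)).trans
    (mul_le_mul_of_nonneg_left (Real.sqrt_le_sqrt ?_) (Real.sqrt_nonneg _))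
  have hs' : Summable fun k => h (k - l) ^ 2 :=
    (Equiv.subRight l).summable_iff (f := fun k => h k ^ 2).2 hs
  rw [← (Equiv.subRight l).tsum_eq (fun k => h k ^ 2)]
  exact hs'.sum_le_tsum F fun _ _ => sq_nonneg _

theorem abs_le_sqrt_tsum_sq {h : ℤ → ℝ} (hs : Summable fun k => h k ^ 2) (k : ℤ) :
    |h k| ≤ √(∑' k, h k ^ 2) := by
  exact Real.abs_le_sqrt (hs.le_tsum k fun _ _ => sq_nonneg _)

theorem summable_mul_shift {g h : ℤ → ℝ} (hg0 : ∀ k, 0 ≤ g k) (hg : Summable g)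
    (hs : Summable fun k => h k ^ 2) (k : ℤ) : Summable fun l => g l * h (k - l) := by
  refine Summable.of_norm_bounded (hg.mul_right (√(∑' k, h k ^ 2))) fun l => ?_
  rw [norm_mul, Real.norm_of_nonneg (hg0 l)]
  gcongr
  · exact hg0 l
  · exact abs_le_sqrt_tsum_sq hs _

theorem summable_mul_shift' {g h : ℤ → ℝ} (hg0 : ∀ k, 0 ≤ g k) (hg : Summable g)
    (hs : Summable fun k => h k ^ 2) (k : ℤ) : Summable fun l => g (k - l) * h l := by
  rw [← (Equiv.subLeft k).summable_iff]
  simpa [Function.comp_def] using summable_mul_shift hg0 hg hs k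

theorem tsum_mul_shift (g h : ℤ → ℝ) (k : ℤ) :
    ∑' l, g (k - l) * h l = ∑' l, g l * h (k - l) := by
  rw [← (Equiv.subLeft k).tsum_eq]
  simp

/-- Young's inequality `ℓ² · (ℓ¹ * ℓ²)`: Cauchy–Schwarz in `k` for each fixed `l`, then summation
against `g l`. -/
theorem trilinear_le (F : Finset ℤ) {f g h : ℤ → ℝ} (hg0 : ∀ k, 0 ≤ g k) (hg : Summable g)
    (hs : Summable fun k => h k ^ 2) :
    ∑ k ∈ F, f k * ∑' l, g l * h (k - l) ≤
      √(∑ k ∈ F, f k ^ 2) * (∑' l, g l) * √(∑' k, h k ^ 2) := by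
  have h1 : ∑ k ∈ F, f k * ∑' l, g l * h (k - l) = ∑' l, ∑ k ∈ F, g l * (f k * h (k - l)) := by
    rw [Summable.tsum_finsetSum]
    · refine Finset.sum_congr rfl fun k _ => ?_
      rw [← tsum_mul_left]
      congr 1; ext l; ring
    · intro k _
      simpa only [mul_left_comm] using (summable_mul_shift hg0 hg hs k).mul_left (f k)
  rw [h1]
  have h2 : Summable fun l => ∑ k ∈ F, g l * (f k * h (k - l)) := by
    refine summable_sum fun k _ => ?_
    simpa only [mul_left_comm] using (summable_mul_shift hg0 hg hs k).mul_left (f k)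
  rw [mul_right_comm, mul_comm, ← tsum_mul_right]
  refine h2.tsum_le_tsum (fun l => ?_) (hg.mul_right _)
  rw [← Finset.mul_sum]
  exact mul_le_mul_of_nonneg_left (trilinear_aux F hs l) (hg0 l)

/-! ### A barrier principle -/

/-- The derivative has to be controlled only at times where `f` touches the barrier. There the size
of `f` is known exactly, so superlinear terms can be estimated without a separate continuation
argument. -/
theorem le_barrier {T B Λ : ℝ} {f f' : ℝ → ℝ} (hf : ContinuousOn f (Icc 0 T))
    (hf' : ∀ t ∈ Ioc 0 T, HasDerivWithinAt f (f' t) (Icc 0 T) t) (h0 : f 0 < B)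
    (hb : ∀ t ∈ Ioc 0 T, f t = B * Real.exp (Λ * t) → f' t < Λ * (B * Real.exp (Λ * t))) :
    ∀ t ∈ Icc 0 T, f t ≤ B * Real.exp (Λ * t) := by
  intro t ht
  rcases ht.1.eq_or_lt with h | htpos
  · simpa [← h] using h0.le
  have hT : 0 < T := htpos.trans_le ht.2
  set b : ℝ → ℝ := fun t => B * Real.exp (Λ * t) with hbdef
  have hbc : Continuous b := by unfold b; fun_prop
  have hbd : ∀ x, HasDerivAt b (Λ * (B * Real.exp (Λ * x))) x := by
    intro x
    have := (((hasDerivAt_id x).const_mul Λ).exp).const_mul B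
    have e1 : Λ * (B * Real.exp (Λ * x)) = B * (Real.exp (Λ * x) * (Λ * 1)) := by ring
    rw [e1]
    exact this
  have h1 : ∀ᶠ s in 𝓝[Icc 0 T] 0, f s < b s := by
    have := (hf 0 ⟨le_rfl, hT.le⟩).sub hbc.continuousWithinAt
    have h2 : f 0 - b 0 < 0 := by simp [hbdef, h0]
    filter_upwards [this.eventually_lt_const h2] with s hs
    exact sub_neg.1 hs
  -- No derivative is available at time `0`. By continuity `f` stays below the barrier for a short
  -- time, and the comparison starts at some `s > 0`.
  have h2 : ∀ᶠ s in 𝓝[>] (0 : ℝ), f s < b s := by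
    refine (h1.filter_mono ?_)
    rw [← nhdsWithin_Ioc_eq_nhdsGT hT]
    exact nhdsWithin_mono _ Ioc_subset_Icc_self
  obtain ⟨s, hs1, hs2⟩ := (h2.and (Ioo_mem_nhdsGT htpos)).exists
  refine image_le_of_deriv_right_lt_deriv_boundary' (a := s) (b := T) (f := f) (f' := f') (B := b)
    (B' := fun x => Λ * (B * Real.exp (Λ * x)))
    (hf.mono (Icc_subset_Icc_left hs2.1.le)) (fun x hx => ?_) hs1.le hbc.continuousOn
    (fun x _ => (hbd x).hasDerivWithinAt) (fun x hx h => ?_) ⟨hs2.2.le, ht.2⟩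
  · have hx0 : x ∈ Ioc 0 T := ⟨hs2.1.trans_le hx.1, hx.2.le⟩
    refine ((hf' x hx0).hasDerivAt (Icc_mem_nhds hx0.1 hx.2)).hasDerivWithinAt
  · exact hb x ⟨hs2.1.trans_le hx.1, hx.2.le⟩ h

/-! ### The quadratic form -/

/-- The bilinear form of the evolution equation. -/
noncomputable def bil (α κ₂ γ : ℝ) (a b : ℤ → ℂ) (k : ℤ) : ℂ :=
  ∑' l : ℤ, (sig α κ₂ γ k l : ℂ) * (a (k - l) * b l)

theorem fld_eq (α κ₁ κ₂ γ : ℝ) (a : ℤ → ℂ) (k : ℤ) : fld α κ₁ κ₂ γ a k =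
    -Complex.I * ((κ₁ * k * qm α k : ℝ) * a k + bil α κ₂ γ a a k) := rfl

theorem bil_eq_sum (α κ₂ γ : ℝ) (a : ℤ → ℂ) {b : ℤ → ℂ} {F : Finset ℤ} (hb : ∀ l ∉ F, b l = 0)
    (k : ℤ) : bil α κ₂ γ a b k = ∑ l ∈ F, (sig α κ₂ γ k l : ℂ) * (a (k - l) * b l) :=
  tsum_eq_sum fun l hl => by simp [hb l hl]

theorem norm_bil_le {α : ℝ} (hα : α ∈ Icc (1 : ℝ) 2) (κ₂ γ : ℝ) {a b : ℤ → ℂ}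
    (hb : Summable fun k => wt k ^ (α + 1) * ‖b k‖) (ha : Summable fun k => ‖a k‖ ^ 2) (k : ℤ) :
    ‖bil α κ₂ γ a b k‖ ≤ symC κ₂ γ * ∑' l, (wt l ^ (α + 1) * ‖b l‖) * ‖a (k - l)‖ := by
  have hs := (summable_mul_shift (fun l => mul_nonneg (Real.rpow_nonneg (wt_pos l).le _)
    (norm_nonneg (b l))) hb ha k).mul_left (symC κ₂ γ)
  rw [← tsum_mul_left]
  refine tsum_of_norm_bounded hs.hasSum fun l => ?_
  rw [norm_mul, norm_mul, Complex.norm_real, Real.norm_eq_abs]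
  have := abs_sig_le hα κ₂ γ k l
  calc |sig α κ₂ γ k l| * (‖a (k - l)‖ * ‖b l‖)
      ≤ (symC κ₂ γ * wt l ^ (α + 1)) * (‖a (k - l)‖ * ‖b l‖) := by gcongr
    _ = _ := by ring

theorem sum_norm_mul_bil_le {α : ℝ} (hα : α ∈ Icc (1 : ℝ) 2) (κ₂ γ : ℝ) {a b : ℤ → ℂ}
    (hb : Summable fun k => wt k ^ (α + 1) * ‖b k‖) (ha : Summable fun k => ‖a k‖ ^ 2)
    (F : Finset ℤ) (e : ℤ → ℂ) :
    ∑ k ∈ F, ‖e k‖ * ‖bil α κ₂ γ a b k‖ ≤ symC κ₂ γ * (√(∑ k ∈ F, ‖e k‖ ^ 2) *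
      (∑' k, wt k ^ (α + 1) * ‖b k‖) * √(∑' k, ‖a k‖ ^ 2)) := by
  have h := trilinear_le F (f := fun k => ‖e k‖) (h := fun k => ‖a k‖)
    (fun l => mul_nonneg (Real.rpow_nonneg (wt_pos l).le (α + 1)) (norm_nonneg (b l))) hb ha
  refine le_trans ?_ (mul_le_mul_of_nonneg_left h (symC_nonneg κ₂ γ))
  rw [Finset.mul_sum]
  refine Finset.sum_le_sum fun k _ => ?_
  rw [mul_left_comm]
  exact mul_le_mul_of_nonneg_left (norm_bil_le hα κ₂ γ hb ha k) (norm_nonneg _)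

/-- Because `b` is real in physical space, conjugating the form `S` transposes its symbol. Hence `2i
Im S = S - conj S` has the symbol `m k l - m l k`. The sequence `e` need not come from a real
function. -/
theorem abs_im_antisymm_le (F : Finset ℤ) (m : ℤ → ℤ → ℝ) {b : ℤ → ℂ}
    (hb : ∀ k, b (-k) = (starRingEnd ℂ) (b k)) (e : ℤ → ℂ) :
    2 * |(∑ k ∈ F, (starRingEnd ℂ) (e k) * ∑ l ∈ F, (m k l : ℂ) * (b (k - l) * e l)).im| ≤
      ∑ k ∈ F, ∑ l ∈ F, |m k l - m l k| * (‖b (k - l)‖ * ‖e l‖ * ‖e k‖) := by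
  set S := ∑ k ∈ F, (starRingEnd ℂ) (e k) * ∑ l ∈ F, (m k l : ℂ) * (b (k - l) * e l) with hS
  have h1 : (starRingEnd ℂ) S =
      ∑ k ∈ F, ∑ l ∈ F, (m l k : ℂ) * (b (k - l) * e l * (starRingEnd ℂ) (e k)) := by
    rw [Finset.sum_comm, hS]
    simp only [map_sum, map_mul, Complex.conj_conj, Complex.conj_ofReal, ← hb, neg_sub,
      Finset.mul_sum]
    refine Finset.sum_congr rfl fun k _ => Finset.sum_congr rfl fun l _ => ?_
    ring
  have h2 : S - (starRingEnd ℂ) S = ∑ k ∈ F, ∑ l ∈ F,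
      ((m k l - m l k : ℝ) : ℂ) * (b (k - l) * e l * (starRingEnd ℂ) (e k)) := by
    rw [h1, hS, ← Finset.sum_sub_distrib]
    refine Finset.sum_congr rfl fun k _ => ?_
    rw [Finset.mul_sum, ← Finset.sum_sub_distrib]
    refine Finset.sum_congr rfl fun l _ => ?_
    push_cast; ring
  have h3 : ‖S - (starRingEnd ℂ) S‖ = 2 * |S.im| := by
    rw [Complex.sub_conj]; simp
  rw [← h3, h2]
  refine (norm_sum_le _ _).trans (Finset.sum_le_sum fun k _ => (norm_sum_le _ _).trans
    (Finset.sum_le_sum fun l _ => le_of_eq ?_))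
  simp only [norm_mul, Complex.norm_real, Real.norm_eq_abs, RCLike.norm_conj]

theorem sum_eq_tsum_of_support {F : Finset ℤ} {e : ℤ → ℂ} (he : ∀ l ∉ F, e l = 0) :
    ∑' k, ‖e k‖ ^ 2 = ∑ k ∈ F, ‖e k‖ ^ 2 :=
  tsum_eq_sum fun l hl => by simp [he l hl]

theorem summable_of_support {F : Finset ℤ} {e : ℤ → ℂ} (he : ∀ l ∉ F, e l = 0)
    (φ : ℤ → ℝ → ℝ) (hφ : ∀ k, φ k 0 = 0) : Summable fun k => φ k ‖e k‖ :=
  summable_of_ne_finset_zero (s := F) fun l hl => by simp [he l hl, hφ]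

/-- This is the integration by parts for transport: all `α + 1` derivatives fall on the real
advecting field `b`, and none on `e`. -/
theorem abs_im_bil_le {α : ℝ} (hα : α ∈ Icc (1 : ℝ) 2) (κ₂ γ : ℝ) {b : ℤ → ℂ}
    (hb : ∀ k, b (-k) = (starRingEnd ℂ) (b k)) (hs : Summable fun k => wt k ^ (α + 1) * ‖b k‖)
    {F : Finset ℤ} {e : ℤ → ℂ} (he : ∀ l ∉ F, e l = 0) :
    |(∑ k ∈ F, (starRingEnd ℂ) (e k) * bil α κ₂ γ b e k).im| ≤
      symC κ₂ γ * (∑' k, wt k ^ (α + 1) * ‖b k‖) * ∑ k ∈ F, ‖e k‖ ^ 2 := by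
  have hg0 : ∀ l, 0 ≤ wt l ^ (α + 1) * ‖b l‖ := fun l =>
    mul_nonneg (Real.rpow_nonneg (wt_pos l).le _) (norm_nonneg _)
  have hse : Summable fun k => ‖e k‖ ^ 2 := summable_of_support he (fun _ x => x ^ 2) (by simp)
  have h1 := abs_im_antisymm_le F (sig α κ₂ γ) hb e
  have h2 := trilinear_le F (f := fun k => ‖e k‖) (h := fun k => ‖e k‖) hg0 hs hse
  rw [sum_eq_tsum_of_support he, mul_right_comm,
    Real.mul_self_sqrt (Finset.sum_nonneg fun _ _ => sq_nonneg _)] at h2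
  simp only [bil_eq_sum α κ₂ γ b he]
  have h3 : ∑ k ∈ F, ∑ l ∈ F, |sig α κ₂ γ k l - sig α κ₂ γ l k| * (‖b (k - l)‖ * ‖e l‖ * ‖e k‖) ≤
      2 * symC κ₂ γ *
        ∑ k ∈ F, ‖e k‖ * ∑' l, wt l ^ (α + 1) * ‖b l‖ * ‖e (k - l)‖ := by
    rw [Finset.mul_sum]
    refine Finset.sum_le_sum fun k _ => ?_
    have hS := summable_mul_shift' hg0 hs hse k
    rw [← tsum_mul_shift (fun l => wt l ^ (α + 1) * ‖b l‖) (fun l => ‖e l‖)]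
    refine le_trans ?_ (mul_le_mul_of_nonneg_left (mul_le_mul_of_nonneg_left
      (hS.sum_le_tsum F fun l _ => mul_nonneg (hg0 _) (norm_nonneg _)) (norm_nonneg _))
      (by linarith [symC_nonneg κ₂ γ]))
    rw [Finset.mul_sum, Finset.mul_sum]
    refine Finset.sum_le_sum fun l _ => ?_
    calc _ ≤ (2 * symC κ₂ γ * wt (k - l) ^ (α + 1)) * (‖b (k - l)‖ * ‖e l‖ * ‖e k‖) := by
          gcongr; exact abs_sig_sub_sig_le hα κ₂ γ k l
      _ = _ := by ring
  have h4 := mul_le_mul_of_nonneg_left h2 (symC_nonneg κ₂ γ)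
  linarith

/-! ### The energy of a family of modes -/

theorem hasDerivWithinAt_energy {T t : ℝ} {F : Finset ℤ} {e : ℝ → ℤ → ℂ} {S : ℤ → ℂ}
    (h : ∀ k ∈ F, HasDerivWithinAt (fun s => e s k) (-Complex.I * S k) (Icc 0 T) t) (c : ℤ → ℝ) :
    HasDerivWithinAt (fun s => ∑ k ∈ F, c k * ‖e s k‖ ^ 2)
      (2 * (∑ k ∈ F, (starRingEnd ℂ) (e t k) * (c k * S k)).im) (Icc 0 T) t := by
  have : 2 * (∑ k ∈ F, (starRingEnd ℂ) (e t k) * (c k * S k)).im =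
      ∑ k ∈ F, c k * (2 * inner ℝ (e t k) (-Complex.I * S k)) := by
    rw [Complex.im_sum, Finset.mul_sum]
    refine Finset.sum_congr rfl fun k _ => ?_
    rw [Complex.inner]
    simp [Complex.mul_re, Complex.mul_im]
    ring
  rw [this]
  exact HasDerivWithinAt.fun_sum fun k hk => ((h k hk).norm_sq).const_mul (c k)

theorem continuousOn_energy {s : Set ℝ} {F : Finset ℤ} {e : ℝ → ℤ → ℂ}
    (h : ∀ k, ContinuousOn (fun t => e t k) s) (c : ℤ → ℝ) :
    ContinuousOn (fun s => ∑ k ∈ F, c k * ‖e s k‖ ^ 2) s :=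
  continuousOn_finsetSum _ fun k _ => ((h k).norm.pow 2).const_smul (c k)

/-! ### Smooth truncation of frequencies -/

/-- The piecewise linear cutoff: `1` for `|k| ≤ N / 2` and `0` for `|k| ≥ N`. -/
noncomputable def cut (N : ℕ) (k : ℤ) : ℝ := max 0 (min 1 (2 - 2 / N * |(k : ℝ)|))

theorem cut_nonneg (N : ℕ) (k : ℤ) : 0 ≤ cut N k := le_max_left _ _

theorem cut_le_one (N : ℕ) (k : ℤ) : cut N k ≤ 1 := max_le zero_le_one (min_le_left _ _)

theorem cut_neg (N : ℕ) (k : ℤ) : cut N (-k) = cut N k := by simp [cut]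

theorem cut_eq_one {N : ℕ} (hN : 1 ≤ N) {k : ℤ} (hk : 2 * |(k : ℝ)| ≤ N) : cut N k = 1 := by
  have hN' : (0 : ℝ) < N := by exact_mod_cast hN
  have : 2 / (N : ℝ) * |(k : ℝ)| ≤ 1 := by
    rw [div_mul_eq_mul_div, div_le_one hN']; exact hk
  rw [cut, min_eq_left (by linarith), max_eq_right zero_le_one]

theorem cut_eq_zero {N : ℕ} (hN : 1 ≤ N) {k : ℤ} (hk : (N : ℝ) ≤ |(k : ℝ)|) : cut N k = 0 := by
  have hN' : (0 : ℝ) < N := by exact_mod_cast hN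
  have : 2 ≤ 2 / (N : ℝ) * |(k : ℝ)| := by
    rw [div_mul_eq_mul_div, le_div_iff₀ hN']; linarith
  rw [cut, max_eq_left]
  exact (min_le_right _ _).trans (by linarith)

theorem abs_cut_sub_cut_le {N : ℕ} (hN : 1 ≤ N) (k l : ℤ) :
    |cut N k - cut N l| ≤ 2 / N * |((k - l : ℤ) : ℝ)| := by
  have hN' : (0 : ℝ) < N := by exact_mod_cast hN
  have h1 := abs_max_sub_max_le_abs (min 1 (2 - 2 / N * |(k : ℝ)|)) (min 1 (2 - 2 / N * |(l : ℝ)|)) 0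
  have h2 := abs_min_sub_min_le_max 1 (2 - 2 / N * |(k : ℝ)|) 1 (2 - 2 / N * |(l : ℝ)|)
  rw [sub_self, abs_zero, max_eq_right (abs_nonneg _)] at h2
  rw [cut, cut, max_comm 0, max_comm 0]
  refine (h1.trans h2).trans ?_
  have h3 : (2 - 2 / N * |(k : ℝ)|) - (2 - 2 / N * |(l : ℝ)|)
      = 2 / N * (|(l : ℝ)| - |(k : ℝ)|) := by ring
  rw [h3, abs_mul, abs_of_pos (by positivity)]
  refine mul_le_mul_of_nonneg_left ?_ (by positivity)
  have := abs_abs_sub_abs_le (l : ℝ) k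
  rwa [abs_sub_comm (l : ℝ), ← Int.cast_sub] at this

/-- The defect is `(cut k - cut l) + cut l (1 - cut (k - l))`. Each piece is at most `2 / N * |k -
l|`. The factor `|l|` costs only a multiple of `N` where `l` is comparable to `N`; for `|l| > 2N` a
nonzero first piece forces `|l| ≤ 2 |k - l|`. -/
theorem abs_mul_cut_defect_le {N : ℕ} (hN : 1 ≤ N) (k l : ℤ) :
    |(l : ℝ)| * |cut N k - cut N (k - l) * cut N l| ≤ 6 * |((k - l : ℤ) : ℝ)| := by
  have hN' : (0 : ℝ) < N := by exact_mod_cast hN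
  set j := k - l with hj
  have hl0 := abs_nonneg (l : ℝ)
  have hj0 := abs_nonneg (j : ℝ)
  have h1 : |(l : ℝ)| * |cut N k - cut N l| ≤ 4 * |(j : ℝ)| := by
    rcases le_or_gt |(l : ℝ)| (2 * N) with h | h
    · calc |(l : ℝ)| * |cut N k - cut N l| ≤ (2 * N) * (2 / N * |(j : ℝ)|) := by
            gcongr; exact abs_cut_sub_cut_le hN k l
        _ = _ := by field_simp; ring
    · rw [cut_eq_zero hN (by linarith : (N : ℝ) ≤ |(l : ℝ)|), sub_zero]
      rcases le_or_gt (N : ℝ) |(k : ℝ)| with hk | hk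
      · rw [cut_eq_zero hN hk]; simp
      · have := abs_cast_le_add_sub k l
        rw [abs_of_nonneg (cut_nonneg N k)]
        nlinarith [cut_nonneg N k, cut_le_one N k]
  have h2 : |(l : ℝ)| * (cut N l * |1 - cut N j|) ≤ 2 * |(j : ℝ)| := by
    rcases le_or_gt (N : ℝ) |(l : ℝ)| with h | h
    · rw [cut_eq_zero hN h]; simp
    · have h3 := abs_cut_sub_cut_le hN 0 j
      rw [cut_eq_one hN (by simp), zero_sub, Int.cast_neg, abs_neg] at h3
      calc |(l : ℝ)| * (cut N l * |1 - cut N j|) ≤ N * (1 * (2 / N * |(j : ℝ)|)) := by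
            have h4 := cut_le_one N l
            have h5 := cut_nonneg N l
            gcongr
        _ = _ := by field_simp
  have h3 : cut N k - cut N j * cut N l = (cut N k - cut N l) + cut N l * (1 - cut N j) := by ring
  have h4 := abs_add_le (cut N k - cut N l) (cut N l * (1 - cut N j))
  rw [← h3, abs_mul (cut N l), abs_of_nonneg (cut_nonneg N l)] at h4
  nlinarith

/-- For `rho` it is enough that the defect is at most one; for the transport part the cutoff's
Lipschitz bound replaces `|l|` by `|k - l|`. -/
theorem abs_sig_mul_cut_defect_le {α : ℝ} (hα : α ∈ Icc (1 : ℝ) 2) (κ₂ γ : ℝ) {N : ℕ} (hN : 1 ≤ N)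
    (k l : ℤ) : |sig α κ₂ γ k l| * |cut N k - cut N (k - l) * cut N l| ≤
      2 * symC κ₂ γ * wt (k - l) ^ (α + 1) := by
  set d := |cut N k - cut N (k - l) * cut N l| with hd
  have hd0 : 0 ≤ d := abs_nonneg _
  have hd1 : d ≤ 1 := by
    have h1 := cut_nonneg N k
    have h2 := cut_le_one N k
    have h3 := mul_nonneg (cut_nonneg N (k - l)) (cut_nonneg N l)
    have h4 := mul_le_one₀ (cut_le_one N (k - l)) (cut_nonneg N l) (cut_le_one N l)
    rw [hd, abs_le]; constructor <;> linarith
  have h1 := abs_rho_le_wt_sub hα κ₂ γ k l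
  have h2 := abs_mul_cut_defect_le hN k l
  rw [← hd] at h2
  have h3 := (abs_le_wt (k - l)).trans (wt_le_wt_rpow (by linarith [hα.1] : 0 ≤ α) (k - l))
  have h4 : sig α κ₂ γ k l = rho α κ₂ γ k l + 3 * κ₂ * l := by rw [rho]; ring
  have h5 : |sig α κ₂ γ k l| ≤ |rho α κ₂ γ k l| + 3 * |κ₂| * |(l : ℝ)| := by
    rw [h4]
    refine (abs_add_le _ _).trans (le_of_eq ?_)
    rw [abs_mul (3 * κ₂), abs_mul 3, abs_of_pos (by norm_num : (0 : ℝ) < 3)]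
  have hW : 0 ≤ wt (k - l) ^ (α + 1) := Real.rpow_nonneg (wt_pos _).le _
  have h6 : |rho α κ₂ γ k l| * d ≤ (symC κ₂ γ - 3 * |κ₂|) * wt (k - l) ^ (α + 1) :=
    (mul_le_of_le_one_right (abs_nonneg _) hd1).trans h1
  have h7 : |κ₂| * (|(l : ℝ)| * d) ≤ |κ₂| * (6 * wt (k - l) ^ (α + 1)) :=
    mul_le_mul_of_nonneg_left (by linarith) (abs_nonneg _)
  have h8 := mul_le_mul_of_nonneg_right h5 hd0
  have h9 : 15 * |κ₂| * wt (k - l) ^ (α + 1) ≤ symC κ₂ γ * wt (k - l) ^ (α + 1) := by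
    gcongr
    rw [symC]
    linarith [abs_nonneg γ, abs_nonneg κ₂]
  linarith

/-- The part of a sequence at frequencies `|k| ≥ N / 4`. -/
noncomputable def tail (N : ℕ) (a : ℤ → ℂ) (k : ℤ) : ℝ := if (N : ℝ) ≤ 4 * |(k : ℝ)| then ‖a k‖ else 0

theorem tail_nonneg (N : ℕ) (a : ℤ → ℂ) (k : ℤ) : 0 ≤ tail N a k := by
  unfold tail; split_ifs <;> simp

theorem tail_le (N : ℕ) (a : ℤ → ℂ) (k : ℤ) : tail N a k ≤ ‖a k‖ := by
  unfold tail; split_ifs <;> simp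

theorem summable_tail_sq {a : ℤ → ℂ} (ha : Summable fun k => ‖a k‖ ^ 2) (N : ℕ) :
    Summable fun k => tail N a k ^ 2 :=
  ha.of_nonneg_of_le (fun _ => sq_nonneg _) fun k =>
    pow_le_pow_left₀ (tail_nonneg N a k) (tail_le N a k) 2

theorem norm_cut_defect_le_tail {N : ℕ} (hN : 1 ≤ N) (a : ℤ → ℂ) (k : ℤ) :
    ‖(cut N k : ℂ) * a k - a k‖ ≤ tail N a k := by
  unfold tail
  split_ifs with h
  · have : (cut N k : ℂ) * a k - a k = ((cut N k - 1 : ℝ) : ℂ) * a k := by push_cast; ring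
    rw [this, norm_mul, Complex.norm_real, Real.norm_eq_abs]
    refine mul_le_of_le_one_left (norm_nonneg _) ?_
    rw [abs_le]; constructor <;> linarith [cut_nonneg N k, cut_le_one N k]
  · rw [cut_eq_one hN (by linarith [abs_nonneg (k : ℝ)])]; simp

/-- If both interacting frequencies are below `N / 4`, then `|k| < N / 2`, all three cutoffs equal
one, and the term vanishes. Otherwise a high factor is measured by the tail and the other factor
carries the weight. When `l` is high this needs the commutator bound; when only `k - l` is high, the
crude symbol bound is enough. -/
theorem norm_residual_term_le {α : ℝ} (hα : α ∈ Icc (1 : ℝ) 2) (κ₂ γ : ℝ) {N : ℕ} (hN : 1 ≤ N)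
    (a : ℤ → ℂ) (k l : ℤ) :
    |sig α κ₂ γ k l| * |cut N k - cut N (k - l) * cut N l| * (‖a (k - l)‖ * ‖a l‖) ≤
      2 * symC κ₂ γ * (wt l ^ (α + 1) * ‖a l‖ * tail N a (k - l) +
        wt (k - l) ^ (α + 1) * ‖a (k - l)‖ * tail N a l) := by
  have hS := symC_nonneg κ₂ γ
  have hWl : 0 ≤ wt l ^ (α + 1) := Real.rpow_nonneg (wt_pos _).le _
  have hWj : 0 ≤ wt (k - l) ^ (α + 1) := Real.rpow_nonneg (wt_pos _).le _
  have ht := tail_nonneg N a l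
  have ht' := tail_nonneg N a (k - l)
  by_cases hl : (N : ℝ) ≤ 4 * |(l : ℝ)|
  · have e1 : tail N a l = ‖a l‖ := by rw [tail, if_pos hl]
    have h1 := abs_sig_mul_cut_defect_le hα κ₂ γ hN k l
    have h2 : 0 ≤ wt l ^ (α + 1) * ‖a l‖ * tail N a (k - l) := by positivity
    calc _ ≤ 2 * symC κ₂ γ * wt (k - l) ^ (α + 1) * (‖a (k - l)‖ * ‖a l‖) := by gcongr
      _ = 2 * symC κ₂ γ * (wt (k - l) ^ (α + 1) * ‖a (k - l)‖ * tail N a l) := by rw [e1]; ring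
      _ ≤ _ := by gcongr; linarith
  by_cases hj : (N : ℝ) ≤ 4 * |((k - l : ℤ) : ℝ)|
  · have e1 : tail N a (k - l) = ‖a (k - l)‖ := by rw [tail, if_pos hj]
    have h1 := abs_sig_le hα κ₂ γ k l
    have hd1 : |cut N k - cut N (k - l) * cut N l| ≤ 1 := by
      have h1 := cut_nonneg N k
      have h2 := cut_le_one N k
      have h3 := mul_nonneg (cut_nonneg N (k - l)) (cut_nonneg N l)
      have h4 := mul_le_one₀ (cut_le_one N (k - l)) (cut_nonneg N l) (cut_le_one N l)
      rw [abs_le]; constructor <;> linarith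
    have h2 : 0 ≤ wt (k - l) ^ (α + 1) * ‖a (k - l)‖ * tail N a l := by positivity
    calc _ ≤ symC κ₂ γ * wt l ^ (α + 1) * 1 * (‖a (k - l)‖ * ‖a l‖) := by gcongr
      _ = symC κ₂ γ * (wt l ^ (α + 1) * ‖a l‖ * tail N a (k - l)) := by rw [e1]; ring
      _ ≤ 2 * symC κ₂ γ * (wt l ^ (α + 1) * ‖a l‖ * tail N a (k - l)) := by
          gcongr; linarith
      _ ≤ _ := by gcongr; linarith
  · push Not at hl hj
    have hk : |(k : ℝ)| ≤ |(l : ℝ)| + |((k - l : ℤ) : ℝ)| := by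
      have := abs_add_le (l : ℝ) ((k - l : ℤ) : ℝ)
      push_cast at this ⊢
      simpa using this
    have hl0 := abs_nonneg (l : ℝ)
    have hj0 := abs_nonneg ((k - l : ℤ) : ℝ)
    rw [cut_eq_one hN (by linarith), cut_eq_one hN (by linarith), cut_eq_one hN (by linarith)]
    simp only [mul_one, sub_self, abs_zero, mul_zero, zero_mul]
    positivity

theorem norm_residual_le {α : ℝ} (hα : α ∈ Icc (1 : ℝ) 2) (κ₂ γ : ℝ) {N : ℕ} (hN : 1 ≤ N)
    {a : ℤ → ℂ} (hs : Summable fun k => wt k ^ (α + 1) * ‖a k‖)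
    (ha : Summable fun k => ‖a k‖ ^ 2) (k : ℤ) :
    ‖cut N k * bil α κ₂ γ a a k - bil α κ₂ γ (fun k => cut N k * a k) (fun k => cut N k * a k) k‖ ≤
      4 * symC κ₂ γ * ∑' l, wt l ^ (α + 1) * ‖a l‖ * tail N a (k - l) := by
  have hg0 : ∀ l, 0 ≤ wt l ^ (α + 1) * ‖a l‖ := fun l =>
    mul_nonneg (Real.rpow_nonneg (wt_pos l).le _) (norm_nonneg _)
  have hT := summable_tail_sq ha N
  have s1 := summable_mul_shift hg0 hs hT k
  have s2 := summable_mul_shift' hg0 hs hT k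
  have s3 := summable_mul_shift hg0 hs ha k
  have hb : Summable fun l => (sig α κ₂ γ k l : ℂ) * (a (k - l) * a l) := by
    refine Summable.of_norm_bounded (s3.mul_left (symC κ₂ γ)) fun l => ?_
    rw [norm_mul, norm_mul, Complex.norm_real, Real.norm_eq_abs]
    calc _ ≤ (symC κ₂ γ * wt l ^ (α + 1)) * (‖a (k - l)‖ * ‖a l‖) := by
          gcongr; exact abs_sig_le hα κ₂ γ k l
      _ = _ := by ring
  have hc : Summable fun l => (sig α κ₂ γ k l : ℂ) *
      ((cut N (k - l) * a (k - l)) * (cut N l * a l)) := by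
    refine Summable.of_norm_bounded hb.norm fun l => ?_
    have h4 := mul_le_one₀ (cut_le_one N (k - l)) (cut_nonneg N l) (cut_le_one N l)
    simp only [norm_mul, Complex.norm_real, Real.norm_eq_abs, abs_of_nonneg (cut_nonneg _ _)]
    calc _ = (|sig α κ₂ γ k l| * (‖a (k - l)‖ * ‖a l‖)) * (cut N (k - l) * cut N l) := by ring
      _ ≤ _ := mul_le_of_le_one_right (by positivity) h4
  have e1 : cut N k * bil α κ₂ γ a a k -
      bil α κ₂ γ (fun k => cut N k * a k) (fun k => cut N k * a k) k =
      ∑' l, ((sig α κ₂ γ k l * (cut N k - cut N (k - l) * cut N l) : ℝ) : ℂ) *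
        (a (k - l) * a l) := by
    rw [bil, bil, ← tsum_mul_left, ← (hb.mul_left _).tsum_sub hc]
    congr 1; ext l; push_cast; ring
  have e2 : 4 * symC κ₂ γ * ∑' l, wt l ^ (α + 1) * ‖a l‖ * tail N a (k - l) =
      ∑' l, 2 * symC κ₂ γ * (wt l ^ (α + 1) * ‖a l‖ * tail N a (k - l) +
        wt (k - l) ^ (α + 1) * ‖a (k - l)‖ * tail N a l) := by
    rw [tsum_mul_left, s1.tsum_add s2, tsum_mul_shift (fun l => wt l ^ (α + 1) * ‖a l‖)]
    ring
  rw [e1, e2]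
  refine tsum_of_norm_bounded ((s1.add s2).mul_left _).hasSum fun l => ?_
  rw [norm_mul, norm_mul, Complex.norm_real, Real.norm_eq_abs, abs_mul]
  exact norm_residual_term_le hα κ₂ γ hN a k l

/-! ### The energy estimate for the Galerkin error -/

/-- The frequencies resolved by the scheme. -/
noncomputable abbrev freq (N : ℕ) : Finset ℤ := Finset.Icc (-(N : ℤ)) N

theorem abs_le_of_mem_freq {N : ℕ} {k : ℤ} (hk : k ∈ freq N) : |(k : ℝ)| ≤ N := by
  rw [Finset.mem_Icc] at hk
  rw [abs_le]
  exact ⟨by exact_mod_cast hk.1, by exact_mod_cast hk.2⟩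

theorem le_abs_of_notMem_freq {N : ℕ} {k : ℤ} (hk : k ∉ freq N) : (N : ℝ) ≤ |(k : ℝ)| := by
  rw [Finset.mem_Icc, not_and_or, not_le, not_le] at hk
  rcases hk with h | h
  · have : (k : ℝ) < -N := by exact_mod_cast h
    linarith [neg_abs_le (k : ℝ)]
  · have : (N : ℝ) < k := by exact_mod_cast h
    linarith [le_abs_self (k : ℝ)]

theorem neg_mem_freq {N : ℕ} {k : ℤ} (hk : k ∈ freq N) : -k ∈ freq N := by
  rw [Finset.mem_Icc] at hk ⊢; omega

theorem summable_norm_of_wt {α : ℝ} (hα : 0 ≤ α) {a : ℤ → ℂ}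
    (hs : Summable fun k => wt k ^ (α + 1) * ‖a k‖) : Summable fun k => ‖a k‖ :=
  hs.of_nonneg_of_le (fun _ => norm_nonneg _) fun k =>
    le_mul_of_one_le_left (norm_nonneg _) (one_le_wt_rpow (by linarith) k)

theorem summable_norm_sq {a : ℤ → ℂ} (ha : Summable fun k => ‖a k‖) :
    Summable fun k => ‖a k‖ ^ 2 := by
  refine (ha.mul_left (∑' k, ‖a k‖)).of_nonneg_of_le (fun _ => sq_nonneg _) fun k => ?_
  rw [sq]
  exact mul_le_mul_of_nonneg_right (ha.le_tsum k fun _ _ => norm_nonneg _) (norm_nonneg _)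

/-- The expansion is around the truncated solution `b`, not around `y`. Thus only `b` has to be real
and bounded in the strong norm, and nothing is asked of `y` beyond its support. -/
theorem bil_sub_bil (α κ₂ γ : ℝ) {F : Finset ℤ} {b y : ℤ → ℂ} (hb : ∀ l ∉ F, b l = 0)
    (hy : ∀ l ∉ F, y l = 0) (k : ℤ) :
    bil α κ₂ γ b b k - bil α κ₂ γ y y k =
      bil α κ₂ γ b (fun k => b k - y k) k + bil α κ₂ γ (fun k => b k - y k) b k -
        bil α κ₂ γ (fun k => b k - y k) (fun k => b k - y k) k := by
  have he : ∀ l ∉ F, b l - y l = 0 := fun l hl => by rw [hb l hl, hy l hl, sub_zero]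
  rw [bil_eq_sum _ _ _ _ hb, bil_eq_sum _ _ _ _ hy, bil_eq_sum α κ₂ γ b he,
    bil_eq_sum _ _ _ _ hb, bil_eq_sum α κ₂ γ (fun k => b k - y k) he, ← Finset.sum_sub_distrib,
    ← Finset.sum_add_distrib, ← Finset.sum_sub_distrib]
  refine Finset.sum_congr rfl fun l _ => ?_
  ring

/-- Inverse inequality: `α + 1` powers from the derivatives, and another half from Cauchy–Schwarz
over at most `3 N` frequencies. The constant is `8 * √3 ≤ 16`. -/
theorem tsum_wt_mul_norm_le {α : ℝ} (hα : α ∈ Icc (1 : ℝ) 2) {N : ℕ} (hN : 1 ≤ N) {e : ℤ → ℂ}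
    (he : ∀ l ∉ freq N, e l = 0) : ∑' k, wt k ^ (α + 1) * ‖e k‖ ≤
      16 * (N : ℝ) ^ (α + 3 / 2) * √(∑ k ∈ freq N, ‖e k‖ ^ 2) := by
  have hN' : (1 : ℝ) ≤ N := by exact_mod_cast hN
  have hN0 : (0 : ℝ) < N := by linarith
  have hα1 : 0 ≤ α + 1 := by linarith [hα.1]
  rw [tsum_eq_sum (s := freq N) fun l hl => by simp [he l hl]]
  have h1 := Real.sum_mul_le_sqrt_mul_sqrt (freq N) (fun k => wt k ^ (α + 1)) fun k => ‖e k‖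
  refine h1.trans (mul_le_mul_of_nonneg_right ?_ (Real.sqrt_nonneg _))
  have h8 : (2 : ℝ) ^ (α + 1) ≤ 8 := by
    calc (2 : ℝ) ^ (α + 1) ≤ 2 ^ (3 : ℝ) :=
          Real.rpow_le_rpow_of_exponent_le (by norm_num) (by linarith [hα.2])
      _ = 8 := by norm_num
  have h2 : ∀ k ∈ freq N, (wt k ^ (α + 1)) ^ 2 ≤ (8 * (N : ℝ) ^ (α + 1)) ^ 2 := by
    intro k hk
    have hw := Real.rpow_nonneg (wt_pos k).le (α + 1)
    refine pow_le_pow_left₀ hw ?_ 2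
    calc wt k ^ (α + 1) ≤ (2 * N) ^ (α + 1) := by
          refine Real.rpow_le_rpow (wt_pos k).le ?_ hα1
          have := abs_le_of_mem_freq hk
          unfold wt; linarith
      _ = 2 ^ (α + 1) * (N : ℝ) ^ (α + 1) := Real.mul_rpow (by norm_num) hN0.le
      _ ≤ _ := by gcongr
  refine Real.sqrt_le_iff.2 ⟨by positivity, (Finset.sum_le_card_nsmul _ _ _ h2).trans ?_⟩
  have hcard : ((freq N).card : ℝ) ≤ 3 * N := by
    rw [Int.card_Icc]
    have : ((N : ℤ) + 1 - -(N : ℤ)).toNat = 2 * N + 1 := by omega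
    rw [this]; push_cast; linarith
  have e1 : ((N : ℝ) ^ (α + 3 / 2)) ^ 2 = N * ((N : ℝ) ^ (α + 1)) ^ 2 := by
    rw [← Real.rpow_natCast, ← Real.rpow_natCast, ← Real.rpow_mul hN0.le, ← Real.rpow_mul hN0.le,
      mul_comm (N : ℝ), ← Real.rpow_add_one hN0.ne']
    congr 1; push_cast; ring
  rw [nsmul_eq_mul, mul_pow, mul_pow, e1]
  have : 0 ≤ ((N : ℝ) ^ (α + 1)) ^ 2 := by positivity
  nlinarith

/-- The linear term has a real symbol and drops out of the imaginary part. The residual gives `δ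
√E`. Transport of `e` by `b` is handled by antisymmetry, `bil e b` by putting all derivatives on
`b`, and `bil e e` by the inverse inequality. -/
theorem abs_energy_rate_le {α : ℝ} (hα : α ∈ Icc (1 : ℝ) 2) (κ₁ κ₂ γ : ℝ) {A δ : ℝ} (hδ : 0 ≤ δ)
    {N : ℕ} (hN : 1 ≤ N) {a y : ℤ → ℂ} (hreal : ∀ k, a (-k) = (starRingEnd ℂ) (a k))
    (hs : Summable fun k => wt k ^ (α + 1) * ‖a k‖) (hA : ∑' k, wt k ^ (α + 1) * ‖a k‖ ≤ A)
    (hy : ∀ l ∉ freq N, y l = 0) (htail : ∑' k, tail N a k ^ 2 ≤ δ ^ 2)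
    {E : ℝ} (hE : E = ∑ k ∈ freq N, ‖(cut N k : ℂ) * a k - y k‖ ^ 2) :
    |(∑ k ∈ freq N, (starRingEnd ℂ) ((cut N k : ℂ) * a k - y k) *
      (cut N k * ((κ₁ * k * qm α k : ℝ) * a k + bil α κ₂ γ a a k) -
        ((κ₁ * k * qm α k : ℝ) * y k + bil α κ₂ γ y y k))).im| ≤
      symC κ₂ γ * (4 * A * δ * √E + 2 * A * E + 16 * (N : ℝ) ^ (α + 3 / 2) * √E * E) := by
  have hα0 : 0 ≤ α := by linarith [hα.1]
  have hS := symC_nonneg κ₂ γ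
  set b : ℤ → ℂ := fun k => cut N k * a k with hbdef
  set e : ℤ → ℂ := fun k => b k - y k with hedef
  have hb : ∀ l ∉ freq N, b l = 0 := fun l hl => by
    rw [hbdef]; simp [cut_eq_zero hN (le_abs_of_notMem_freq hl)]
  have he : ∀ l ∉ freq N, e l = 0 := fun l hl => by rw [hedef]; simp [hb l hl, hy l hl]
  have hE' : E = ∑ k ∈ freq N, ‖e k‖ ^ 2 := hE
  have hE0 : 0 ≤ E := by rw [hE']; exact Finset.sum_nonneg fun _ _ => sq_nonneg _
  have ha2 := summable_norm_sq (summable_norm_of_wt hα0 hs)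
  have hse : Summable fun k => ‖e k‖ ^ 2 := summable_of_support he (fun _ x => x ^ 2) (by simp)
  have hseE : ∑' k, ‖e k‖ ^ 2 = E := by rw [sum_eq_tsum_of_support he, hE']
  have hbreal : ∀ k, b (-k) = (starRingEnd ℂ) (b k) := fun k => by
    simp [hbdef, cut_neg, hreal]
  have hba : ∀ k, wt k ^ (α + 1) * ‖b k‖ ≤ wt k ^ (α + 1) * ‖a k‖ := fun k => by
    refine mul_le_mul_of_nonneg_left ?_ (Real.rpow_nonneg (wt_pos k).le _)
    rw [hbdef]
    simp only [norm_mul, Complex.norm_real, Real.norm_eq_abs, abs_of_nonneg (cut_nonneg N k)]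
    exact mul_le_of_le_one_left (norm_nonneg _) (cut_le_one N k)
  have hsb : Summable fun k => wt k ^ (α + 1) * ‖b k‖ :=
    hs.of_nonneg_of_le (fun k => mul_nonneg (Real.rpow_nonneg (wt_pos k).le _) (norm_nonneg _)) hba
  have hAb : ∑' k, wt k ^ (α + 1) * ‖b k‖ ≤ A := (hsb.tsum_le_tsum hba hs).trans hA
  set R : ℤ → ℂ := fun k => cut N k * bil α κ₂ γ a a k - bil α κ₂ γ b b k with hR
  have hsplit : ∑ k ∈ freq N, (starRingEnd ℂ) ((cut N k : ℂ) * a k - y k) *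
      (cut N k * ((κ₁ * k * qm α k : ℝ) * a k + bil α κ₂ γ a a k) -
        ((κ₁ * k * qm α k : ℝ) * y k + bil α κ₂ γ y y k)) =
      ∑ k ∈ freq N, ((κ₁ * k * qm α k * ‖e k‖ ^ 2 : ℝ) : ℂ) +
      ∑ k ∈ freq N, (starRingEnd ℂ) (e k) * R k +
      ∑ k ∈ freq N, (starRingEnd ℂ) (e k) * bil α κ₂ γ b e k +
      ∑ k ∈ freq N, (starRingEnd ℂ) (e k) * bil α κ₂ γ e b k -
      ∑ k ∈ freq N, (starRingEnd ℂ) (e k) * bil α κ₂ γ e e k := by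
    rw [← Finset.sum_add_distrib, ← Finset.sum_add_distrib, ← Finset.sum_add_distrib,
      ← Finset.sum_sub_distrib]
    refine Finset.sum_congr rfl fun k _ => ?_
    have h1 := bil_sub_bil α κ₂ γ hb hy k
    have h2 : ((‖e k‖ ^ 2 : ℝ) : ℂ) = (starRingEnd ℂ) (e k) * e k := by
      rw [mul_comm, Complex.mul_conj, Complex.normSq_eq_norm_sq]
    change (starRingEnd ℂ) (e k) * _ = _
    have h3 : e k = cut N k * a k - y k := rfl
    rw [Complex.ofReal_mul _ (‖e k‖ ^ 2), h2]
    simp only [hR]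
    linear_combination (starRingEnd ℂ) (e k) * h1 -
      (starRingEnd ℂ) (e k) * ((κ₁ * k * qm α k : ℝ) : ℂ) * h3
  have hIm : ∀ f : ℤ → ℂ, |(∑ k ∈ freq N, (starRingEnd ℂ) (e k) * f k).im| ≤
      ∑ k ∈ freq N, ‖e k‖ * ‖f k‖ := fun f => by
    refine (Complex.abs_im_le_norm _).trans ((norm_sum_le _ _).trans (le_of_eq ?_))
    simp
  have t0 : (∑ k ∈ freq N, ((κ₁ * k * qm α k * ‖e k‖ ^ 2 : ℝ) : ℂ)).im = 0 := by
    rw [← Complex.ofReal_sum, Complex.ofReal_im]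
  have t1 : |(∑ k ∈ freq N, (starRingEnd ℂ) (e k) * R k).im| ≤
      symC κ₂ γ * (4 * A * δ * √E) := by
    refine (hIm R).trans ?_
    have h1 := trilinear_le (freq N) (f := fun k => ‖e k‖) (h := fun k => tail N a k)
      (fun l => mul_nonneg (Real.rpow_nonneg (wt_pos l).le (α + 1)) (norm_nonneg (a l))) hs
      (summable_tail_sq ha2 N)
    rw [← hE'] at h1
    have h2 : √(∑' k, tail N a k ^ 2) ≤ δ := Real.sqrt_le_iff.2 ⟨hδ, htail⟩
    have hA0 : 0 ≤ ∑' k, wt k ^ (α + 1) * ‖a k‖ :=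
      tsum_nonneg fun k => mul_nonneg (Real.rpow_nonneg (wt_pos k).le _) (norm_nonneg _)
    calc ∑ k ∈ freq N, ‖e k‖ * ‖R k‖ ≤ 4 * symC κ₂ γ *
          ∑ k ∈ freq N, ‖e k‖ * ∑' l, wt l ^ (α + 1) * ‖a l‖ * tail N a (k - l) := by
          rw [Finset.mul_sum]
          refine Finset.sum_le_sum fun k _ => ?_
          rw [mul_left_comm]
          exact mul_le_mul_of_nonneg_left (norm_residual_le hα κ₂ γ hN hs ha2 k) (norm_nonneg _)
      _ ≤ 4 * symC κ₂ γ * (√E * A * δ) := by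
          refine mul_le_mul_of_nonneg_left (h1.trans ?_) (by positivity)
          have := Real.sqrt_nonneg E
          have hA1 : 0 ≤ A := hA0.trans hA
          gcongr
      _ = _ := by ring
  have t2 : |(∑ k ∈ freq N, (starRingEnd ℂ) (e k) * bil α κ₂ γ b e k).im| ≤
      symC κ₂ γ * (A * E) := by
    refine (abs_im_bil_le hα κ₂ γ hbreal hsb he).trans ?_
    rw [← hE', mul_assoc]
    gcongr
  have t3 : |(∑ k ∈ freq N, (starRingEnd ℂ) (e k) * bil α κ₂ γ e b k).im| ≤
      symC κ₂ γ * (A * E) := by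
    refine (hIm _).trans ((sum_norm_mul_bil_le hα κ₂ γ hsb hse (freq N) e).trans ?_)
    rw [hseE, ← hE', mul_right_comm, Real.mul_self_sqrt hE0, mul_comm E]
    gcongr
  have t4 : |(∑ k ∈ freq N, (starRingEnd ℂ) (e k) * bil α κ₂ γ e e k).im| ≤
      symC κ₂ γ * (16 * (N : ℝ) ^ (α + 3 / 2) * √E * E) := by
    have hs4 : Summable fun k => wt k ^ (α + 1) * ‖e k‖ :=
      summable_of_support he (fun k x => wt k ^ (α + 1) * x) (by simp)
    refine (hIm _).trans ((sum_norm_mul_bil_le hα κ₂ γ hs4 hse (freq N) e).trans ?_)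
    rw [hseE, ← hE', mul_right_comm, Real.mul_self_sqrt hE0, mul_comm E]
    have := tsum_wt_mul_norm_le hα hN he
    rw [← hE'] at this
    gcongr
  rw [hsplit, Complex.sub_im, Complex.add_im, Complex.add_im, Complex.add_im, t0, zero_add]
  rw [abs_le] at *
  constructor <;> linarith [t1.1, t1.2, t2.1, t2.2, t3.1, t3.2, t4.1, t4.2]

/-- The tail size `δ` is a free parameter, so the same estimate gives both the algebraic and the
exponential rate. -/
theorem galerkin_error_bound {α : ℝ} (hα : α ∈ Icc (1 : ℝ) 2) (κ₁ κ₂ γ T : ℝ) {A : ℝ}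
    (hA0 : 0 ≤ A) : ∃ K > 0, ∃ ε > 0, ∀ (N : ℕ) (_ : 1 ≤ N) (a y : ℝ → ℤ → ℂ)
    (_ : ModeSol α κ₁ κ₂ γ T univ a) (_ : ModeSol α κ₁ κ₂ γ T (freq N) y)
    (_ : ∀ t ∈ Icc 0 T, ∀ k, a t (-k) = (starRingEnd ℂ) (a t k))
    (_ : ∀ t ∈ Icc 0 T, Summable fun k => wt k ^ (α + 1) * ‖a t k‖)
    (_ : ∀ t ∈ Icc 0 T, ∑' k, wt k ^ (α + 1) * ‖a t k‖ ≤ A)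
    (_ : ∀ t ∈ Icc 0 T, ∀ l ∉ freq N, y t l = 0)
    (_ : ∀ k ∈ freq N, y 0 k = a 0 k) (δ : ℝ) (_ : 0 < δ)
    (_ : ∀ t ∈ Icc 0 T, ∑' k, tail N (a t) k ^ 2 ≤ δ ^ 2)
    (_ : (N : ℝ) ^ (α + 3 / 2) * δ ≤ ε),
    ∀ t ∈ Icc 0 T, ∑ k ∈ freq N, ‖(cut N k : ℂ) * a t k - y t k‖ ^ 2 ≤ K * δ ^ 2 := by
  have hα0 : 0 ≤ α := by linarith [hα.1]
  have hS := symC_nonneg κ₂ γ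
  set S := symC κ₂ γ with hSdef
  -- On the barrier `δ ≤ √E` and `N ^ (α + 3 / 2) * √E ≤ 1`, so the rate is at most `2 S (6 A + 16)
  -- E`. The final `1` makes the comparison strict.
  set Λ := S * (12 * A + 32) + 1 with hΛ
  have hΛ0 : 0 < Λ := by positivity
  -- The barrier starts at `2 δ²`, strictly above `E 0 ≤ δ²`. On it `√E ≤ 2 δ exp (Λ T)`, which
  -- dictates the smallness threshold `ε`.
  refine ⟨2 * Real.exp (Λ * T), by positivity, Real.exp (-(Λ * T)) / 2, by positivity, ?_⟩
  intro N hN a y ha hy hreal hs hA hysupp hy0 δ hδ htail hsmall t ht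
  have hT : 0 ≤ T := ht.1.trans ht.2
  set e : ℝ → ℤ → ℂ := fun t k => (cut N k : ℂ) * a t k - y t k with he
  set E : ℝ → ℝ := fun t => ∑ k ∈ freq N, 1 * ‖e t k‖ ^ 2 with hEdef
  set G : ℝ → ℤ → ℂ := fun t k =>
    cut N k * ((κ₁ * k * qm α k : ℝ) * a t k + bil α κ₂ γ (a t) (a t) k) -
        ((κ₁ * k * qm α k : ℝ) * y t k + bil α κ₂ γ (y t) (y t) k) with hG
  have hc : ContinuousOn E (Icc 0 T) :=
    continuousOn_energy (fun k => ((ha.cont k).const_smul (cut N k : ℂ)).sub (hy.cont k)) _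
  have hd : ∀ s ∈ Ioc 0 T, HasDerivWithinAt E
      (2 * (∑ k ∈ freq N, (starRingEnd ℂ) (e s k) * ((1 : ℝ) * G s k)).im) (Icc 0 T) s := by
    intro s hs
    refine hasDerivWithinAt_energy (e := e) (S := G s) (fun k hk => ?_) fun _ => 1
    have h1 := ((ha.deriv k (mem_univ _) s hs).const_mul (cut N k : ℂ)).sub (hy.deriv k hk s hs)
    refine h1.congr_deriv ?_
    rw [fld_eq, fld_eq, hG]
    ring
  have hE0 : E 0 < 2 * δ ^ 2 := by
    have h0 : (0 : ℝ) ∈ Icc 0 T := ⟨le_rfl, hT⟩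
    have hsum := summable_tail_sq (summable_norm_sq (summable_norm_of_wt hα0 (hs 0 h0))) N
    calc E 0 ≤ ∑ k ∈ freq N, tail N (a 0) k ^ 2 := by
          refine Finset.sum_le_sum fun k hk => ?_
          rw [one_mul, he]
          simp only [hy0 k hk]
          exact pow_le_pow_left₀ (norm_nonneg _) (norm_cut_defect_le_tail hN _ _) 2
      _ ≤ ∑' k, tail N (a 0) k ^ 2 := hsum.sum_le_tsum _ fun _ _ => sq_nonneg _
      _ ≤ δ ^ 2 := htail 0 h0
      _ < 2 * δ ^ 2 := by nlinarith [sq_pos_of_pos hδ]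
  have key := le_barrier (Λ := Λ) hc hd hE0 fun s hs0 hEs => by
    have hsI : s ∈ Icc 0 T := Ioc_subset_Icc_self hs0
    have h1 := abs_energy_rate_le hα κ₁ κ₂ γ hδ.le hN (hreal s hsI) (hs s hsI) (hA s hsI)
      (hysupp s hsI) (htail s hsI) (E := E s) (by simp [hEdef, he])
    have h2 : (∑ k ∈ freq N, (starRingEnd ℂ) (e s k) * ((1 : ℝ) * G s k)).im ≤ _ :=
      (le_abs_self _).trans (le_of_eq_of_le (by simp only [Complex.ofReal_one, one_mul, he, hG]) h1)
    have hexp1 : 1 ≤ Real.exp (Λ * s) := Real.one_le_exp (by nlinarith [hs0.1])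
    have hexp2 : Real.exp (Λ * s) ≤ Real.exp (Λ * T) := Real.exp_le_exp.2 (by nlinarith [hs0.2])
    have hEpos : 0 < E s := by rw [hEs]; positivity
    have hδE : δ ≤ √(E s) := by
      refine Real.le_sqrt_of_sq_le ?_
      rw [hEs]; nlinarith [sq_pos_of_pos hδ]
    have hss : √(E s) * √(E s) = E s := Real.mul_self_sqrt hEpos.le
    have hNE : (N : ℝ) ^ (α + 3 / 2) * √(E s) ≤ 1 := by
      have h3 : √(E s) ≤ 2 * δ * Real.exp (Λ * T) := by
        refine Real.sqrt_le_iff.2 ⟨by positivity, ?_⟩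
        rw [hEs]
        have : Real.exp (Λ * s) ≤ Real.exp (Λ * T) ^ 2 := by nlinarith
        have h4 := mul_le_mul_of_nonneg_left this (by positivity : 0 ≤ 2 * δ ^ 2)
        have h5 : 0 ≤ δ ^ 2 * Real.exp (Λ * T) ^ 2 := by positivity
        nlinarith
      have hN0 : 0 ≤ (N : ℝ) ^ (α + 3 / 2) := by positivity
      calc (N : ℝ) ^ (α + 3 / 2) * √(E s) ≤ (N : ℝ) ^ (α + 3 / 2) * (2 * δ * Real.exp (Λ * T)) := by
            gcongr
        _ = 2 * ((N : ℝ) ^ (α + 3 / 2) * δ) * Real.exp (Λ * T) := by ring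
        _ ≤ 2 * (Real.exp (-(Λ * T)) / 2) * Real.exp (Λ * T) := by gcongr
        _ = Real.exp (-(Λ * T)) * Real.exp (Λ * T) := by ring
        _ = 1 := by rw [← Real.exp_add]; simp
    have h5 : δ * √(E s) ≤ E s := by
      calc δ * √(E s) ≤ √(E s) * √(E s) := by gcongr
        _ = _ := hss
    rw [← hEs]
    have h6 : A * (δ * √(E s)) ≤ A * E s := mul_le_mul_of_nonneg_left h5 hA0
    have h7 : (N : ℝ) ^ (α + 3 / 2) * √(E s) * E s ≤ 1 * E s :=
      mul_le_mul_of_nonneg_right hNE hEpos.le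
    have h8 : S * (4 * A * δ * √(E s) + 2 * A * E s +
        16 * (N : ℝ) ^ (α + 3 / 2) * √(E s) * E s) ≤ S * ((6 * A + 16) * E s) :=
      mul_le_mul_of_nonneg_left (by linarith) hS
    rw [hΛ]
    linarith
  have h9 := key t ht
  simp only [hEdef, one_mul] at h9
  refine h9.trans ?_
  have : Real.exp (Λ * t) ≤ Real.exp (Λ * T) := Real.exp_le_exp.2 (by nlinarith [ht.2])
  nlinarith [sq_nonneg δ]

/-! ### Reality of the Galerkin solution -/

theorem bil_conj_neg (α κ₂ γ : ℝ) (y : ℤ → ℂ) (k : ℤ) :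
    bil α κ₂ γ (fun k => (starRingEnd ℂ) (y (-k))) (fun k => (starRingEnd ℂ) (y (-k))) k =
      -(starRingEnd ℂ) (bil α κ₂ γ y y (-k)) := by
  rw [bil, bil, Complex.conj_tsum, ← (Equiv.neg ℤ).tsum_eq, ← tsum_neg]
  congr 1; ext l
  simp only [Equiv.neg_apply, neg_neg, map_mul, Complex.conj_ofReal, neg_sub]
  have h1 : sig α κ₂ γ (-k) l = -sig α κ₂ γ k (-l) := by
    rw [← sig_neg, neg_neg]
  have h2 : -l - k = -k - l := by ring
  rw [h1, h2]
  push_cast; ring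

theorem fld_conj_neg (α κ₁ κ₂ γ : ℝ) (y : ℤ → ℂ) (k : ℤ) :
    fld α κ₁ κ₂ γ (fun k => (starRingEnd ℂ) (y (-k))) k =
      (starRingEnd ℂ) (fld α κ₁ κ₂ γ y (-k)) := by
  rw [fld_eq, fld_eq, bil_conj_neg]
  simp only [map_mul, map_add, map_neg, Complex.conj_I, Complex.conj_ofReal, qm]
  push_cast; simp only [abs_neg]; ring

theorem ModeSol.conj_neg {α κ₁ κ₂ γ T : ℝ} {N : ℕ} {y : ℝ → ℤ → ℂ}
    (hy : ModeSol α κ₁ κ₂ γ T (freq N) y) :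
    ModeSol α κ₁ κ₂ γ T (freq N) (fun t k => (starRingEnd ℂ) (y t (-k))) := by
  refine ⟨fun k => Complex.continuous_conj.comp_continuousOn (hy.cont (-k)), fun k hk t ht => ?_⟩
  rw [fld_conj_neg]
  exact (hy.deriv (-k) (neg_mem_freq hk) t ht).star

/-- The reflected conjugate solves the same finite system with the same datum, so uniqueness
applies. Antisymmetry is not available before reality is known, so crude Lipschitz bounds are used;
their constants may depend on `N` and on the solution. -/
theorem ModeSol.eq_conj_neg {α : ℝ} (hα : α ∈ Icc (1 : ℝ) 2) {κ₁ κ₂ γ T : ℝ} {N : ℕ} (hN : 1 ≤ N)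
    {y : ℝ → ℤ → ℂ} (hy : ModeSol α κ₁ κ₂ γ T (freq N) y)
    (hsupp : ∀ t ∈ Icc 0 T, ∀ l ∉ freq N, y t l = 0)
    (h0 : ∀ k, y 0 (-k) = (starRingEnd ℂ) (y 0 k)) :
    ∀ t ∈ Icc 0 T, ∀ k, y t (-k) = (starRingEnd ℂ) (y t k) := by
  have hS := symC_nonneg κ₂ γ
  set z : ℝ → ℤ → ℂ := fun t k => (starRingEnd ℂ) (y t (-k)) with hz
  have hzs := hy.conj_neg
  have hzsupp : ∀ t ∈ Icc 0 T, ∀ l ∉ freq N, z t l = 0 := fun t ht l hl => by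
    have : -l ∉ freq N := fun h => hl (by simpa using neg_mem_freq h)
    simp [hz, hsupp t ht _ this]
  set d : ℝ → ℤ → ℂ := fun t k => y t k - z t k with hd
  set E : ℝ → ℝ := fun t => ∑ k ∈ freq N, 1 * ‖d t k‖ ^ 2 with hEdef
  set Y : ℝ → ℝ := fun t => ∑ k ∈ freq N, 1 * ‖y t k‖ ^ 2 with hYdef
  have hEc : ContinuousOn E (Icc 0 T) :=
    continuousOn_energy (fun k => (hy.cont k).sub (hzs.cont k)) _
  have hYc : ContinuousOn Y (Icc 0 T) := continuousOn_energy (fun k => hy.cont k) _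
  obtain ⟨M₁, hM₁⟩ := isCompact_Icc.exists_bound_of_continuousOn hEc
  obtain ⟨M₂, hM₂⟩ := isCompact_Icc.exists_bound_of_continuousOn hYc
  set M := √(max M₁ M₂) with hM
  set C := 16 * (N : ℝ) ^ (α + 3 / 2) with hC
  have hC0 : 0 ≤ C := by positivity
  have hM0 : 0 ≤ M := Real.sqrt_nonneg _
  set Λ := 6 * (symC κ₂ γ * (C * M)) + 1 with hΛ
  set G : ℝ → ℤ → ℂ := fun t k =>
    ((κ₁ * k * qm α k : ℝ) * y t k + bil α κ₂ γ (y t) (y t) k) -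
        ((κ₁ * k * qm α k : ℝ) * z t k + bil α κ₂ γ (z t) (z t) k) with hG
  have hder : ∀ s ∈ Ioc 0 T, HasDerivWithinAt E
      (2 * (∑ k ∈ freq N, (starRingEnd ℂ) (d s k) * ((1 : ℝ) * G s k)).im) (Icc 0 T) s := by
    intro s hs
    refine hasDerivWithinAt_energy (e := d) (S := G s) (fun k hk => ?_) fun _ => 1
    refine ((hy.deriv k hk s hs).sub (hzs.deriv k hk s hs)).congr_deriv ?_
    rw [fld_eq, fld_eq, hG]
    ring
  have hrate : ∀ s ∈ Icc 0 T,
      (∑ k ∈ freq N, (starRingEnd ℂ) (d s k) * ((1 : ℝ) * G s k)).im ≤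
        3 * (symC κ₂ γ * (C * M)) * E s := by
    intro s hs
    have hds : ∀ l ∉ freq N, d s l = 0 := fun l hl => by
      simp [hd, hsupp s hs l hl, hzsupp s hs l hl]
    have hE0 : 0 ≤ E s := Finset.sum_nonneg fun _ _ => by positivity
    have hEe : E s = ∑ k ∈ freq N, ‖d s k‖ ^ 2 := by simp [hEdef]
    have hYe : Y s = ∑ k ∈ freq N, ‖y s k‖ ^ 2 := by simp [hYdef]
    have hEM : √(E s) ≤ M :=
      Real.sqrt_le_sqrt (((le_abs_self _).trans (hM₁ s hs)).trans (le_max_left _ _))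
    have hYM : √(Y s) ≤ M :=
      Real.sqrt_le_sqrt (((le_abs_self _).trans (hM₂ s hs)).trans (le_max_right _ _))
    have hd2 : Summable fun k => ‖d s k‖ ^ 2 := summable_of_support hds (fun _ x => x ^ 2) (by simp)
    have hy2 : Summable fun k => ‖y s k‖ ^ 2 :=
      summable_of_support (hsupp s hs) (fun _ x => x ^ 2) (by simp)
    have hdw : Summable fun k => wt k ^ (α + 1) * ‖d s k‖ :=
      summable_of_support hds (fun k x => wt k ^ (α + 1) * x) (by simp)
    have hyw : Summable fun k => wt k ^ (α + 1) * ‖y s k‖ :=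
      summable_of_support (hsupp s hs) (fun k x => wt k ^ (α + 1) * x) (by simp)
    have e1 : ∑' k, ‖d s k‖ ^ 2 = E s := by rw [sum_eq_tsum_of_support hds, hEe]
    have e2 : ∑' k, ‖y s k‖ ^ 2 = Y s := by rw [sum_eq_tsum_of_support (hsupp s hs), hYe]
    have w1 := tsum_wt_mul_norm_le hα hN hds
    have w2 := tsum_wt_mul_norm_le hα hN (hsupp s hs)
    rw [← hEe, ← hC] at w1
    rw [← hYe, ← hC] at w2
    have b1 := sum_norm_mul_bil_le hα κ₂ γ hdw hy2 (freq N) (d s)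
    have b2 := sum_norm_mul_bil_le hα κ₂ γ hyw hd2 (freq N) (d s)
    have b3 := sum_norm_mul_bil_le hα κ₂ γ hdw hd2 (freq N) (d s)
    rw [e2, ← hEe] at b1
    rw [e1, ← hEe] at b2 b3
    have hss : √(E s) * √(E s) = E s := Real.mul_self_sqrt hE0
    have hsq := Real.sqrt_nonneg (E s)
    have hsy := Real.sqrt_nonneg (Y s)
    have c1 : √(E s) * (∑' k, wt k ^ (α + 1) * ‖d s k‖) * √(Y s) ≤ C * M * E s := by
      calc _ ≤ √(E s) * (C * √(E s)) * M := by gcongr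
        _ = C * M * (√(E s) * √(E s)) := by ring
        _ = _ := by rw [hss]
    have c2 : √(E s) * (∑' k, wt k ^ (α + 1) * ‖y s k‖) * √(E s) ≤ C * M * E s := by
      calc _ ≤ √(E s) * (C * M) * √(E s) := by gcongr; exact w2.trans (by gcongr)
        _ = C * M * (√(E s) * √(E s)) := by ring
        _ = _ := by rw [hss]
    have c3 : √(E s) * (∑' k, wt k ^ (α + 1) * ‖d s k‖) * √(E s) ≤ C * M * E s := by
      calc _ ≤ √(E s) * (C * M) * √(E s) := by gcongr; exact w1.trans (by gcongr)
        _ = C * M * (√(E s) * √(E s)) := by ring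
        _ = _ := by rw [hss]
    have hsplit : ∑ k ∈ freq N, (starRingEnd ℂ) (d s k) * ((1 : ℝ) * G s k) =
        ∑ k ∈ freq N, ((κ₁ * k * qm α k * ‖d s k‖ ^ 2 : ℝ) : ℂ) +
        ∑ k ∈ freq N, (starRingEnd ℂ) (d s k) * (bil α κ₂ γ (y s) (d s) k +
          bil α κ₂ γ (d s) (y s) k - bil α κ₂ γ (d s) (d s) k) := by
      rw [← Finset.sum_add_distrib]
      refine Finset.sum_congr rfl fun k _ => ?_
      have h1 := bil_sub_bil α κ₂ γ (hsupp s hs) (hzsupp s hs) k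
      have h2 : ((‖d s k‖ ^ 2 : ℝ) : ℂ) = (starRingEnd ℂ) (d s k) * d s k := by
        rw [mul_comm, Complex.mul_conj, Complex.normSq_eq_norm_sq]
      have h3 : d s k = y s k - z s k := rfl
      rw [Complex.ofReal_mul _ (‖d s k‖ ^ 2), h2]
      simp only [hG]
      push_cast
      linear_combination (starRingEnd ℂ) (d s k) * h1 -
        (starRingEnd ℂ) (d s k) * (κ₁ * k * qm α k) * h3
    rw [hsplit, Complex.add_im, ← Complex.ofReal_sum, Complex.ofReal_im, zero_add]
    have h5 : ‖∑ k ∈ freq N, (starRingEnd ℂ) (d s k) * (bil α κ₂ γ (y s) (d s) k +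
          bil α κ₂ γ (d s) (y s) k - bil α κ₂ γ (d s) (d s) k)‖ ≤
        ∑ k ∈ freq N, ‖d s k‖ * ‖bil α κ₂ γ (y s) (d s) k‖ +
        ∑ k ∈ freq N, ‖d s k‖ * ‖bil α κ₂ γ (d s) (y s) k‖ +
        ∑ k ∈ freq N, ‖d s k‖ * ‖bil α κ₂ γ (d s) (d s) k‖ := by
      rw [← Finset.sum_add_distrib, ← Finset.sum_add_distrib]
      refine (norm_sum_le _ _).trans (Finset.sum_le_sum fun k _ => ?_)
      rw [norm_mul, RCLike.norm_conj, ← mul_add, ← mul_add]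
      exact mul_le_mul_of_nonneg_left ((norm_sub_le _ _).trans
        (add_le_add_left (norm_add_le _ _) _)) (norm_nonneg _)
    have h6 := mul_le_mul_of_nonneg_left c1 hS
    have h7 := mul_le_mul_of_nonneg_left c2 hS
    have h8 := mul_le_mul_of_nonneg_left c3 hS
    refine (le_abs_self _).trans ((Complex.abs_im_le_norm _).trans (h5.trans ?_))
    linarith
  have hzero : E 0 = 0 := by
    refine Finset.sum_eq_zero fun k _ => ?_
    have : y 0 k = (starRingEnd ℂ) (y 0 (-k)) := by rw [h0]; simp
    simp [hd, hz, ← this]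
  intro t ht k
  have hEt : E t ≤ 0 := by
    refine le_of_forall_pos_le_add fun η hη => ?_
    -- The barrier constant is chosen so that the barrier equals `η` at time `t`, with `η`
    -- arbitrary.
    have h1 := le_barrier (B := η / Real.exp (Λ * t)) (Λ := Λ) hEc hder
      (by rw [hzero]; positivity) (fun s hs hEs => ?_) t ht
    · rw [div_mul_cancel₀ _ (Real.exp_pos _).ne'] at h1
      linarith
    · have hp : 0 < η / Real.exp (Λ * t) * Real.exp (Λ * s) := by positivity
      rw [← hEs] at hp ⊢
      have := hrate s (Ioc_subset_Icc_self hs)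
      rw [hΛ]
      linarith
  have hdk : d t k = 0 := by
    by_cases hk : k ∈ freq N
    · have h1 : 1 * ‖d t k‖ ^ 2 ≤ E t :=
        Finset.single_le_sum (f := fun k => 1 * ‖d t k‖ ^ 2) (fun _ _ => by positivity) hk
      have h2 : ‖d t k‖ ^ 2 = 0 := le_antisymm (by linarith) (sq_nonneg _)
      simpa using h2
    · simp [hd, hsupp t ht k hk, hzsupp t ht k hk]
  have : y t k = (starRingEnd ℂ) (y t (-k)) := sub_eq_zero.1 hdk
  rw [this, Complex.conj_conj]

/-! ### Conservation of energy -/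

/-- The trilinear form with symbol `m`. -/
noncomputable def tri (F : Finset ℤ) (y : ℤ → ℂ) (m : ℤ → ℤ → ℝ) : ℂ :=
  ∑ k ∈ F, (starRingEnd ℂ) (y k) * ∑ l ∈ F, (m k l : ℂ) * (y (k - l) * y l)

theorem tri_add (F : Finset ℤ) (y : ℤ → ℂ) (m₁ m₂ : ℤ → ℤ → ℝ) :
    tri F y (fun k l => m₁ k l + m₂ k l) = tri F y m₁ + tri F y m₂ := by
  simp only [tri, Complex.ofReal_add, add_mul, Finset.sum_add_distrib, mul_add]

theorem tri_const_mul (F : Finset ℤ) (y : ℤ → ℂ) (c : ℝ) (m : ℤ → ℤ → ℝ) :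
    tri F y (fun k l => c * m k l) = c * tri F y m := by
  simp only [tri, Complex.ofReal_mul, Finset.mul_sum]
  refine Finset.sum_congr rfl fun k _ => Finset.sum_congr rfl fun l _ => ?_
  ring

theorem conj_tri (F : Finset ℤ) {y : ℤ → ℂ} (hy : ∀ k, y (-k) = (starRingEnd ℂ) (y k))
    (m : ℤ → ℤ → ℝ) : (starRingEnd ℂ) (tri F y m) = tri F y fun k l => m l k := by
  simp only [tri, map_sum, map_mul, Complex.conj_ofReal, ← hy, neg_sub, neg_neg, Finset.mul_sum]
  rw [Finset.sum_comm]
  refine Finset.sum_congr rfl fun k _ => Finset.sum_congr rfl fun l _ => ?_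
  ring

theorem tri_reflect {F : Finset ℤ} {y : ℤ → ℂ} (hF : ∀ l ∉ F, y l = 0) (m : ℤ → ℤ → ℝ) :
    tri F y m = tri F y fun k l => m k (k - l) := by
  refine Finset.sum_congr rfl fun k _ => ?_
  congr 1
  have h1 : ∑' l, (m k l : ℂ) * (y (k - l) * y l) = ∑ l ∈ F, (m k l : ℂ) * (y (k - l) * y l) :=
    tsum_eq_sum fun l hl => by simp [hF l hl]
  have h2 : ∑' l, (m k (k - l) : ℂ) * (y (k - l) * y l) =
      ∑ l ∈ F, (m k (k - l) : ℂ) * (y (k - l) * y l) :=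
    tsum_eq_sum fun l hl => by simp [hF l hl]
  rw [← h1, ← h2, ← (Equiv.subLeft k).tsum_eq]
  congr 1; ext l
  simp [mul_comm]

/-- Two symmetries act on the form: conjugation swaps `k` and `l`, and the substitution `l ↦ k - l`
leaves the product unchanged. They give `Q₁ = 2 conj Q₁`, so `Q₁` has zero imaginary part, and turn
the `κ₂` part into `Q₂ + conj Q₂`, which is real. -/
theorem im_tri_sym {F : Finset ℤ} {y : ℤ → ℂ} (hy : ∀ k, y (-k) = (starRingEnd ℂ) (y k))
    (hF : ∀ l ∉ F, y l = 0) (α κ₂ γ : ℝ) : (tri F y (sym α κ₂ γ)).im = 0 := by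
  set Q₁ := tri F y fun (k _ : ℤ) => (k : ℝ)
  set Q₂ := tri F y fun (k _ : ℤ) => |(k : ℝ)| ^ α * k
  have h1 : tri F y (fun (_ l : ℤ) => (l : ℝ)) = (starRingEnd ℂ) Q₁ := (conj_tri F hy _).symm
  have h2 : tri F y (fun (_ l : ℤ) => |(l : ℝ)| ^ α * l) = (starRingEnd ℂ) Q₂ := (conj_tri F hy _).symm
  have h3 : Q₁ = 2 * (starRingEnd ℂ) Q₁ := by
    have e1 := tri_reflect hF fun (_ l : ℤ) => (l : ℝ)
    have e2 := tri_add F y (fun (k l : ℤ) => ((k - l : ℤ) : ℝ)) fun (_ l : ℤ) => (l : ℝ)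
    have e3 : (fun k l : ℤ => ((k - l : ℤ) : ℝ) + l) = fun (k _ : ℤ) => (k : ℝ) := by
      ext k l; push_cast; ring
    rw [e3, ← e1, h1] at e2
    rw [two_mul]; exact e2
  have h4 : Q₂ = 2 * tri F y fun (k l : ℤ) => |(k : ℝ)| ^ α * l := by
    have e1 := tri_reflect hF fun (k l : ℤ) => |(k : ℝ)| ^ α * (l : ℝ)
    have e2 := tri_add F y (fun (k l : ℤ) => |(k : ℝ)| ^ α * ((k - l : ℤ) : ℝ))
      fun (k l : ℤ) => |(k : ℝ)| ^ α * (l : ℝ)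
    have e3 : (fun k l : ℤ => |(k : ℝ)| ^ α * ((k - l : ℤ) : ℝ) + |(k : ℝ)| ^ α * (l : ℝ)) =
        fun (k _ : ℤ) => |(k : ℝ)| ^ α * k := by
      ext k l; push_cast; ring
    rw [e3, ← e1] at e2
    rw [two_mul]; exact e2
  have h5 : tri F y (sym α κ₂ γ) = 3 / 2 * γ * Q₁ + κ₂ * (Q₂ + (starRingEnd ℂ) Q₂) := by
    have e1 : sym α κ₂ γ = fun (k l : ℤ) => 3 / 2 * γ * (k : ℝ) +
        κ₂ * (2 * (|(k : ℝ)| ^ α * l) + |(l : ℝ)| ^ α * l) := by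
      ext k l; rw [sym]; ring
    rw [e1, tri_add F y (fun (k _ : ℤ) => 3 / 2 * γ * (k : ℝ))
      fun (k l : ℤ) => κ₂ * (2 * (|(k : ℝ)| ^ α * l) + |(l : ℝ)| ^ α * l), tri_const_mul F y (3 / 2 * γ),
      tri_const_mul F y κ₂, tri_add F y (fun (k l : ℤ) => 2 * (|(k : ℝ)| ^ α * l)), tri_const_mul F y 2,
      h2, h4]
    push_cast
    rfl
  have h6 : Q₁.im = 0 := by
    have := congrArg Complex.im h3
    simp at this
    linarith
  rw [h5, Complex.add_conj]
  simp [h6]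

/-- The energy `∑ (1 + |k|^α) |y k|²` is conserved: its weight cancels `qm` and leaves the symbol
`sym`. The resulting bound does not depend on `N`. -/
theorem ModeSol.sum_sq_le {α : ℝ} (hα : α ∈ Icc (1 : ℝ) 2) {κ₁ κ₂ γ T A : ℝ} {N : ℕ}
    {y : ℝ → ℤ → ℂ} (hy : ModeSol α κ₁ κ₂ γ T (freq N) y)
    (hsupp : ∀ t ∈ Icc 0 T, ∀ l ∉ freq N, y t l = 0)
    (hreal : ∀ t ∈ Icc 0 T, ∀ k, y t (-k) = (starRingEnd ℂ) (y t k))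
    (hA : ∑ k ∈ freq N, wt k ^ (α + 1) * ‖y 0 k‖ ≤ A) :
    ∀ t ∈ Icc 0 T, ∑ k ∈ freq N, ‖y t k‖ ^ 2 ≤ (2 * A ^ 2 + 1) * Real.exp T := by
  have hα0 : 0 ≤ α := by linarith [hα.1]
  have hWn : ∀ k, 0 ≤ wt k ^ (α + 1) := fun k => Real.rpow_nonneg (wt_pos k).le _
  set c : ℤ → ℝ := fun k => 1 + |(k : ℝ)| ^ α with hc
  set H : ℝ → ℝ := fun t => ∑ k ∈ freq N, c k * ‖y t k‖ ^ 2 with hH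
  have hHc : ContinuousOn H (Icc 0 T) := continuousOn_energy (fun k => hy.cont k) _
  have hder : ∀ s ∈ Ioc 0 T, HasDerivWithinAt H (0 : ℝ) (Icc 0 T) s := by
    intro s hs
    have hsI : s ∈ Icc 0 T := Ioc_subset_Icc_self hs
    refine (hasDerivWithinAt_energy (e := y) (fun k hk => ?_) c
      (S := fun k => (κ₁ * k * qm α k : ℝ) * y s k + bil α κ₂ γ (y s) (y s) k)).congr_deriv ?_
    · exact hy.deriv k hk s hs
    · have h1 : ∑ k ∈ freq N, (starRingEnd ℂ) (y s k) *
          (c k * ((κ₁ * k * qm α k : ℝ) * y s k + bil α κ₂ γ (y s) (y s) k)) =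
          ∑ k ∈ freq N, ((κ₁ * k * ‖y s k‖ ^ 2 : ℝ) : ℂ) + tri (freq N) (y s) (sym α κ₂ γ) := by
        rw [tri, ← Finset.sum_add_distrib]
        refine Finset.sum_congr rfl fun k _ => ?_
        have hq : (c k : ℂ) * (qm α k : ℂ) = 1 := by
          rw [← Complex.ofReal_mul, qm, mul_inv_cancel₀ (by positivity), Complex.ofReal_one]
        have h2 : ((‖y s k‖ ^ 2 : ℝ) : ℂ) = (starRingEnd ℂ) (y s k) * y s k := by
          rw [mul_comm, Complex.mul_conj, Complex.normSq_eq_norm_sq]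
        have h3 : (c k : ℂ) * bil α κ₂ γ (y s) (y s) k =
            ∑ l ∈ freq N, (sym α κ₂ γ k l : ℂ) * (y s (k - l) * y s l) := by
          rw [bil_eq_sum _ _ _ _ (hsupp s hsI), Finset.mul_sum]
          refine Finset.sum_congr rfl fun l _ => ?_
          rw [sig]; push_cast
          linear_combination ((sym α κ₂ γ k l : ℂ) * (y s (k - l) * y s l)) * hq
        rw [← h3, Complex.ofReal_mul _ (‖y s k‖ ^ 2), h2]
        push_cast
        linear_combination ((starRingEnd ℂ) (y s k) * (κ₁ * k) * y s k) * hq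
      rw [h1, Complex.add_im, ← Complex.ofReal_sum, Complex.ofReal_im,
        im_tri_sym (hreal s hsI) (hsupp s hsI)]
      simp
  have hA0 : 0 ≤ A := (Finset.sum_nonneg fun k _ => mul_nonneg (hWn k) (norm_nonneg _)).trans hA
  have hH0 : H 0 < 2 * A ^ 2 + 1 := by
    have h1 : ∀ k ∈ freq N, c k * ‖y 0 k‖ ^ 2 ≤ 2 * A * (wt k ^ (α + 1) * ‖y 0 k‖) := by
      intro k hk
      have h2 : wt k ^ (α + 1) * ‖y 0 k‖ ≤ A := (Finset.single_le_sum
        (f := fun k => wt k ^ (α + 1) * ‖y 0 k‖)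
        (fun k _ => mul_nonneg (hWn k) (norm_nonneg _)) hk).trans hA
      have h3 : ‖y 0 k‖ ≤ A := le_trans
        (le_mul_of_one_le_left (norm_nonneg _) (one_le_wt_rpow (by linarith) k)) h2
      have h4 : c k ≤ 2 * wt k ^ (α + 1) := by
        have e1 := abs_rpow_le_wt hα0 k
        have e2 : wt k ^ α ≤ wt k ^ (α + 1) :=
          Real.rpow_le_rpow_of_exponent_le (one_le_wt k) (by linarith)
        have e3 := one_le_wt_rpow (by linarith : 0 ≤ α + 1) k
        rw [hc]; dsimp only; linarith
      have h5 := hWn k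
      calc c k * ‖y 0 k‖ ^ 2 ≤ (2 * wt k ^ (α + 1)) * (A * ‖y 0 k‖) := by
            rw [sq]; gcongr
        _ = _ := by ring
    have h6 : H 0 ≤ 2 * A * A := by
      refine (Finset.sum_le_sum h1).trans ?_
      rw [← Finset.mul_sum]; gcongr
    linarith
  intro t ht
  -- The energy is constant, but `le_barrier` asks for strict inequality; a growing barrier supplies
  -- it at the price of a factor `exp T`.
  have h1 := le_barrier (Λ := 1) hHc hder hH0 (fun s _ _ => by positivity) t ht
  have h2 : ∑ k ∈ freq N, ‖y t k‖ ^ 2 ≤ H t := Finset.sum_le_sum fun k _ =>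
    le_mul_of_one_le_left (sq_nonneg _) (by
      rw [hc]; linarith [Real.rpow_nonneg (abs_nonneg (k : ℝ)) α])
  refine h2.trans (h1.trans ?_)
  have : Real.exp (1 * t) ≤ Real.exp T := Real.exp_le_exp.2 (by linarith [ht.2])
  gcongr

/-! ### Propagation of analyticity for the Galerkin solution -/

theorem sum_sum_trilinear_le {F : Finset ℤ} (f : ℤ → ℝ) {g h : ℤ → ℝ} (hf0 : ∀ k, 0 ≤ f k)
    (hg0 : ∀ k, 0 ≤ g k) (hh0 : ∀ k, 0 ≤ h k) (hg : ∀ k ∉ F, g k = 0) (hh : ∀ k ∉ F, h k = 0) :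
    ∑ k ∈ F, ∑ l ∈ F, f k * (g l * h (k - l)) ≤
      √(∑ k ∈ F, f k ^ 2) * (∑ k ∈ F, g k) * √(∑ k ∈ F, h k ^ 2) := by
  have hgs : Summable g := summable_of_ne_finset_zero (s := F) hg
  have hhs : Summable fun k => h k ^ 2 :=
    summable_of_ne_finset_zero (s := F) fun k hk => by simp [hh k hk]
  have h1 := trilinear_le F (f := f) hg0 hgs hhs
  rw [tsum_eq_sum (s := F) hg, tsum_eq_sum (s := F) (f := fun k => h k ^ 2)
    fun k hk => by simp [hh k hk]] at h1
  refine le_trans (Finset.sum_le_sum fun k _ => ?_) h1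
  rw [← Finset.mul_sum]
  exact mul_le_mul_of_nonneg_left ((summable_mul_shift hg0 hgs hhs k).sum_le_tsum F
    fun l _ => mul_nonneg (hg0 _) (hh0 _)) (hf0 k)

theorem sum_sum_trilinear_le' {F : Finset ℤ} (f : ℤ → ℝ) {g h : ℤ → ℝ} (hf0 : ∀ k, 0 ≤ f k)
    (hg0 : ∀ k, 0 ≤ g k) (hh0 : ∀ k, 0 ≤ h k) (hg : ∀ k ∉ F, g k = 0) (hh : ∀ k ∉ F, h k = 0) :
    ∑ k ∈ F, ∑ l ∈ F, f k * (g (k - l) * h l) ≤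
      √(∑ k ∈ F, f k ^ 2) * (∑ k ∈ F, g k) * √(∑ k ∈ F, h k ^ 2) := by
  refine le_trans (le_of_eq ?_) (sum_sum_trilinear_le f hf0 hg0 hh0 hg hh)
  refine Finset.sum_congr rfl fun k _ => ?_
  have h1 : ∑' l, g (k - l) * h l = ∑ l ∈ F, g (k - l) * h l :=
    tsum_eq_sum fun l hl => by simp [hh l hl]
  have h2 : ∑' l, g l * h (k - l) = ∑ l ∈ F, g l * h (k - l) :=
    tsum_eq_sum fun l hl => by simp [hg l hl]
  rw [← Finset.mul_sum, ← Finset.mul_sum, ← h1, ← h2, tsum_mul_shift]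

/-- The Gevrey weight `(1 + x)⁴ e^{τ x}`. -/
noncomputable def gev (τ x : ℝ) : ℝ := (1 + x) ^ 4 * Real.exp (τ * x)

theorem gev_pos (τ : ℝ) {x : ℝ} (hx : 0 ≤ x) : 0 < gev τ x := by unfold gev; positivity

/-! ### Commutator of the Gevrey weight with transport -/

theorem exp_le_one_add_mul_exp (x : ℝ) : Real.exp x ≤ 1 + x * Real.exp x := by
  have h1 := Real.add_one_le_exp (-x)
  have h2 : Real.exp (-x) * Real.exp x = 1 := by rw [← Real.exp_add]; simp
  nlinarith [Real.exp_pos x]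

/-- The expression equals `q (W p - W q) (W p + W q) - (p - q) (W q)²` with `W = gev τ`.
Differencing the polynomial factor of the weight loses no derivative. Differencing the exponential
loses one, but carries a factor `τ`, and that derivative is shared as `√p * √q`. The inequality `exp
x ≤ 1 + x exp x` keeps the part without `τ` free of exponentials of `p - q`. -/
theorem abs_gev_transport_le_of_le {τ p q : ℝ} (hτ : 0 ≤ τ) (hq : 0 ≤ q) (hqp : q ≤ p)
    (hp3 : p ≤ 3 * q) : |q * gev τ p ^ 2 - p * gev τ q ^ 2| ≤
      1500 * (((p - q) + τ * (√p * √q) * ((p - q) * Real.exp (τ * (p - q)))) *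
        (gev τ p * gev τ q)) := by
  have hp : 0 ≤ p := hq.trans hqp
  set d := p - q with hd
  have hd0 : 0 ≤ d := by linarith
  set r := Real.exp (τ * d) with hr
  have hr1 : 1 ≤ r := Real.one_le_exp (by positivity)
  have hr2 : r ≤ 1 + τ * d * r := exp_le_one_add_mul_exp _
  have hWp := gev_pos τ hp
  have hWq := gev_pos τ hq
  have hexp : Real.exp (τ * p) = Real.exp (τ * q) * r := by
    rw [hr, ← Real.exp_add]; congr 1; rw [hd]; ring
  have hqq : q ≤ √p * √q := by
    rw [← Real.sqrt_mul hp]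
    exact Real.le_sqrt_of_sq_le (by nlinarith)
  have hdq : d ≤ 2 * (√p * √q) := by linarith
  have hmono : gev τ q ≤ gev τ p := by
    unfold gev; gcongr
  -- The fourth power of `1 + p ≤ 3 (1 + q)` gives `81`.
  have h81 : gev τ p ≤ 81 * r * gev τ q := by
    unfold gev
    rw [hexp]
    have : (1 + p) ^ 4 ≤ (3 * (1 + q)) ^ 4 := pow_le_pow_left₀ (by linarith) (by linarith) 4
    have he := Real.exp_pos (τ * q)
    calc (1 + p) ^ 4 * (Real.exp (τ * q) * r) ≤ (3 * (1 + q)) ^ 4 * (Real.exp (τ * q) * r) := by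
          gcongr
      _ = _ := by ring
  have hdiff : q * (gev τ p - gev τ q) ≤ d * (4 + τ * q) * gev τ p := by
    have e1 : gev τ p - gev τ q = Real.exp (τ * q) *
        (((1 + p) ^ 4 - (1 + q) ^ 4) * r + (1 + q) ^ 4 * (r - 1)) := by
      unfold gev; rw [hexp]; ring
    have e2 : (1 + p) ^ 4 - (1 + q) ^ 4 ≤ 4 * d * (1 + p) ^ 3 := by
      have : (1 + p) ^ 4 - (1 + q) ^ 4 =
        d * ((1 + p) ^ 3 + (1 + p) ^ 2 * (1 + q) + (1 + p) * (1 + q) ^ 2 + (1 + q) ^ 3) := by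
        rw [hd]; ring
      have h1 : (1 + p) ^ 2 * (1 + q) ≤ (1 + p) ^ 2 * (1 + p) := by gcongr
      have h2 : (1 + p) * (1 + q) ^ 2 ≤ (1 + p) * (1 + p) ^ 2 := by gcongr
      have h3 : (1 + q) ^ 3 ≤ (1 + p) ^ 3 := by gcongr
      rw [this, mul_comm 4 d, mul_assoc]
      exact mul_le_mul_of_nonneg_left (by linarith) hd0
    have e3 : r - 1 ≤ τ * d * r := by linarith
    have e4 : q * (((1 + p) ^ 4 - (1 + q) ^ 4) * r + (1 + q) ^ 4 * (r - 1)) ≤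
        d * (4 + τ * q) * ((1 + p) ^ 4 * r) := by
      calc q * (((1 + p) ^ 4 - (1 + q) ^ 4) * r + (1 + q) ^ 4 * (r - 1))
          ≤ q * (4 * d * (1 + p) ^ 3 * r + (1 + p) ^ 4 * (τ * d * r)) := by gcongr
        _ ≤ (1 + p) * (4 * d * (1 + p) ^ 3 * r) + q * ((1 + p) ^ 4 * (τ * d * r)) := by
            rw [mul_add]; gcongr; linarith
        _ = _ := by ring
    have he := Real.exp_pos (τ * q)
    calc q * (gev τ p - gev τ q) = Real.exp (τ * q) *
          (q * (((1 + p) ^ 4 - (1 + q) ^ 4) * r + (1 + q) ^ 4 * (r - 1))) := by rw [e1]; ring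
      _ ≤ Real.exp (τ * q) * (d * (4 + τ * q) * ((1 + p) ^ 4 * r)) := by gcongr
      _ = _ := by unfold gev; rw [hexp]; ring
  have hmain : d * (4 + τ * q) * r ≤ 4 * d + 9 * (τ * (√p * √q) * (d * r)) := by
    have h1 : 4 * d * r ≤ 4 * d + 4 * (τ * d * (d * r)) := by nlinarith
    have h2 : τ * d * (d * r) ≤ τ * (2 * (√p * √q)) * (d * r) := by gcongr
    have h3 : τ * q * (d * r) ≤ τ * (√p * √q) * (d * r) := by gcongr
    nlinarith
  set s := √p * √q with hs
  have hs0 : 0 ≤ s := by positivity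
  have hpp : 0 ≤ gev τ p * gev τ q := by positivity
  have e5 : q * gev τ p ^ 2 - p * gev τ q ^ 2 =
      q * (gev τ p - gev τ q) * (gev τ p + gev τ q) - d * gev τ q ^ 2 := by rw [hd]; ring
  have h6 : q * (gev τ p - gev τ q) * (gev τ p + gev τ q) ≤
      162 * ((4 * d + 9 * (τ * s * (d * r))) * (gev τ p * gev τ q)) := by
    calc _ ≤ d * (4 + τ * q) * gev τ p * (gev τ p + gev τ p) := by gcongr
      _ = 2 * (d * (4 + τ * q)) * gev τ p * gev τ p := by ring
      _ ≤ 2 * (d * (4 + τ * q)) * gev τ p * (81 * r * gev τ q) := by gcongr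
      _ = 162 * ((d * (4 + τ * q) * r) * (gev τ p * gev τ q)) := by ring
      _ ≤ _ := by gcongr
  have h7 : 0 ≤ q * (gev τ p - gev τ q) * (gev τ p + gev τ q) :=
    mul_nonneg (mul_nonneg hq (by linarith)) (by linarith)
  have h8 : d * gev τ q ^ 2 ≤ d * (gev τ p * gev τ q) := by
    rw [sq]; gcongr
  have h9 : 0 ≤ d * gev τ q ^ 2 := by positivity
  have h10 : 0 ≤ d * (gev τ p * gev τ q) := by positivity
  have h11 : 0 ≤ τ * s * (d * r) * (gev τ p * gev τ q) := by positivity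
  rw [e5, abs_le]
  constructor <;> nlinarith

theorem abs_gev_transport_le {τ p q : ℝ} (hτ : 0 ≤ τ) (hp : 0 ≤ p) (hq : 0 ≤ q)
    (h : 2 * |p - q| ≤ p + q) : |q * gev τ p ^ 2 - p * gev τ q ^ 2| ≤
      1500 * ((|p - q| + τ * (√p * √q) * (|p - q| * Real.exp (τ * |p - q|))) *
        (gev τ p * gev τ q)) := by
  rcases le_total q p with h1 | h1
  · rw [abs_of_nonneg (by linarith : 0 ≤ p - q)] at h ⊢
    exact abs_gev_transport_le_of_le hτ hq h1 (by linarith)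
  · rw [abs_sub_comm p q, abs_of_nonneg (by linarith : 0 ≤ q - p)] at h ⊢
    rw [abs_sub_comm, mul_comm (√p), mul_comm (gev τ p) (gev τ q)]
    exact abs_gev_transport_le_of_le hτ hp h1 (by linarith)

theorem abs_gev_transport_int_le {τ : ℝ} (hτ : 0 ≤ τ) {k l : ℤ}
    (h : 2 * |((k - l : ℤ) : ℝ)| ≤ |(k : ℝ)| + |(l : ℝ)|) :
    |(l : ℝ) * gev τ |(k : ℝ)| ^ 2 - k * gev τ |(l : ℝ)| ^ 2| ≤
      1500 * ((|((k - l : ℤ) : ℝ)| + τ * (√|(k : ℝ)| * √|(l : ℝ)|) *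
        (|((k - l : ℤ) : ℝ)| * Real.exp (τ * |((k - l : ℤ) : ℝ)|))) *
        (gev τ |(k : ℝ)| * gev τ |(l : ℝ)|)) := by
  have h1 := abs_gev_transport_le hτ (abs_nonneg (k : ℝ)) (abs_nonneg (l : ℝ))
  push_cast at h ⊢
  rcases le_total 0 (k : ℝ) with hk | hk <;> rcases le_total 0 (l : ℝ) with hl | hl
  · rw [abs_of_nonneg hk, abs_of_nonneg hl] at *
    exact h1 h
  -- For opposite signs `|k - l| = |k| + |l|`, so the hypothesis forces both frequencies to vanish.
  · rw [abs_of_nonneg hk, abs_of_nonpos hl, abs_of_nonneg (by linarith)] at h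
    have e1 : (k : ℝ) = 0 := by linarith
    have e2 : (l : ℝ) = 0 := by linarith
    simp [e1, e2]
  · rw [abs_of_nonpos hk, abs_of_nonneg hl, abs_of_nonpos (by linarith)] at h
    have e1 : (k : ℝ) = 0 := by linarith
    have e2 : (l : ℝ) = 0 := by linarith
    simp [e1, e2]
  · have e1 : |(k : ℝ) - l| = |(|(k : ℝ)| - |(l : ℝ)|)| := by
      rw [abs_of_nonpos hk, abs_of_nonpos hl, abs_sub_comm]; congr 1; ring
    have e2 : |(l : ℝ) * gev τ |(k : ℝ)| ^ 2 - k * gev τ |(l : ℝ)| ^ 2| =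
        |(|(l : ℝ)| * gev τ |(k : ℝ)| ^ 2 - |(k : ℝ)| * gev τ |(l : ℝ)| ^ 2)| := by
      generalize gev τ |(k : ℝ)| = u
      generalize gev τ |(l : ℝ)| = v
      rw [abs_of_nonpos hk, abs_of_nonpos hl, ← abs_neg]
      congr 1; ring
    rw [e2, e1]
    rw [e1] at h
    exact h1 h

theorem gev_le_of_abs_le {τ : ℝ} (hτ : 0 ≤ τ) {k n m : ℤ}
    (hk : |(k : ℝ)| ≤ |(n : ℝ)| + |(m : ℝ)|) (hnm : |(n : ℝ)| ≤ |(m : ℝ)|) :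
    gev τ |(k : ℝ)| ≤ 16 * (gev τ |(m : ℝ)| * Real.exp (τ * |(n : ℝ)|)) := by
  have hk0 := abs_nonneg (k : ℝ)
  have hm0 := abs_nonneg (m : ℝ)
  unfold gev
  calc (1 + |(k : ℝ)|) ^ 4 * Real.exp (τ * |(k : ℝ)|)
      ≤ (2 * (1 + |(m : ℝ)|)) ^ 4 * Real.exp (τ * |(m : ℝ)| + τ * |(n : ℝ)|) := by
        gcongr
        · linarith
        · nlinarith
    _ = _ := by rw [Real.exp_add]; ring

/-- The exponential on the low frequency is traded for a part without exponential and a part with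
factor `τ`. The latter's extra `|n|` is split into half derivatives on the low and the high factor.
-/
theorem low_high_le {α τ : ℝ} (hα : α ∈ Icc (1 : ℝ) 2) (hτ : 0 ≤ τ) (y : ℤ → ℂ) {n m : ℤ}
    (hnm : |(n : ℝ)| ≤ |(m : ℝ)|) {z : ℝ} (hz : 0 ≤ z) :
    wt n ^ (α + 1) * Real.exp (τ * |(n : ℝ)|) * ‖y n‖ * z ≤
      wt n ^ (α + 1) * ‖y n‖ * z +
        τ * ((wt n ^ 3 * √|(n : ℝ)| * Real.exp (τ * |(n : ℝ)|) * ‖y n‖) * (√|(m : ℝ)| * z)) := by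
  have hn0 := abs_nonneg (n : ℝ)
  have hW := Real.rpow_nonneg (wt_pos n).le (α + 1)
  have hW3 : wt n ^ (α + 1) ≤ wt n ^ 3 := by
    rw [← Real.rpow_natCast]
    exact Real.rpow_le_rpow_of_exponent_le (one_le_wt n) (by push_cast; linarith [hα.2])
  have h1 := exp_le_one_add_mul_exp (τ * |(n : ℝ)|)
  have h2 : |(n : ℝ)| ≤ √|(n : ℝ)| * √|(m : ℝ)| := by
    rw [← Real.sqrt_mul hn0]
    exact Real.le_sqrt_of_sq_le (by nlinarith)
  have he := Real.exp_pos (τ * |(n : ℝ)|)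
  have hw3 : 0 ≤ wt n ^ 3 := pow_nonneg (wt_pos n).le 3
  calc wt n ^ (α + 1) * Real.exp (τ * |(n : ℝ)|) * ‖y n‖ * z
      ≤ wt n ^ (α + 1) * (1 + τ * |(n : ℝ)| * Real.exp (τ * |(n : ℝ)|)) * ‖y n‖ * z := by gcongr
    _ = wt n ^ (α + 1) * ‖y n‖ * z +
        wt n ^ (α + 1) * (τ * |(n : ℝ)| * Real.exp (τ * |(n : ℝ)|)) * ‖y n‖ * z := by ring
    _ ≤ wt n ^ (α + 1) * ‖y n‖ * z +
        wt n ^ 3 * (τ * (√|(n : ℝ)| * √|(m : ℝ)|) * Real.exp (τ * |(n : ℝ)|)) * ‖y n‖ * z := by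
        gcongr
    _ = _ := by ring

/-- The quadratic symbol without the transport part of the interactions in which the advecting
frequency `k - l` is not dominant. -/
noncomputable def rem (α κ₂ γ : ℝ) (k l : ℤ) : ℝ :=
  sig α κ₂ γ k l - if 2 * |((k - l : ℤ) : ℝ)| ≤ |(k : ℝ)| + |(l : ℝ)| then 3 * κ₂ * l else 0

theorem abs_rem_le_right {α : ℝ} (hα : α ∈ Icc (1 : ℝ) 2) (κ₂ γ : ℝ) (k l : ℤ) :
    |rem α κ₂ γ k l| ≤ 2 * symC κ₂ γ * wt l ^ (α + 1) := by
  have hW := Real.rpow_nonneg (wt_pos l).le (α + 1)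
  have hSW := mul_nonneg (symC_nonneg κ₂ γ) hW
  have hκW := mul_nonneg (abs_nonneg κ₂) hW
  unfold rem
  split_ifs
  · have := abs_rho_le_wt_right hα κ₂ γ k l
    rw [rho] at this
    linarith
  · rw [sub_zero]
    linarith [abs_sig_le hα κ₂ γ k l]

/-- Where the transport part is not removed, `k - l` is dominant, `|l| ≤ 2 |k - l|`, and the
transport part is itself controlled by `wt (k - l)`. -/
theorem abs_rem_le_sub {α : ℝ} (hα : α ∈ Icc (1 : ℝ) 2) (κ₂ γ : ℝ) (k l : ℤ) :
    |rem α κ₂ γ k l| ≤ 2 * symC κ₂ γ * wt (k - l) ^ (α + 1) := by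
  have hW := Real.rpow_nonneg (wt_pos (k - l)).le (α + 1)
  have hSW := mul_nonneg (symC_nonneg κ₂ γ) hW
  have hκW := mul_nonneg (abs_nonneg κ₂) hW
  have h1 := abs_rho_le_wt_sub hα κ₂ γ k l
  unfold rem
  split_ifs with h
  · rw [rho] at h1
    linarith
  · push Not at h
    have h2 := (abs_le_wt (k - l)).trans (wt_le_wt_rpow (by linarith [hα.1] : 0 ≤ α) (k - l))
    have h3 : |(l : ℝ)| ≤ 2 * wt (k - l) ^ (α + 1) := by linarith [abs_nonneg (k : ℝ)]
    have h4 := mul_le_mul_of_nonneg_left h3 (abs_nonneg κ₂)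
    have h5 : sig α κ₂ γ k l = rho α κ₂ γ k l + 3 * κ₂ * l := by rw [rho]; ring
    have h6 := abs_add_le (rho α κ₂ γ k l) (3 * κ₂ * l)
    rw [abs_mul (3 * κ₂), abs_mul 3, abs_of_pos (by norm_num : (0 : ℝ) < 3)] at h6
    have h7 : 40 * |κ₂| * wt (k - l) ^ (α + 1) ≤ symC κ₂ γ * wt (k - l) ^ (α + 1) := by
      refine mul_le_mul_of_nonneg_right ?_ hW
      rw [symC]; linarith [abs_nonneg γ]
    rw [sub_zero, h5]
    linarith

/-- Since `rem` is bounded by the weight of either interacting frequency, the weight is placed on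
the lower one. One Gevrey weight of `k` then passes to the higher frequency, leaving an exponential
on the lower one for `low_high_le` to split. -/
theorem rem_term_le {α τ : ℝ} (hα : α ∈ Icc (1 : ℝ) 2) (hτ : 0 ≤ τ) (κ₂ γ : ℝ) (y : ℤ → ℂ)
    {z u g h : ℤ → ℝ} (hz : ∀ n, z n = gev τ |(n : ℝ)| * ‖y n‖)
    (hu : ∀ n, u n = wt n ^ (α + 1) * ‖y n‖)
    (hg : ∀ n, g n = wt n ^ 3 * √|(n : ℝ)| * Real.exp (τ * |(n : ℝ)|) * ‖y n‖)
    (hh : ∀ n, h n = √|(n : ℝ)| * z n) (k l : ℤ) :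
    |gev τ |(k : ℝ)| ^ 2 * rem α κ₂ γ k l| * (‖y (k - l)‖ * ‖y l‖ * ‖y k‖) ≤
      32 * symC κ₂ γ * (z k * (u (k - l) * z l) + z k * (u l * z (k - l)) +
        τ * (z k * (g (k - l) * h l) + z k * (g l * h (k - l)))) := by
  have hS := symC_nonneg κ₂ γ
  have hgev : ∀ n : ℤ, 0 < gev τ |(n : ℝ)| := fun n => gev_pos τ (abs_nonneg _)
  have hz0 : ∀ n, 0 ≤ z n := fun n => by rw [hz]; exact mul_nonneg (hgev n).le (norm_nonneg _)
  have hW : ∀ n, 0 ≤ wt n ^ (α + 1) := fun n => Real.rpow_nonneg (wt_pos n).le _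
  have hu0 : ∀ n, 0 ≤ u n := fun n => by rw [hu]; exact mul_nonneg (hW n) (norm_nonneg _)
  have hg0 : ∀ n, 0 ≤ g n := fun n => by
    rw [hg]; have := pow_nonneg (wt_pos n).le 3; positivity
  have hh0 : ∀ n, 0 ≤ h n := fun n => by rw [hh]; exact mul_nonneg (Real.sqrt_nonneg _) (hz0 n)
  have key : ∀ n m : ℤ, |(k : ℝ)| ≤ |(n : ℝ)| + |(m : ℝ)| → |(n : ℝ)| ≤ |(m : ℝ)| →
      |rem α κ₂ γ k l| ≤ 2 * symC κ₂ γ * wt n ^ (α + 1) →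
      |gev τ |(k : ℝ)| ^ 2 * rem α κ₂ γ k l| * (‖y n‖ * ‖y m‖ * ‖y k‖) ≤
        32 * symC κ₂ γ * (z k * (u n * z m) + τ * (z k * (g n * h m))) := by
    intro n m h1 h2 h3
    have h4 := gev_le_of_abs_le hτ h1 h2
    have h5 := low_high_le hα hτ y h2 (hz0 m)
    rw [← hu, ← hg, ← hh] at h5
    have he := Real.exp_pos (τ * |(n : ℝ)|)
    rw [abs_mul, abs_of_pos (pow_pos (hgev k) 2)]
    have hk := (hgev k).le
    have hm := (hgev m).le
    have hWn := hW n
    calc gev τ |(k : ℝ)| ^ 2 * |rem α κ₂ γ k l| * (‖y n‖ * ‖y m‖ * ‖y k‖)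
        = gev τ |(k : ℝ)| * gev τ |(k : ℝ)| * |rem α κ₂ γ k l| * (‖y n‖ * ‖y m‖ * ‖y k‖) := by ring
      _ ≤ gev τ |(k : ℝ)| * (16 * (gev τ |(m : ℝ)| * Real.exp (τ * |(n : ℝ)|))) *
            (2 * symC κ₂ γ * wt n ^ (α + 1)) * (‖y n‖ * ‖y m‖ * ‖y k‖) := by gcongr
      _ = 32 * symC κ₂ γ * (z k *
            (wt n ^ (α + 1) * Real.exp (τ * |(n : ℝ)|) * ‖y n‖ * z m)) := by
          rw [hz k, hz m]; ring
      _ ≤ 32 * symC κ₂ γ * (z k * (u n * z m + τ * (g n * h m))) := by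
          have := hz0 k
          gcongr
      _ = _ := by ring
  have hk1 : |(k : ℝ)| ≤ |(l : ℝ)| + |((k - l : ℤ) : ℝ)| := by
    have := abs_add_le (l : ℝ) ((k - l : ℤ) : ℝ)
    push_cast at this ⊢
    simpa using this
  have p1 : 0 ≤ z k * (u (k - l) * z l) := mul_nonneg (hz0 _) (mul_nonneg (hu0 _) (hz0 _))
  have p2 : 0 ≤ z k * (u l * z (k - l)) := mul_nonneg (hz0 _) (mul_nonneg (hu0 _) (hz0 _))
  have p3 : 0 ≤ τ * (z k * (g (k - l) * h l)) :=
    mul_nonneg hτ (mul_nonneg (hz0 _) (mul_nonneg (hg0 _) (hh0 _)))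
  have p4 : 0 ≤ τ * (z k * (g l * h (k - l))) :=
    mul_nonneg hτ (mul_nonneg (hz0 _) (mul_nonneg (hg0 _) (hh0 _)))
  rcases le_total |(l : ℝ)| |((k - l : ℤ) : ℝ)| with hlj | hlj
  · have := key l (k - l) hk1 hlj (abs_rem_le_right hα κ₂ γ k l)
    rw [mul_comm ‖y l‖] at this
    refine this.trans (mul_le_mul_of_nonneg_left ?_ (by positivity))
    linarith
  · have := key (k - l) l (by linarith) hlj (abs_rem_le_sub hα κ₂ γ k l)
    refine this.trans (mul_le_mul_of_nonneg_left ?_ (by positivity))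
    linarith

/-- The constant `(∑_k (1 + |k|)⁻²)^{1/2}`. -/
noncomputable def wtC : ℝ := √(∑' k : ℤ, (wt k ^ 2)⁻¹)

theorem summable_wt_inv : Summable fun k : ℤ => (wt k ^ 2)⁻¹ := by
  have h1 : Summable fun k : ℤ => 1 / |(k : ℝ)| ^ (2 : ℕ) := by
    have := Real.summable_one_div_int_pow (p := 2)
    simpa using this
  rw [← (Set.finite_singleton (0 : ℤ)).summable_compl_iff] at h1 ⊢
  refine h1.of_nonneg_of_le (fun k => inv_nonneg.2 (sq_nonneg _)) fun k => ?_
  have hk : 0 < |((k : ℤ) : ℝ)| := by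
    rw [abs_pos]; exact_mod_cast k.2
  have := abs_le_wt (k : ℤ)
  change (wt k ^ 2)⁻¹ ≤ 1 / |((k : ℤ) : ℝ)| ^ 2
  rw [one_div]
  gcongr

theorem sum_le_wtC (F : Finset ℤ) {g : ℤ → ℝ} :
    ∑ k ∈ F, g k ≤ wtC * √(∑ k ∈ F, (wt k * g k) ^ 2) := by
  have h1 := Real.sum_mul_le_sqrt_mul_sqrt F (fun k => (wt k)⁻¹) fun k => wt k * g k
  have h2 : ∀ k, (wt k)⁻¹ * (wt k * g k) = g k := fun k =>
    inv_mul_cancel_left₀ (wt_pos k).ne' _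
  simp only [h2] at h1
  refine h1.trans (mul_le_mul_of_nonneg_right (Real.sqrt_le_sqrt ?_) (Real.sqrt_nonneg _))
  simp only [inv_pow]
  exact summable_wt_inv.sum_le_tsum F fun k _ => by have := wt_pos k; positivity

/-- Terms without `τ` involve only the norm bounded by `A` and are linear in `X`. All other terms
carry `τ` and two half derivatives, hence the factor `τ √X Y`, the form that a shrinking radius can
absorb. -/
theorem abs_gevrey_rate_le {α τ : ℝ} (hα : α ∈ Icc (1 : ℝ) 2) (hτ : 0 ≤ τ) (κ₁ κ₂ γ : ℝ)
    {F : Finset ℤ} {y : ℤ → ℂ} (hy : ∀ l ∉ F, y l = 0)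
    (hreal : ∀ k, y (-k) = (starRingEnd ℂ) (y k)) {A X Y : ℝ}
    (hA : ∑ k ∈ F, wt k ^ (α + 1) * ‖y k‖ ≤ A)
    (hX : X = ∑ k ∈ F, gev τ |(k : ℝ)| ^ 2 * ‖y k‖ ^ 2)
    (hY : Y = ∑ k ∈ F, |(k : ℝ)| * (gev τ |(k : ℝ)| ^ 2 * ‖y k‖ ^ 2)) :
    |(∑ k ∈ F, (starRingEnd ℂ) (y k) * ((gev τ |(k : ℝ)| ^ 2 : ℝ) *
      ((κ₁ * k * qm α k : ℝ) * y k + bil α κ₂ γ y y k))).im| ≤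
      200 * symC κ₂ γ * (A * X + τ * wtC * √X * Y) := by
  have hS := symC_nonneg κ₂ γ
  have hgev : ∀ n : ℤ, 0 < gev τ |(n : ℝ)| := fun n => gev_pos τ (abs_nonneg _)
  set z : ℤ → ℝ := fun n => gev τ |(n : ℝ)| * ‖y n‖ with hz
  set u : ℤ → ℝ := fun n => wt n ^ (α + 1) * ‖y n‖ with hu
  set g : ℤ → ℝ := fun n => wt n ^ 3 * √|(n : ℝ)| * Real.exp (τ * |(n : ℝ)|) * ‖y n‖ with hg
  set h : ℤ → ℝ := fun n => √|(n : ℝ)| * z n with hh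
  set v : ℤ → ℝ := fun n => |(n : ℝ)| * Real.exp (τ * |(n : ℝ)|) * ‖y n‖ with hv
  have hz0 : ∀ n, 0 ≤ z n := fun n => mul_nonneg (hgev n).le (norm_nonneg _)
  have hu0 : ∀ n, 0 ≤ u n := fun n =>
    mul_nonneg (Real.rpow_nonneg (wt_pos n).le _) (norm_nonneg _)
  have hg0 : ∀ n, 0 ≤ g n := fun n => by have := pow_nonneg (wt_pos n).le 3; positivity
  have hh0 : ∀ n, 0 ≤ h n := fun n => mul_nonneg (Real.sqrt_nonneg _) (hz0 n)
  have hv0 : ∀ n, 0 ≤ v n := fun n => by positivity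
  have sz : ∀ n ∉ F, z n = 0 := fun n hn => by simp [hz, hy n hn]
  have su : ∀ n ∉ F, u n = 0 := fun n hn => by simp [hu, hy n hn]
  have sg : ∀ n ∉ F, g n = 0 := fun n hn => by simp [hg, hy n hn]
  have sh : ∀ n ∉ F, h n = 0 := fun n hn => by simp [hh, sz n hn]
  have sv : ∀ n ∉ F, v n = 0 := fun n hn => by simp [hv, hy n hn]
  have hX' : ∑ k ∈ F, z k ^ 2 = X := by rw [hX]; simp only [hz, mul_pow]
  have hY' : ∑ k ∈ F, h k ^ 2 = Y := by
    rw [hY]; simp only [hh, hz, mul_pow, Real.sq_sqrt (abs_nonneg _)]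
  have hX0 : 0 ≤ X := by rw [← hX']; exact Finset.sum_nonneg fun _ _ => sq_nonneg _
  have hY0 : 0 ≤ Y := by rw [← hY']; exact Finset.sum_nonneg fun _ _ => sq_nonneg _
  have hgev_eq : ∀ n : ℤ, gev τ |(n : ℝ)| = wt n ^ 4 * Real.exp (τ * |(n : ℝ)|) := fun n => rfl
  -- This fixes the exponent four in `gev`: three powers cover `α + 1 ≤ 3`, and one passes from `ℓ²`
  -- to `ℓ¹`.
  have hgsum : ∑ k ∈ F, g k ≤ wtC * √Y := by
    refine (sum_le_wtC F).trans (le_of_eq ?_)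
    rw [← hY']
    congr 2
    refine Finset.sum_congr rfl fun k _ => ?_
    simp only [hg, hh, hz, hgev_eq]; ring
  have hvsum : ∑ k ∈ F, v k ≤ wtC * √X := by
    refine (sum_le_wtC F).trans ?_
    rw [← hX']
    refine mul_le_mul_of_nonneg_left (Real.sqrt_le_sqrt (Finset.sum_le_sum fun k _ => ?_))
      (Real.sqrt_nonneg _)
    have hw := wt_pos k
    refine pow_le_pow_left₀ (mul_nonneg hw.le (hv0 k)) ?_ 2
    simp only [hv, hz, hgev_eq]
    have h1 := abs_le_wt k
    have h2 := one_le_wt k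
    have h3 : wt k * |(k : ℝ)| ≤ wt k ^ 4 := by
      calc wt k * |(k : ℝ)| ≤ wt k * wt k := by gcongr
        _ = wt k ^ 2 := by ring
        _ ≤ wt k ^ 4 := pow_le_pow_right₀ h2 (by norm_num)
    calc wt k * (|(k : ℝ)| * Real.exp (τ * |(k : ℝ)|) * ‖y k‖)
        = (wt k * |(k : ℝ)|) * (Real.exp (τ * |(k : ℝ)|) * ‖y k‖) := by ring
      _ ≤ wt k ^ 4 * (Real.exp (τ * |(k : ℝ)|) * ‖y k‖) := by gcongr
      _ = _ := by ring
  have hXX : √X * √X = X := Real.mul_self_sqrt hX0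
  have hYY : √Y * √Y = Y := Real.mul_self_sqrt hY0
  have hsX := Real.sqrt_nonneg X
  have hsY := Real.sqrt_nonneg Y
  have T1 : ∑ k ∈ F, ∑ l ∈ F, z k * (u (k - l) * z l) ≤ A * X := by
    refine (sum_sum_trilinear_le' z hz0 hu0 hz0 su sz).trans ?_
    rw [hX', mul_right_comm, hXX, mul_comm]; gcongr
  have T2 : ∑ k ∈ F, ∑ l ∈ F, z k * (u l * z (k - l)) ≤ A * X := by
    refine (sum_sum_trilinear_le z hz0 hu0 hz0 su sz).trans ?_
    rw [hX', mul_right_comm, hXX, mul_comm]; gcongr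
  have T3 : ∑ k ∈ F, ∑ l ∈ F, z k * (g (k - l) * h l) ≤ wtC * √X * Y := by
    refine (sum_sum_trilinear_le' z hz0 hg0 hh0 sg sh).trans ?_
    rw [hX', hY']
    calc √X * (∑ k ∈ F, g k) * √Y ≤ √X * (wtC * √Y) * √Y := by gcongr
      _ = wtC * √X * (√Y * √Y) := by ring
      _ = _ := by rw [hYY]
  have T4 : ∑ k ∈ F, ∑ l ∈ F, z k * (g l * h (k - l)) ≤ wtC * √X * Y := by
    refine (sum_sum_trilinear_le z hz0 hg0 hh0 sg sh).trans ?_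
    rw [hX', hY']
    calc √X * (∑ k ∈ F, g k) * √Y ≤ √X * (wtC * √Y) * √Y := by gcongr
      _ = wtC * √X * (√Y * √Y) := by ring
      _ = _ := by rw [hYY]
  have T5 : ∑ k ∈ F, ∑ l ∈ F, h k * (v (k - l) * h l) ≤ wtC * √X * Y := by
    refine (sum_sum_trilinear_le' h hh0 hv0 hh0 sv sh).trans ?_
    rw [hY', mul_right_comm, hYY, mul_comm]; gcongr
  -- The region defining `m₁` is symmetric in `k` and `l`, so it survives antisymmetrization and the
  -- commutator bound applies on it.
  set m₁ : ℤ → ℤ → ℝ := fun k l =>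
    if 2 * |((k - l : ℤ) : ℝ)| ≤ |(k : ℝ)| + |(l : ℝ)| then
      3 * κ₂ * (l * gev τ |(k : ℝ)| ^ 2) else 0 with hm₁
  set m₂ : ℤ → ℤ → ℝ := fun k l => gev τ |(k : ℝ)| ^ 2 * rem α κ₂ γ k l with hm₂
  have hm : ∀ k l : ℤ, gev τ |(k : ℝ)| ^ 2 * sig α κ₂ γ k l = m₁ k l + m₂ k l := by
    intro k l
    simp only [hm₁, hm₂, rem]
    split_ifs <;> ring
  have hsplit : ∑ k ∈ F, (starRingEnd ℂ) (y k) * ((gev τ |(k : ℝ)| ^ 2 : ℝ) *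
      ((κ₁ * k * qm α k : ℝ) * y k + bil α κ₂ γ y y k)) =
      ∑ k ∈ F, ((gev τ |(k : ℝ)| ^ 2 * (κ₁ * k * qm α k) * ‖y k‖ ^ 2 : ℝ) : ℂ) +
        (tri F y m₁ + tri F y m₂) := by
    rw [← tri_add, tri, ← Finset.sum_add_distrib]
    refine Finset.sum_congr rfl fun k _ => ?_
    have h2 : ((‖y k‖ ^ 2 : ℝ) : ℂ) = (starRingEnd ℂ) (y k) * y k := by
      rw [mul_comm, Complex.mul_conj, Complex.normSq_eq_norm_sq]
    have h3 : ((gev τ |(k : ℝ)| ^ 2 : ℝ) : ℂ) * bil α κ₂ γ y y k =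
        ∑ l ∈ F, ((m₁ k l + m₂ k l : ℝ) : ℂ) * (y (k - l) * y l) := by
      rw [bil_eq_sum _ _ _ _ hy, Finset.mul_sum]
      refine Finset.sum_congr rfl fun l _ => ?_
      rw [← hm]; push_cast; ring
    rw [← h3, Complex.ofReal_mul _ (‖y k‖ ^ 2), h2, Complex.ofReal_mul (gev τ |(k : ℝ)| ^ 2)]
    ring
  have hI1 : |(tri F y m₁).im| ≤ 2250 * |κ₂| * (A * X + τ * (wtC * √X * Y)) := by
    have h1 := abs_im_antisymm_le F m₁ hreal y
    have h2 : ∀ k l : ℤ, |m₁ k l - m₁ l k| * (‖y (k - l)‖ * ‖y l‖ * ‖y k‖) ≤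
        4500 * |κ₂| * (z k * (u (k - l) * z l) + τ * (h k * (v (k - l) * h l))) := by
      intro k l
      have hnn : 0 ≤ z k * (u (k - l) * z l) + τ * (h k * (v (k - l) * h l)) :=
        add_nonneg (mul_nonneg (hz0 _) (mul_nonneg (hu0 _) (hz0 _)))
          (mul_nonneg hτ (mul_nonneg (hh0 _) (mul_nonneg (hv0 _) (hh0 _))))
      by_cases hD : 2 * |((k - l : ℤ) : ℝ)| ≤ |(k : ℝ)| + |(l : ℝ)|
      · have hD' : 2 * |((l - k : ℤ) : ℝ)| ≤ |(l : ℝ)| + |(k : ℝ)| := by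
          rw [← neg_sub k l, Int.cast_neg, abs_neg, add_comm]; exact hD
        have e1 : |m₁ k l - m₁ l k| =
            3 * |κ₂| * |(l : ℝ) * gev τ |(k : ℝ)| ^ 2 - k * gev τ |(l : ℝ)| ^ 2| := by
          simp only [hm₁, if_pos hD, if_pos hD']
          rw [← mul_sub, abs_mul, abs_mul, abs_of_pos (by norm_num : (0 : ℝ) < 3)]
        have h3 := abs_gev_transport_int_le hτ hD
        have h4 := (abs_le_wt (k - l)).trans
          (wt_le_wt_rpow (by linarith [hα.1] : 0 ≤ α) (k - l))
        have hk := (hgev k).le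
        have hl := (hgev l).le
        rw [e1]
        calc 3 * |κ₂| * |(l : ℝ) * gev τ |(k : ℝ)| ^ 2 - k * gev τ |(l : ℝ)| ^ 2| *
              (‖y (k - l)‖ * ‖y l‖ * ‖y k‖)
            ≤ 3 * |κ₂| * (1500 * ((|((k - l : ℤ) : ℝ)| + τ * (√|(k : ℝ)| * √|(l : ℝ)|) *
              (|((k - l : ℤ) : ℝ)| * Real.exp (τ * |((k - l : ℤ) : ℝ)|))) *
              (gev τ |(k : ℝ)| * gev τ |(l : ℝ)|))) * (‖y (k - l)‖ * ‖y l‖ * ‖y k‖) := by gcongr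
          _ ≤ 3 * |κ₂| * (1500 * ((wt (k - l) ^ (α + 1) + τ * (√|(k : ℝ)| * √|(l : ℝ)|) *
              (|((k - l : ℤ) : ℝ)| * Real.exp (τ * |((k - l : ℤ) : ℝ)|))) *
              (gev τ |(k : ℝ)| * gev τ |(l : ℝ)|))) * (‖y (k - l)‖ * ‖y l‖ * ‖y k‖) := by gcongr
          _ = _ := by simp only [hz, hu, hh, hv]; ring
      · have hD' : ¬ 2 * |((l - k : ℤ) : ℝ)| ≤ |(l : ℝ)| + |(k : ℝ)| := by
          rw [← neg_sub k l, Int.cast_neg, abs_neg, add_comm]; exact hD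
        have e1 : m₁ k l - m₁ l k = 0 := by simp only [hm₁, if_neg hD, if_neg hD', sub_zero]
        rw [e1, abs_zero, zero_mul]
        positivity
    have h5 : ∑ k ∈ F, ∑ l ∈ F, |m₁ k l - m₁ l k| * (‖y (k - l)‖ * ‖y l‖ * ‖y k‖) ≤
        4500 * |κ₂| * (A * X + τ * (wtC * √X * Y)) := by
      refine (Finset.sum_le_sum fun k _ => Finset.sum_le_sum fun l _ => h2 k l).trans ?_
      simp only [← Finset.mul_sum, Finset.sum_add_distrib] at T1 T5 ⊢
      gcongr
    change 2 * |(tri F y m₁).im| ≤ _ at h1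
    linarith
  have hI2 : |(tri F y m₂).im| ≤
      32 * symC κ₂ γ * (A * X + A * X + τ * (wtC * √X * Y + wtC * √X * Y)) := by
    have h1 : ‖tri F y m₂‖ ≤
        ∑ k ∈ F, ∑ l ∈ F, |m₂ k l| * (‖y (k - l)‖ * ‖y l‖ * ‖y k‖) := by
      refine (norm_sum_le _ _).trans (Finset.sum_le_sum fun k _ => ?_)
      rw [Finset.mul_sum]
      refine (norm_sum_le _ _).trans (Finset.sum_le_sum fun l _ => le_of_eq ?_)
      simp only [norm_mul, RCLike.norm_conj, Complex.norm_real, Real.norm_eq_abs]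
      ring
    refine (Complex.abs_im_le_norm _).trans (h1.trans ?_)
    refine (Finset.sum_le_sum fun k _ => Finset.sum_le_sum fun l _ =>
      rem_term_le hα hτ κ₂ γ y (fun _ => rfl) (fun _ => rfl) (fun _ => rfl) (fun _ => rfl)
        k l).trans ?_
    simp only [← Finset.mul_sum, Finset.sum_add_distrib] at T1 T2 T3 T4 ⊢
    gcongr
  rw [hsplit, Complex.add_im, ← Complex.ofReal_sum, Complex.ofReal_im, zero_add, Complex.add_im]
  have hA0 : 0 ≤ A := (Finset.sum_nonneg fun k _ => hu0 k).trans hA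
  have hZ : 0 ≤ A * X + τ * (wtC * √X * Y) := by
    have : 0 ≤ wtC := Real.sqrt_nonneg _
    positivity
  have hκ : 40 * |κ₂| ≤ symC κ₂ γ := by rw [symC]; linarith [abs_nonneg γ]
  have h7 := mul_le_mul_of_nonneg_right hκ hZ
  have h8 := mul_nonneg hS hZ
  refine (abs_add_le _ _).trans ?_
  linarith

/-- With radius `τ' = -L τ`, differentiating the weight produces `-2 L τ Y`, which cancels the
half-derivative loss while `X` stays below the barrier. -/
theorem ModeSol.gevrey_bound {α : ℝ} (hα : α ∈ Icc (1 : ℝ) 2) (κ₁ κ₂ γ T : ℝ) {A B τ₀ : ℝ}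
    (hA0 : 0 ≤ A) (hB0 : 0 ≤ B) (hτ₀ : 0 < τ₀) : ∃ C > 0, ∃ c > 0, ∀ (N : ℕ) (y : ℝ → ℤ → ℂ)
    (_ : ModeSol α κ₁ κ₂ γ T (freq N) y) (_ : ∀ t ∈ Icc 0 T, ∀ l ∉ freq N, y t l = 0)
    (_ : ∀ t ∈ Icc 0 T, ∀ k, y t (-k) = (starRingEnd ℂ) (y t k))
    (_ : ∀ t ∈ Icc 0 T, ∑ k ∈ freq N, wt k ^ (α + 1) * ‖y t k‖ ≤ A)
    (_ : ∑ k ∈ freq N, gev τ₀ |(k : ℝ)| ^ 2 * ‖y 0 k‖ ^ 2 ≤ B),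
    ∀ t ∈ Icc 0 T, ∀ k, ‖y t k‖ ≤ C * Real.exp (-c * |(k : ℝ)|) := by
  have hS := symC_nonneg κ₂ γ
  have hc0 : 0 ≤ wtC := Real.sqrt_nonneg _
  set S := symC κ₂ γ with hSdef
  set Λ := 400 * S * A + 1 with hΛ
  have hΛ0 : 0 < Λ := by positivity
  set Bm := (B + 1) * Real.exp (Λ * T) with hBm
  have hBm0 : 0 < Bm := by positivity
  -- `Bm` is the final height of the barrier, so `√X ≤ √Bm` whenever `X` touches it. This `L` then
  -- makes the two `Y` terms cancel.
  set L := 200 * S * wtC * √Bm with hL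
  have hL0 : 0 ≤ L := by positivity
  refine ⟨√Bm, by positivity, τ₀ * Real.exp (-(L * T)), by positivity, ?_⟩
  intro N y hy hsupp hreal hA hB t ht k
  set τ : ℝ → ℝ := fun t => τ₀ * Real.exp (-(L * t)) with hτ
  have hτpos : ∀ t, 0 < τ t := fun t => by positivity
  have hτd : ∀ t, HasDerivAt τ (-L * τ t) t := by
    intro t
    have h1 := ((((hasDerivAt_id t).const_mul L).neg).exp).const_mul τ₀
    refine h1.congr_deriv ?_
    simp only [hτ, id, Pi.neg_apply]; ring
  have hτc : Continuous τ := by unfold τ; fun_prop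
  set X : ℝ → ℝ := fun t => ∑ k ∈ freq N, gev (τ t) |(k : ℝ)| ^ 2 * ‖y t k‖ ^ 2 with hX
  set Y : ℝ → ℝ := fun t => ∑ k ∈ freq N, |(k : ℝ)| * (gev (τ t) |(k : ℝ)| ^ 2 * ‖y t k‖ ^ 2)
    with hY
  set Q : ℝ → ℝ := fun t => (∑ k ∈ freq N, (starRingEnd ℂ) (y t k) *
    ((gev (τ t) |(k : ℝ)| ^ 2 : ℝ) * ((κ₁ * k * qm α k : ℝ) * y t k +
      bil α κ₂ γ (y t) (y t) k))).im with hQ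
  have hgd : ∀ (k : ℤ) t, HasDerivAt (fun t => gev (τ t) |(k : ℝ)| ^ 2)
      (-(2 * L * τ t * |(k : ℝ)|) * gev (τ t) |(k : ℝ)| ^ 2) t := by
    intro k t
    have h1 := (((hτd t).mul_const |(k : ℝ)|).exp.const_mul ((1 + |(k : ℝ)|) ^ 4)).pow 2
    refine h1.congr_deriv ?_
    simp only [gev]
    ring
  have hXc : ContinuousOn X (Icc 0 T) := by
    refine continuousOn_finsetSum _ fun k _ => ContinuousOn.mul ?_ ((hy.cont k).norm.pow 2)
    exact fun t _ => (hgd k t).continuousAt.continuousWithinAt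
  have hXd : ∀ s ∈ Ioc 0 T, HasDerivWithinAt X (-(2 * L * τ s) * Y s + 2 * Q s) (Icc 0 T) s := by
    intro s hs
    have h1 : -(2 * L * τ s) * Y s + 2 * Q s = ∑ k ∈ freq N,
        (-(2 * L * τ s * |(k : ℝ)|) * gev (τ s) |(k : ℝ)| ^ 2 * ‖y s k‖ ^ 2 +
        gev (τ s) |(k : ℝ)| ^ 2 * (2 * inner ℝ (y s k) (-Complex.I *
          ((κ₁ * k * qm α k : ℝ) * y s k + bil α κ₂ γ (y s) (y s) k)))) := by
      simp only [hQ, hY]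
      rw [Complex.im_sum, Finset.mul_sum, Finset.mul_sum, ← Finset.sum_add_distrib]
      refine Finset.sum_congr rfl fun k _ => ?_
      generalize (κ₁ * k * qm α k : ℝ) * y s k + bil α κ₂ γ (y s) (y s) k = w
      rw [Complex.inner]
      generalize gev (τ s) |(k : ℝ)| ^ 2 = c
      simp [Complex.mul_re, Complex.mul_im, -Complex.ofReal_pow]
      ring
    rw [h1]
    exact HasDerivWithinAt.fun_sum fun k hk =>
      (hgd k s).hasDerivWithinAt.mul (hy.deriv k hk s hs).norm_sq
  have hY0 : ∀ s, 0 ≤ Y s := fun s => Finset.sum_nonneg fun _ _ => by positivity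
  have hT : 0 ≤ T := ht.1.trans ht.2
  have hX0 : X 0 < B + 1 := by
    have : τ 0 = τ₀ := by simp [hτ]
    simp only [hX, this]
    linarith
  have hXt : X t ≤ Bm := by
    refine (le_barrier (Λ := Λ) hXc hXd hX0 (fun s hs hXs => ?_) t ht).trans ?_
    · have hsI : s ∈ Icc 0 T := Ioc_subset_Icc_self hs
      have h1 := abs_gevrey_rate_le hα (hτpos s).le κ₁ κ₂ γ (hsupp s hsI) (hreal s hsI)
        (hA s hsI) (X := X s) rfl (Y := Y s) rfl
      have h2 : Q s ≤ _ := (le_abs_self _).trans h1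
      have hXB : √(X s) ≤ √Bm := by
        refine Real.sqrt_le_sqrt ?_
        rw [hXs, hBm]
        have : Λ * s ≤ Λ * T := mul_le_mul_of_nonneg_left hs.2 hΛ0.le
        gcongr
      have hXpos : 0 < X s := by rw [hXs]; positivity
      rw [← hXs]
      have h3 : τ s * wtC * √(X s) * Y s ≤ τ s * wtC * √Bm * Y s := by
        have := hτpos s
        have := hY0 s
        gcongr
      have h4 := mul_le_mul_of_nonneg_left h3 (by positivity : 0 ≤ 400 * S)
      have h5 : 2 * L * τ s * Y s = 400 * S * (τ s * wtC * √Bm * Y s) := by rw [hL]; ring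
      rw [hΛ]
      linarith
    · rw [hBm]
      have : Λ * t ≤ Λ * T := mul_le_mul_of_nonneg_left ht.2 hΛ0.le
      gcongr
  by_cases hk : k ∈ freq N
  · have h1 : gev (τ t) |(k : ℝ)| ^ 2 * ‖y t k‖ ^ 2 ≤ Bm :=
      (Finset.single_le_sum (f := fun k : ℤ => gev (τ t) |(k : ℝ)| ^ 2 * ‖y t k‖ ^ 2)
        (fun _ _ => by positivity) hk).trans hXt
    have h2 : gev (τ t) |(k : ℝ)| * ‖y t k‖ ≤ √Bm := by
      refine Real.le_sqrt_of_sq_le ?_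
      rw [mul_pow]; exact h1
    have h3 : Real.exp (τ₀ * Real.exp (-(L * T)) * |(k : ℝ)|) ≤ gev (τ t) |(k : ℝ)| := by
      have h4 : τ₀ * Real.exp (-(L * T)) ≤ τ t := by
        simp only [hτ]
        have : -(L * T) ≤ -(L * t) := neg_le_neg (mul_le_mul_of_nonneg_left ht.2 hL0)
        gcongr
      have h5 : 1 ≤ (1 + |(k : ℝ)|) ^ 4 := one_le_pow₀ (by linarith [abs_nonneg (k : ℝ)])
      refine le_trans ?_ (le_mul_of_one_le_left (Real.exp_pos _).le h5)
      gcongr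
    rw [neg_mul, Real.exp_neg, ← div_eq_mul_inv, le_div_iff₀ (Real.exp_pos _), mul_comm]
    exact (mul_le_mul_of_nonneg_right h3 (norm_nonneg _)).trans h2
  · rw [hsupp t ht k hk, norm_zero]; positivity

/-! ### Fourier coefficients of real-analytic periodic functions -/

/-- Cauchy estimates by re-expansion: at every centre near `x₀`, the Taylor coefficients are
dominated by one convergent multiple sum `K`, so the `n`-th one is at most `K ρ⁻ⁿ`. -/
theorem exists_iteratedDeriv_bound_nhds {f : ℝ → ℂ} {x₀ : ℝ} (hf : AnalyticAt ℝ f x₀) :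
    ∃ s ∈ 𝓝 x₀, ∃ C > 0, ∃ R > 0, ∀ n : ℕ, ∀ x ∈ s,
      ‖iteratedDeriv n f x‖ ≤ C * n.factorial * R ^ n := by
  obtain ⟨p, r, hp⟩ := hf
  obtain ⟨ρ', hρ'0, hρ'r⟩ := ENNReal.lt_iff_exists_nnreal_btwn.1 hp.r_pos
  have hρ'pos : 0 < ρ' := by exact_mod_cast hρ'0
  set ρ := ρ' / 2 with hρ
  have hρ0 : 0 < ρ := by positivity
  have hρr : ((ρ + ρ : NNReal) : ENNReal) < p.radius := by
    rw [hρ, add_halves]; exact hρ'r.trans_le hp.r_le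
  have hsum := p.changeOriginSeries_summable_aux₁ (r := ρ) (r' := ρ) (by exact_mod_cast hρr)
  set K := ∑' s : Σ k l : ℕ, { s : Finset (Fin (k + l)) // s.card = l },
    ‖p (s.1 + s.2.1)‖₊ * ρ ^ s.2.1 * ρ ^ s.1 with hK
  have hsig := (NNReal.summable_sigma.1 hsum)
  have hbound : ∀ y : ℝ, ‖y‖₊ ≤ ρ → ∀ n, ‖p.changeOrigin y n‖₊ * ρ ^ n ≤ K := by
    intro y hy n
    have hyr : (‖y‖₊ : ENNReal) < p.radius :=
      lt_of_le_of_lt (by exact_mod_cast hy.trans (le_add_of_nonneg_left hρ0.le)) hρr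
    have h1 := p.nnnorm_changeOrigin_le n hyr
    have hsρ := p.changeOriginSeries_summable_aux₂ (r := ρ)
      (lt_of_le_of_lt (by exact_mod_cast le_add_of_nonneg_left hρ0.le) hρr) n
    have h2 : (∑' s : Σ l : ℕ, { s : Finset (Fin (n + l)) // s.card = l },
        ‖p (n + s.1)‖₊ * ‖y‖₊ ^ s.1) ≤
        ∑' s : Σ l : ℕ, { s : Finset (Fin (n + l)) // s.card = l }, ‖p (n + s.1)‖₊ * ρ ^ s.1 :=
      (p.changeOriginSeries_summable_aux₂ hyr n).tsum_le_tsum (fun s => by gcongr) hsρ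
    calc ‖p.changeOrigin y n‖₊ * ρ ^ n ≤
          (∑' s : Σ l : ℕ, { s : Finset (Fin (n + l)) // s.card = l },
            ‖p (n + s.1)‖₊ * ρ ^ s.1) * ρ ^ n := by gcongr; exact h1.trans h2
      _ = ∑' s : Σ l : ℕ, { s : Finset (Fin (n + l)) // s.card = l },
            ‖p (n + s.1)‖₊ * ρ ^ s.1 * ρ ^ n := (NNReal.tsum_mul_right _ _).symm
      _ ≤ ∑' k, ∑' s : Σ l : ℕ, { s : Finset (Fin (k + l)) // s.card = l },
            ‖p (k + s.1)‖₊ * ρ ^ s.1 * ρ ^ k := hsig.2.le_tsum n fun _ _ => zero_le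
      _ = K := (hsum.tsum_sigma' hsig.1).symm
  refine ⟨Metric.ball x₀ ρ, Metric.ball_mem_nhds _ (by exact_mod_cast hρ0), K + 1, by positivity,
    (ρ : ℝ)⁻¹, by positivity, fun n x hx => ?_⟩
  have hy : ‖x - x₀‖₊ ≤ ρ := by
    rw [← NNReal.coe_le_coe, coe_nnnorm, ← dist_eq_norm]; exact hx.le
  have hyr : (‖x - x₀‖₊ : ENNReal) < r := by
    refine lt_of_le_of_lt ?_ hρ'r
    exact_mod_cast hy.trans (half_le_self ρ'.2)
  have h1 := (hp.changeOrigin hyr).factorial_smul 1 n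
  rw [add_sub_cancel] at h1
  rw [iteratedDeriv_eq_iteratedFDeriv, ← h1, nsmul_eq_mul, norm_mul, RCLike.norm_natCast]
  have h2 : ‖(p.changeOrigin (x - x₀) n) fun _ => (1 : ℝ)‖ ≤ ‖p.changeOrigin (x - x₀) n‖ := by
    exact ((p.changeOrigin (x - x₀) n).le_opNorm _).trans (by simp)
  have h3 : ‖p.changeOrigin (x - x₀) n‖ * (ρ : ℝ) ^ n ≤ K := by
    exact_mod_cast hbound _ hy n
  have hρ0' : (0 : ℝ) < ρ := by exact_mod_cast hρ0
  have h4 : ‖p.changeOrigin (x - x₀) n‖ ≤ K * (ρ : ℝ)⁻¹ ^ n := by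
    rw [inv_pow, ← div_eq_mul_inv, le_div_iff₀ (by positivity)]; exact h3
  calc (n.factorial : ℝ) * ‖(p.changeOrigin (x - x₀) n) fun _ => (1 : ℝ)‖
      ≤ n.factorial * ((K + 1) * (ρ : ℝ)⁻¹ ^ n) := by
        gcongr
        refine (h2.trans h4).trans ?_
        gcongr; linarith
    _ = _ := by ring

theorem exists_iteratedDeriv_bound {f : ℝ → ℂ} (hf : AnalyticOnNhd ℝ f univ) {s : Set ℝ}
    (hs : IsCompact s) : ∃ C > 0, ∃ R > 0, ∀ n : ℕ, ∀ x ∈ s,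
      ‖iteratedDeriv n f x‖ ≤ C * n.factorial * R ^ n := by
  refine hs.induction_on (p := fun s => ∃ C > 0, ∃ R > 0, ∀ n : ℕ, ∀ x ∈ s,
      ‖iteratedDeriv n f x‖ ≤ C * n.factorial * R ^ n)
    ⟨1, one_pos, 1, one_pos, fun _ _ h => h.elim⟩ ?_ ?_ ?_
  · rintro s t hst ⟨C, hC, R, hR, h⟩
    exact ⟨C, hC, R, hR, fun n x hx => h n x (hst hx)⟩
  · rintro s t ⟨C, hC, R, hR, h⟩ ⟨C', hC', R', hR', h'⟩
    refine ⟨max C C', lt_max_of_lt_left hC, max R R', lt_max_of_lt_left hR, fun n x hx => ?_⟩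
    rcases hx with hx | hx
    · refine (h n x hx).trans ?_
      gcongr <;> exact le_max_left _ _
    · refine (h' n x hx).trans ?_
      gcongr <;> exact le_max_right _ _
  · intro x _
    obtain ⟨t, ht, h⟩ := exists_iteratedDeriv_bound_nhds (hf x (mem_univ x))
    exact ⟨t, mem_nhdsWithin_of_mem_nhds ht, h⟩

theorem periodic_deriv {f : ℝ → ℂ} {c : ℝ} (hf : Function.Periodic f c) :
    Function.Periodic (deriv f) c := by
  intro x
  rw [← deriv_comp_add_const]
  congr 1
  exact funext hf

theorem fc_deriv {f : ℝ → ℂ} (hf : ContDiff ℝ 1 f) (hper : Function.Periodic f (2 * Real.pi))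
    (k : ℤ) : fc (deriv f) k = Complex.I * k * fc f k := by
  have he : ∀ x, HasDerivAt (e (-k)) (-(Complex.I * k) * e (-k) x) x := by
    intro x
    have h1 : HasDerivAt (fun x : ℝ => Complex.I * ((-k : ℤ) : ℂ) * (x : ℂ))
        (Complex.I * ((-k : ℤ) : ℂ) * 1) x :=
      (Complex.ofRealCLM.hasDerivAt (x := x)).const_mul (Complex.I * ((-k : ℤ) : ℂ))
    refine h1.cexp.congr_deriv ?_
    rw [e]; push_cast; ring
  have hfd : ∀ x, HasDerivAt f (deriv f x) x := fun x =>
    (hf.differentiable (by norm_num) x).hasDerivAt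
  have hfc : Continuous (deriv f) := hf.continuous_deriv le_rfl
  have hc1 : Continuous fun x => deriv f x * e (-k) x := hfc.mul (continuous_e _)
  have hc2 : Continuous fun x => f x * (-(Complex.I * k) * e (-k) x) :=
    hf.continuous.mul (continuous_const.mul (continuous_e _))
  have h2 := intervalIntegral.integral_eq_sub_of_hasDerivAt (a := -Real.pi) (b := Real.pi)
    (fun x _ => (hfd x).mul (he x)) ((hc1.add hc2).intervalIntegrable _ _)
  have h3 : f Real.pi * e (-k) Real.pi = f (-Real.pi) * e (-k) (-Real.pi) := by
    have e1 : Real.pi = -Real.pi + 2 * Real.pi := by ring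
    rw [← hper (-Real.pi), ← e_periodic (-k) (-Real.pi), ← e1]
  simp only [Pi.mul_apply] at h2
  rw [h3, sub_self,
    intervalIntegral.integral_add (hc1.intervalIntegrable _ _) (hc2.intervalIntegrable _ _)] at h2
  have h4 : ∫ x in (-Real.pi)..Real.pi, f x * (-(Complex.I * k) * e (-k) x) =
      -(Complex.I * k) * ∫ x in (-Real.pi)..Real.pi, f x * e (-k) x := by
    rw [← intervalIntegral.integral_const_mul]
    congr 1; ext x; ring
  rw [h4] at h2
  rw [fc_eq, fc_eq]
  linear_combination (1 / (2 * (Real.pi : ℂ))) * h2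

theorem fc_iteratedDeriv {f : ℝ → ℂ} (hf : ContDiff ℝ (⊤ : ℕ∞) f)
    (hper : Function.Periodic f (2 * Real.pi)) (k : ℤ) (n : ℕ) :
    Function.Periodic (iteratedDeriv n f) (2 * Real.pi) ∧
      fc (iteratedDeriv n f) k = (Complex.I * k) ^ n * fc f k := by
  induction n with
  | zero => simpa using hper
  | succ n ih =>
    have hc : ContDiff ℝ 1 (iteratedDeriv n f) := by
      rw [iteratedDeriv_eq_iterate]
      exact ContDiff.iterate_deriv' 1 n (hf.of_le (by exact_mod_cast le_top))
    rw [iteratedDeriv_succ]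
    refine ⟨periodic_deriv ih.1, ?_⟩
    rw [fc_deriv hc ih.1, ih.2]
    ring

/-- Integrating by parts `n` times gives `|k|ⁿ ‖fc f k‖ ≤ C n! Rⁿ` for every `n`. Summing these
bounds against `(2R)⁻ⁿ / n!` rebuilds an exponential on the left and a geometric series on the
right. -/
theorem exists_fc_bound_of_analytic {f : ℝ → ℂ} (hf : AnalyticOnNhd ℝ f univ)
    (hper : Function.Periodic f (2 * Real.pi)) :
    ∃ C > 0, ∃ c > 0, ∀ k, ‖fc f k‖ ≤ C * Real.exp (-c * |(k : ℝ)|) := by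
  obtain ⟨C, hC, R, hR, hb⟩ := exists_iteratedDeriv_bound hf
    (isCompact_Icc (a := -Real.pi) (b := Real.pi))
  have hsm : ContDiff ℝ (⊤ : ℕ∞) f := by
    rw [contDiff_iff_contDiffAt]
    exact fun x => (hf x (mem_univ x)).contDiffAt
  refine ⟨2 * C, by positivity, (2 * R)⁻¹, by positivity, fun k => ?_⟩
  have h1 : ∀ n : ℕ, |(k : ℝ)| ^ n * ‖fc f k‖ ≤ C * n.factorial * R ^ n := by
    intro n
    have h2 := norm_fc_le (iteratedDeriv n f) k
    rw [(fc_iteratedDeriv hsm hper k n).2] at h2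
    have h3 : ‖(Complex.I * k) ^ n * fc f k‖ = |(k : ℝ)| ^ n * ‖fc f k‖ := by
      rw [norm_mul, norm_pow, norm_mul, Complex.norm_I, one_mul, Complex.norm_intCast]
    rw [h3] at h2
    refine h2.trans ?_
    have h4 : ∫ x in (-Real.pi)..Real.pi, ‖iteratedDeriv n f x‖ ≤
        ∫ _ in (-Real.pi)..Real.pi, C * n.factorial * R ^ n := by
      refine intervalIntegral.integral_mono_on neg_pi_lt_pi.le ?_ (by simp) fun x hx => hb n x hx
      exact ((hsm.continuous_iteratedDeriv n (by exact_mod_cast le_top)).norm).intervalIntegrable _ _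
    rw [intervalIntegral.integral_const, smul_eq_mul] at h4
    calc _ ≤ 1 / (2 * Real.pi) * ((Real.pi - -Real.pi) * (C * n.factorial * R ^ n)) := by gcongr
      _ = _ := by field_simp; ring
  have hterm : ∀ n : ℕ, ((2 * R)⁻¹ * |(k : ℝ)|) ^ n / n.factorial * ‖fc f k‖ ≤
      C * (1 / 2 : ℝ) ^ n := by
    intro n
    have hfac : (0 : ℝ) < n.factorial := by exact_mod_cast n.factorial_pos
    have e1 : ((2 * R)⁻¹ * |(k : ℝ)|) ^ n / n.factorial * ‖fc f k‖ =
        (|(k : ℝ)| ^ n * ‖fc f k‖) * ((1 / 2) ^ n / (R ^ n * n.factorial)) := by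
      rw [mul_pow, inv_pow, mul_pow, div_pow, one_pow]
      field_simp
    rw [e1]
    calc _ ≤ (C * n.factorial * R ^ n) * ((1 / 2) ^ n / (R ^ n * n.factorial)) :=
          mul_le_mul_of_nonneg_right (h1 n) (by positivity)
      _ = _ := by field_simp
  have h5 : HasSum (fun n : ℕ => ((2 * R)⁻¹ * |(k : ℝ)|) ^ n / n.factorial)
      (Real.exp ((2 * R)⁻¹ * |(k : ℝ)|)) := by
    rw [Real.exp_eq_exp_ℝ]
    exact NormedSpace.expSeries_div_hasSum_exp _
  have h6 : HasSum (fun n : ℕ => C * (1 / 2 : ℝ) ^ n) (C * 2) := hasSum_geometric_two.mul_left C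
  have h7 : Real.exp ((2 * R)⁻¹ * |(k : ℝ)|) * ‖fc f k‖ ≤ C * 2 :=
    hasSum_le hterm (h5.mul_right ‖fc f k‖) h6
  rw [neg_mul, Real.exp_neg, ← div_eq_mul_inv, le_div_iff₀ (Real.exp_pos _), mul_comm 2 C,
    mul_comm ‖fc f k‖]
  exact h7

/-! ### Transfer between functions and coefficients -/

theorem wt_sq_le (k : ℤ) : wt k ^ 2 ≤ 2 * (1 + (k : ℝ) ^ 2) := by
  have := sq_abs (k : ℝ)
  unfold wt
  nlinarith [sq_nonneg (1 - |(k : ℝ)|)]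

theorem wt_rpow_sq_le {r : ℝ} (hr : 0 ≤ r) (k : ℤ) :
    (wt k ^ r) ^ 2 ≤ 2 ^ r * (1 + (k : ℝ) ^ 2) ^ r := by
  have h0 := (wt_pos k).le
  rw [← Real.mul_rpow (by norm_num) (by positivity), ← Real.rpow_natCast, ← Real.rpow_mul h0,
    mul_comm, Real.rpow_mul h0, Real.rpow_natCast]
  exact Real.rpow_le_rpow (by positivity) (wt_sq_le k) hr

theorem hsNorm_nonneg (s : ℝ) (f : ℝ → ℂ) : 0 ≤ hsNorm s f := Real.sqrt_nonneg _

/-- Cauchy–Schwarz against `wt⁻¹`, which is square summable, costs one more power of `wt`; this is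
where `r ≥ α + 2` enters. -/
theorem MemHs.sum_wt_le {α r : ℝ} (hα : 0 ≤ α) (hr : α + 2 ≤ r) {f : ℝ → ℂ} (hf : MemHs r f)
    (F : Finset ℤ) :
    ∑ k ∈ F, wt k ^ (α + 1) * ‖fc f k‖ ≤ wtC * (√(2 ^ r) * hsNorm r f) := by
  refine (sum_le_wtC F).trans ?_
  refine mul_le_mul_of_nonneg_left ?_ (Real.sqrt_nonneg _)
  rw [Real.sqrt_le_left (mul_nonneg (Real.sqrt_nonneg _) (hsNorm_nonneg _ _)), mul_pow,
    Real.sq_sqrt (by positivity), hsNorm_sq, ← tsum_mul_left]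
  refine le_trans (Finset.sum_le_sum fun k _ => ?_) ((hf.summable.mul_left _).sum_le_tsum F
    fun k _ => by positivity)
  have h1 : wt k * (wt k ^ (α + 1) * ‖fc f k‖) = wt k ^ (α + 2) * ‖fc f k‖ := by
    have : α + 2 = α + 1 + 1 := by ring
    rw [this, Real.rpow_add_one (wt_pos k).ne' (α + 1)]
    ring
  rw [h1, mul_pow, ← mul_assoc]
  gcongr
  refine le_trans ?_ (wt_rpow_sq_le (by linarith) k)
  have := Real.rpow_le_rpow_of_exponent_le (one_le_wt k) hr
  have h0 := wt_pos k
  gcongr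

theorem MemHs.summable_wt {α r : ℝ} (hα : 0 ≤ α) (hr : α + 2 ≤ r) {f : ℝ → ℂ} (hf : MemHs r f) :
    Summable fun k => wt k ^ (α + 1) * ‖fc f k‖ :=
  summable_of_sum_le (fun k => mul_nonneg (Real.rpow_nonneg (wt_pos k).le _) (norm_nonneg _))
    (hf.sum_wt_le hα hr)

theorem MemHs.tsum_wt_le {α r : ℝ} (hα : 0 ≤ α) (hr : α + 2 ≤ r) {f : ℝ → ℂ} (hf : MemHs r f) :
    ∑' k, wt k ^ (α + 1) * ‖fc f k‖ ≤ wtC * (√(2 ^ r) * hsNorm r f) :=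
  (hf.summable_wt hα hr).tsum_le_of_sum_le (hf.sum_wt_le hα hr)

theorem MemHs.summable_sq {r : ℝ} {f : ℝ → ℂ} (hf : MemHs r f) : Summable fun k => ‖fc f k‖ ^ 2 :=
  (hasSum_sq_fc hf.memLp).summable

theorem MemHs.tsum_tail_sq_le {r : ℝ} (hr : 0 ≤ r) {f : ℝ → ℂ} (hf : MemHs r f) {N : ℕ}
    (hN : 1 ≤ N) : ∑' k, tail N (fc f) k ^ 2 ≤ ((4 / N : ℝ) ^ r * hsNorm r f) ^ 2 := by
  have hN0 : (0 : ℝ) < N := by exact_mod_cast hN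
  rw [mul_pow, hsNorm_sq, ← tsum_mul_left]
  refine (summable_tail_sq hf.summable_sq N).tsum_le_tsum (fun k => ?_) (hf.summable.mul_left _)
  rw [tail]
  split_ifs with h
  · rw [← mul_assoc]
    refine le_mul_of_one_le_left (by positivity) ?_
    have h1 : ((4 / N : ℝ) ^ r) ^ 2 = ((4 / N : ℝ) ^ 2) ^ r := by
      rw [← Real.rpow_natCast, ← Real.rpow_mul (by positivity), mul_comm, Real.rpow_mul
        (by positivity), Real.rpow_natCast]
    rw [h1, ← Real.mul_rpow (by positivity) (by positivity)]
    refine Real.one_le_rpow ?_ hr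
    rw [div_pow, div_mul_eq_mul_div, one_le_div (by positivity)]
    have h2 : (N : ℝ) ^ 2 ≤ (4 * |(k : ℝ)|) ^ 2 := by gcongr
    rw [mul_pow, sq_abs] at h2
    nlinarith
  · rw [zero_pow two_ne_zero]; positivity

theorem continuous_and_fc_eq_zero_of_mem_V {N : ℕ} {f : ℝ → ℂ} (hf : f ∈ V N) :
    Continuous f ∧ ∀ k ∉ freq N, fc f k = 0 := by
  induction hf using Submodule.span_induction with
  | mem g hg =>
    obtain ⟨l, hl, rfl⟩ := hg
    refine ⟨continuous_e l, fun k hk => ?_⟩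
    rw [fc_e, if_neg]
    rintro rfl
    exact hk (Finset.mem_Icc.2 hl)
  | zero => exact ⟨continuous_const, fun k _ => by simp [fc]⟩
  | add g h _ _ hg hh =>
    refine ⟨hg.1.add hh.1, fun k hk => ?_⟩
    have := fc_add (perL2_of_continuous hg.1).perInt (perL2_of_continuous hh.1).perInt k
    rw [hg.2 k hk, hh.2 k hk, add_zero] at this
    exact this
  | smul c g _ hg =>
    refine ⟨hg.1.const_smul c, fun k hk => ?_⟩
    have := fc_const_mul c g k
    rw [hg.2 k hk, mul_zero] at this
    exact this

theorem fc_P (N : ℕ) (f : ℝ → ℂ) (k : ℤ) : fc (P N f) k = if k ∈ freq N then fc f k else 0 := by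
  have h : P N f = ser fun k => if k ∈ freq N then fc f k else 0 := by
    ext x
    rw [ser, tsum_eq_sum (s := freq N) fun l hl => by rw [if_neg hl, zero_mul]]
    exact Finset.sum_congr rfl fun l hl => by rw [if_pos hl]
  rw [h, fc_ser]
  exact summable_of_ne_finset_zero (s := freq N) fun l hl => by rw [if_neg hl, norm_zero]

/-- Parseval and the triangle inequality through the truncation `cut N k * fc f k`: its distance to
`f` is the tail. -/
theorem l2Norm_sub_sq_le {N : ℕ} (hN : 1 ≤ N) {f g : ℝ → ℂ} (hf : PerL2 f) (hg : PerL2 g)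
    (hg0 : ∀ k ∉ freq N, fc g k = 0) : l2Norm (fun x => f x - g x) ^ 2 ≤ 4 * Real.pi *
      (∑' k, tail N (fc f) k ^ 2 + ∑ k ∈ freq N, ‖(cut N k : ℂ) * fc f k - fc g k‖ ^ 2) := by
  have hs := summable_tail_sq (hasSum_sq_fc hf).summable N
  have hd0 : ∀ k ∉ freq N, (cut N k : ℂ) * fc f k - fc g k = 0 := fun k hk => by
    rw [hg0 k hk, cut_eq_zero hN (le_abs_of_notMem_freq hk)]; simp
  have hs2 : Summable fun k => ‖(cut N k : ℂ) * fc f k - fc g k‖ ^ 2 :=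
    summable_of_ne_finset_zero (s := freq N) fun l hl => by simp [hd0 l hl]
  have h1 : ∑ k ∈ freq N, ‖(cut N k : ℂ) * fc f k - fc g k‖ ^ 2 =
      ∑' k, ‖(cut N k : ℂ) * fc f k - fc g k‖ ^ 2 :=
    (tsum_eq_sum fun l hl => by simp [hd0 l hl]).symm
  rw [l2Norm_sq (f := fun x => f x - g x) (hf.sub hg), h1, ← hs.tsum_add hs2]
  have h2 : ∑' k, ‖fc (fun x => f x - g x) k‖ ^ 2 ≤
      ∑' k, 2 * (tail N (fc f) k ^ 2 + ‖(cut N k : ℂ) * fc f k - fc g k‖ ^ 2) := by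
    refine (hasSum_sq_fc (hf.sub hg)).summable.tsum_le_tsum (fun k => ?_) ((hs.add hs2).mul_left 2)
    rw [fc_sub hf.perInt hg.perInt]
    have h3 : ‖fc f k - fc g k‖ ≤ tail N (fc f) k + ‖(cut N k : ℂ) * fc f k - fc g k‖ := by
      have := norm_cut_defect_le_tail hN (fc f) k
      rw [norm_sub_rev] at this
      have e : fc f k - fc g k = (fc f k - cut N k * fc f k) + (cut N k * fc f k - fc g k) := by
        ring
      rw [e]
      exact (norm_add_le _ _).trans (add_le_add_left this _)
    have h4 := tail_nonneg N (fc f) k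
    nlinarith [norm_nonneg (fc f k - fc g k),
      sq_nonneg (tail N (fc f) k - ‖(cut N k : ℂ) * fc f k - fc g k‖)]
  rw [tsum_mul_left] at h2
  calc _ ≤ 2 * Real.pi * (2 * _) := mul_le_mul_of_nonneg_left h2 (by positivity)
    _ = _ := by ring

/-! ### Solutions in Fourier modes -/

section

variable {α κ₁ κ₂ γ T r : ℝ} {u₀ : ℝ → ℝ} {u : ℝ → ℝ → ℝ}

theorem IsExactSolution.modeSol (hα : 0 ≤ α) (hr : α + 2 ≤ r)
    (hu : IsExactSolution α κ₁ κ₂ γ T r u₀ u) :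
    ModeSol α κ₁ κ₂ γ T univ fun t => fc fun x => (u t x : ℂ) :=
  modeSol_of_variational hα (fun k _ => e_mem_smoothPer k) (fun t ht => (hu.cont.mem t ht).memLp)
    (fun t ht => (hu.cont.mem t ht).summable_wt hα hr)
    (hu.cont.continuousOn_fc (by linarith)) hu.eqn

theorem fc_ofReal_neg (f : ℝ → ℝ) (k : ℤ) :
    fc (fun x => (f x : ℂ)) (-k) = (starRingEnd ℂ) (fc (fun x => (f x : ℂ)) k) :=
  fc_neg_of_real (fun _ => Complex.conj_ofReal _) k

variable {N : ℕ} {uN : ℝ → ℝ → ℂ}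

theorem IsFSG.fc_eq_zero (h : IsFSG α κ₁ κ₂ γ T N u₀ uN) :
    ∀ t ∈ Icc 0 T, ∀ k ∉ freq N, fc (uN t) k = 0 := fun t ht =>
  (continuous_and_fc_eq_zero_of_mem_V (h.mem t ht)).2

theorem IsFSG.modeSol (hα : 0 ≤ α) (h : IsFSG α κ₁ κ₂ γ T N u₀ uN) :
    ModeSol α κ₁ κ₂ γ T (freq N) fun t => fc (uN t) :=
  modeSol_of_variational hα (fun _ hk => e_mem_V hk) (fun t ht => (h.cont.mem t ht).memLp)
    (fun t ht => summable_of_support (h.fc_eq_zero t ht) (fun k x => wt k ^ (α + 1) * x)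
      fun _ => mul_zero _)
    (h.cont.continuousOn_fc le_rfl) h.eqn

theorem IsFSG.fc_init (h : IsFSG α κ₁ κ₂ γ T N u₀ uN) (k : ℤ) :
    fc (uN 0) k = if k ∈ freq N then fc (fun x => (u₀ x : ℂ)) k else 0 := by
  rw [h.init, fc_P]

theorem IsFSG.fc_neg (hα : α ∈ Icc (1 : ℝ) 2) (hN : 1 ≤ N) (h : IsFSG α κ₁ κ₂ γ T N u₀ uN) :
    ∀ t ∈ Icc 0 T, ∀ k, fc (uN t) (-k) = (starRingEnd ℂ) (fc (uN t) k) := by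
  refine (h.modeSol (by linarith [hα.1])).eq_conj_neg hα hN h.fc_eq_zero fun k => ?_
  simp only [h.fc_init]
  by_cases hk : k ∈ freq N
  · rw [if_pos hk, if_pos (neg_mem_freq hk), fc_ofReal_neg]
  · rw [if_neg hk, if_neg fun h => hk (by simpa using neg_mem_freq h), map_zero]

end

/-! ### Error bounds -/

/-- The coefficient bound is kept beside the `L²` bound because the inverse inequality is applied to
it in the analytic case. -/
theorem exists_error_bound {α r : ℝ} (hα : α ∈ Icc (1 : ℝ) 2) (hr : α + 2 ≤ r) 
    (κ₁ κ₂ γ T : ℝ) {M : ℝ} (hM : 0 ≤ M) :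
    ∃ K > 0, ∃ ε > 0, ∀ (u₀ : ℝ → ℝ) (u : ℝ → ℝ → ℝ) (_ : IsExactSolution α κ₁ κ₂ γ T r u₀ u)
      (_ : ∀ t ∈ Icc 0 T, hsNorm r (fun x => (u t x : ℂ)) ≤ M) (N : ℕ) (_ : 1 ≤ N)
      (uN : ℝ → ℝ → ℂ) (_ : IsFSG α κ₁ κ₂ γ T N u₀ uN) (δ : ℝ) (_ : 0 < δ)
      (_ : ∀ t ∈ Icc 0 T, ∑' k, tail N (fc fun x => (u t x : ℂ)) k ^ 2 ≤ δ ^ 2)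
      (_ : (N : ℝ) ^ (α + 3 / 2) * δ ≤ ε), ∀ t ∈ Icc 0 T,
      ∑ k ∈ freq N, ‖(cut N k : ℂ) * fc (fun x => (u t x : ℂ)) k - fc (uN t) k‖ ^ 2 ≤ (K * δ) ^ 2 ∧
        l2Norm (fun x => (u t x : ℂ) - uN t x) ≤ K * δ := by
  have hα0 : 0 ≤ α := by linarith [hα.1]
  have hc : 0 ≤ wtC := Real.sqrt_nonneg _
  obtain ⟨K, hK, ε, hε, H⟩ := galerkin_error_bound hα κ₁ κ₂ γ T
    (A := wtC * (√(2 ^ r) * M)) (by positivity)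
  have hpi := Real.pi_gt_three
  refine ⟨4 * Real.pi * (1 + K), by positivity, ε, hε, ?_⟩
  intro u₀ u hu huM N hN uN hN' δ hδ htail hsmall t ht
  have h0 : ∀ k ∈ freq N, fc (uN 0) k = fc (fun x => (u 0 x : ℂ)) k := fun k hk => by
    rw [hN'.fc_init, if_pos hk, hu.init]
  have h1 := H N hN _ _ (hu.modeSol hα0 hr) (hN'.modeSol hα0) (fun t _ => fc_ofReal_neg _)
    (fun t ht => (hu.cont.mem t ht).summable_wt hα0 hr)
    (fun t ht => ((hu.cont.mem t ht).tsum_wt_le hα0 hr).trans (by gcongr; exact huM t ht))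
    hN'.fc_eq_zero h0 δ hδ htail hsmall t ht
  have h2 := l2Norm_sub_sq_le hN (hu.cont.mem t ht).memLp (hN'.cont.mem t ht).memLp
    (hN'.fc_eq_zero t ht)
  -- A constant at least one is below its square, so both estimates can be written with the same
  -- `K`.
  have h4 : 1 ≤ 4 * Real.pi * (1 + K) := by nlinarith
  have h5 : 4 * Real.pi * (1 + K) ≤ (4 * Real.pi * (1 + K)) ^ 2 := by nlinarith
  have h6 : K ≤ 4 * Real.pi * (1 + K) := by nlinarith
  have hδ2 : 0 < δ ^ 2 := by positivity
  constructor
  · rw [mul_pow]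
    exact h1.trans (mul_le_mul_of_nonneg_right (h6.trans h5) hδ2.le)
  · refine abs_le_of_sq_le_sq' ?_ (by positivity) |>.2
    calc _ ≤ 4 * Real.pi * (δ ^ 2 + K * δ ^ 2) :=
          h2.trans (mul_le_mul_of_nonneg_left (add_le_add (htail t ht) h1) (by positivity))
      _ = 4 * Real.pi * (1 + K) * δ ^ 2 := by ring
      _ ≤ (4 * Real.pi * (1 + K)) ^ 2 * δ ^ 2 := mul_le_mul_of_nonneg_right h5 hδ2.le
      _ = _ := by ring

/-- This serves degrees too small for the barrier argument. The initial energy of the scheme is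
controlled by `M`, and conservation keeps it bounded for every `N`. -/
theorem exists_uniform_error_bound {α r : ℝ} (hα : α ∈ Icc (1 : ℝ) 2) (hr : α + 2 ≤ r) 
    (κ₁ κ₂ γ : ℝ) {T : ℝ} (hT : 0 ≤ T) (M : ℝ) :
    ∃ C > 0, ∀ (u₀ : ℝ → ℝ) (u : ℝ → ℝ → ℝ) (_ : IsExactSolution α κ₁ κ₂ γ T r u₀ u)
      (_ : ∀ t ∈ Icc 0 T, hsNorm r (fun x => (u t x : ℂ)) ≤ M) (N : ℕ) (_ : 1 ≤ N)
      (uN : ℝ → ℝ → ℂ) (_ : IsFSG α κ₁ κ₂ γ T N u₀ uN), ∀ t ∈ Icc 0 T,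
        l2Norm (fun x => (u t x : ℂ) - uN t x) ≤ C := by
  have hα0 : 0 ≤ α := by linarith [hα.1]
  have hc : 0 ≤ wtC := Real.sqrt_nonneg _
  set A := wtC * (√(2 ^ r) * M) with hA
  refine ⟨√(4 * Real.pi * (M ^ 2 + (2 * A ^ 2 + 1) * Real.exp T)), by positivity, ?_⟩
  intro u₀ u hu huM N hN uN hN' t ht
  have hT0 : (0 : ℝ) ∈ Icc 0 T := ⟨le_rfl, hT⟩
  have hy := (hN'.modeSol hα0).sum_sq_le hα hN'.fc_eq_zero (hN'.fc_neg hα hN) (A := A) ?_ t ht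
  · have hf := hu.cont.mem t ht
    have hg := hN'.cont.mem t ht
    refine Real.le_sqrt_of_sq_le ?_
    rw [l2Norm_sq (f := fun x => (u t x : ℂ) - uN t x) (hf.memLp.sub hg.memLp)]
    have h1 : ∑' k, ‖fc (fun x => (u t x : ℂ)) k‖ ^ 2 ≤ M ^ 2 := by
      refine le_trans ?_ (pow_le_pow_left₀ (hsNorm_nonneg _ _) (huM t ht) 2)
      rw [hsNorm_sq]
      exact hf.summable_sq.tsum_le_tsum (fun k => le_mul_of_one_le_left (by positivity)
        (one_le_bracket (by linarith) k)) hf.summable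
    have h2 : ∑' k, ‖fc (uN t) k‖ ^ 2 ≤ (2 * A ^ 2 + 1) * Real.exp T := by
      rwa [tsum_eq_sum (s := freq N) fun l hl => by
        rw [hN'.fc_eq_zero t ht l hl, norm_zero, zero_pow two_ne_zero]]
    have h3 : ∑' k, ‖fc (fun x => (u t x : ℂ) - uN t x) k‖ ^ 2 ≤
        ∑' k, 2 * (‖fc (fun x => (u t x : ℂ)) k‖ ^ 2 + ‖fc (uN t) k‖ ^ 2) := by
      refine (hasSum_sq_fc (hf.memLp.sub hg.memLp)).summable.tsum_le_tsum (fun k => ?_)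
        ((hf.summable_sq.add hg.summable_sq).mul_left 2)
      rw [fc_sub (PerL2.perInt hf.memLp) (PerL2.perInt hg.memLp)]
      have := norm_sub_le (fc (fun x => (u t x : ℂ)) k) (fc (uN t) k)
      nlinarith [sq_nonneg (‖fc (fun x => (u t x : ℂ)) k‖ - ‖fc (uN t) k‖),
        norm_nonneg (fc (fun x => (u t x : ℂ)) k - fc (uN t) k)]
    rw [tsum_mul_left, hf.summable_sq.tsum_add hg.summable_sq] at h3
    calc _ ≤ 2 * Real.pi * (2 * (M ^ 2 + (2 * A ^ 2 + 1) * Real.exp T)) :=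
          mul_le_mul_of_nonneg_left (by linarith) (by positivity)
      _ = _ := by ring
  · have h1 : ∑ k ∈ freq N, wt k ^ (α + 1) * ‖fc (uN 0) k‖ =
        ∑ k ∈ freq N, wt k ^ (α + 1) * ‖fc (fun x => (u 0 x : ℂ)) k‖ :=
      Finset.sum_congr rfl fun k hk => by rw [hN'.fc_init, if_pos hk, hu.init]
    rw [h1]
    refine ((hu.cont.mem 0 hT0).sum_wt_le hα0 hr _).trans ?_
    rw [hA]
    gcongr
    exact huM 0 hT0

theorem exists_algebraic_error_bound {α r : ℝ} (hα : α ∈ Icc (1 : ℝ) 2) (hr : α + 2 ≤ r) 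
    (κ₁ κ₂ γ : ℝ) {T : ℝ} (hT : 0 ≤ T) (M : ℝ) :
    ∃ C > 0, ∀ (u₀ : ℝ → ℝ) (u : ℝ → ℝ → ℝ) (_ : IsExactSolution α κ₁ κ₂ γ T r u₀ u)
      (_ : ∀ t ∈ Icc 0 T, hsNorm r (fun x => (u t x : ℂ)) ≤ M) (N : ℕ) (_ : 1 ≤ N)
      (uN : ℝ → ℝ → ℂ) (_ : IsFSG α κ₁ κ₂ γ T N u₀ uN), ∀ t ∈ Icc 0 T,
        l2Norm (fun x => (u t x : ℂ) - uN t x) ≤ C * (N : ℝ) ^ (-r) := by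
  have hr0 : 0 ≤ r := by linarith [hα.1]
  -- The maximum with one keeps the tail parameter `δ = (4 / N) ^ r * D` strictly positive.
  set D := max M 1 with hD
  have hD1 : 1 ≤ D := le_max_right _ _
  obtain ⟨K, hK, ε, hε, H⟩ := exists_error_bound hα hr κ₁ κ₂ γ T (M := D) (by linarith)
  obtain ⟨C, hC, H'⟩ := exists_uniform_error_bound hα hr κ₁ κ₂ γ hT D
  have h4 : ∀ N : ℕ, (4 / N : ℝ) ^ r = 4 ^ r * (N : ℝ) ^ (-r) := fun N => by
    rw [Real.div_rpow (by norm_num) (Nat.cast_nonneg _), Real.rpow_neg (Nat.cast_nonneg _),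
      div_eq_mul_inv]
  have hlim : Tendsto (fun N : ℕ => (D * 4 ^ r) * (N : ℝ) ^ (-(1 / 2 : ℝ))) atTop (𝓝 0) := by
    have := ((tendsto_rpow_neg_atTop (y := 1 / 2) (by norm_num)).comp
      tendsto_natCast_atTop_atTop).const_mul (D * 4 ^ r)
    simpa using this
  obtain ⟨N₀, hN₀⟩ := eventually_atTop.1 ((hlim.eventually_le_const hε))
  refine ⟨K * (D * 4 ^ r) + C * (N₀ : ℝ) ^ r, by positivity, ?_⟩
  intro u₀ u hu huM N hN uN hN' t ht
  have huD : ∀ t ∈ Icc 0 T, hsNorm r (fun x => (u t x : ℂ)) ≤ D := fun t ht =>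
    (huM t ht).trans (le_max_left _ _)
  have hNp : (0 : ℝ) < N := by exact_mod_cast hN
  rcases le_or_gt N₀ N with h | h
  · have := (H u₀ u hu huD N hN uN hN' ((4 / N : ℝ) ^ r * D) (by positivity) (fun t ht => ?_) ?_
      t ht).2
    · refine this.trans ?_
      rw [h4, add_mul]
      have : 0 ≤ C * (N₀ : ℝ) ^ r * (N : ℝ) ^ (-r) := by positivity
      linarith
    · refine ((hu.cont.mem t ht).tsum_tail_sq_le hr0 hN).trans ?_
      have := hsNorm_nonneg r fun x => (u t x : ℂ)
      gcongr
      exact huD t ht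
    · refine le_trans ?_ (hN₀ N h)
      have h5 : (N : ℝ) ^ (α + 3 / 2) * ((4 / N : ℝ) ^ r * D) =
          D * 4 ^ r * (N : ℝ) ^ (α + 3 / 2 + -r) := by
        rw [h4, Real.rpow_add hNp (α + 3 / 2) (-r)]; ring
      rw [h5]
      -- Here `r ≥ α + 2` yields the exponent `α + 3 / 2 - r ≤ -1 / 2`, so the smallness condition
      -- holds for large `N`.
      gcongr
      · exact_mod_cast hN
      · linarith
  · refine (H' u₀ u hu huD N hN uN hN' t ht).trans ?_
    have h5 : 1 ≤ (N₀ : ℝ) ^ r * (N : ℝ) ^ (-r) := by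
      rw [Real.rpow_neg hNp.le, ← div_eq_mul_inv, one_le_div (by positivity)]
      gcongr
    rw [add_mul, mul_assoc C]
    have : 0 ≤ K * (D * 4 ^ r) * (N : ℝ) ^ (-r) := by positivity
    nlinarith

/-! ### Exponential convergence -/

theorem ContInHs.exists_bound {s T : ℝ} {u : ℝ → ℝ → ℂ} (hu : ContInHs s T u) :
    ∃ M, ∀ t ∈ Icc 0 T, hsNorm s (u t) ≤ M := by
  refine isCompact_Icc.induction_on (p := fun A => ∃ M, ∀ t ∈ A, hsNorm s (u t) ≤ M)
    ⟨0, fun t ht => ht.elim⟩ (fun A B hAB ⟨M, hM⟩ => ⟨M, fun t ht => hM t (hAB ht)⟩)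
    (fun A B ⟨M, hM⟩ ⟨M', hM'⟩ => ⟨max M M', fun t ht => ht.elim
      (fun h => (hM t h).trans (le_max_left _ _)) fun h => (hM' t h).trans (le_max_right _ _)⟩)
    fun t₀ ht₀ => ?_
  refine ⟨_, inter_mem self_mem_nhdsWithin ((hu.cont t₀ ht₀).eventually_le_const one_pos),
    √(2 * hsNorm s (u t₀) ^ 2 + 2), fun t ht => Real.le_sqrt_of_sq_le ?_⟩
  have hf := hu.mem t ht.1
  have hg := hu.mem t₀ ht₀
  have hd := hf.sub hg
  have h1 : hsNorm s (fun x => u t x - u t₀ x) ^ 2 ≤ 1 :=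
    pow_le_one₀ (hsNorm_nonneg _ _) ht.2
  refine le_trans ?_ (by linarith :
    2 * hsNorm s (u t₀) ^ 2 + 2 * hsNorm s (fun x => u t x - u t₀ x) ^ 2 ≤ _)
  rw [hsNorm_sq, hsNorm_sq, hsNorm_sq, ← tsum_mul_left, ← tsum_mul_left,
    ← (hg.summable.mul_left 2).tsum_add (hd.summable.mul_left 2)]
  refine hf.summable.tsum_le_tsum (fun k => ?_)
    ((hg.summable.mul_left 2).add (hd.summable.mul_left 2))
  rw [fc_sub (PerL2.perInt hf.memLp) (PerL2.perInt hg.memLp)]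
  have h2 : ‖fc (u t) k‖ ^ 2 ≤
      2 * ‖fc (u t₀) k‖ ^ 2 + 2 * ‖fc (u t) k - fc (u t₀) k‖ ^ 2 := by
    have := norm_add_le (fc (u t₀) k) (fc (u t) k - fc (u t₀) k)
    rw [add_sub_cancel] at this
    nlinarith [sq_nonneg (‖fc (u t₀) k‖ - ‖fc (u t) k - fc (u t₀) k‖), norm_nonneg (fc (u t) k)]
  have hp : 0 ≤ (1 + (k : ℝ) ^ 2) ^ s := by positivity
  nlinarith [mul_le_mul_of_nonneg_left h2 hp]

/-! ### Exponentially decaying sequences -/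

theorem exists_wt_pow_mul_exp_le {c : ℝ} (hc : 0 < c) :
    ∃ D > 0, ∀ k : ℤ, wt k ^ 8 * Real.exp (-c * |(k : ℝ)|) ≤ D * (wt k ^ 2)⁻¹ := by
  -- Ten powers are absorbed by the exponential: eight from the square of `gev`, two for
  -- summability.
  refine ⟨Nat.factorial 10 * Real.exp c / c ^ 10, by positivity, fun k => ?_⟩
  have hw := wt_pos k
  have h1 := Real.pow_div_factorial_le_exp (c * wt k) (by positivity) 10
  rw [div_le_iff₀ (by positivity)] at h1
  have h2 : Real.exp (c * wt k) * Real.exp (-c * |(k : ℝ)|) = Real.exp c := by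
    rw [← Real.exp_add]; unfold wt; ring_nf
  rw [← div_eq_mul_inv, le_div_iff₀ (by positivity), le_div_iff₀ (by positivity)]
  calc _ = (c * wt k) ^ 10 * Real.exp (-c * |(k : ℝ)|) := by ring
    _ ≤ Real.exp (c * wt k) * Nat.factorial 10 * Real.exp (-c * |(k : ℝ)|) := by gcongr
    _ = _ := by rw [mul_right_comm, h2, mul_comm]

theorem summable_exp_neg_abs {c : ℝ} (hc : 0 < c) :
    Summable fun k : ℤ => Real.exp (-c * |(k : ℝ)|) := by
  obtain ⟨D, -, hD⟩ := exists_wt_pow_mul_exp_le hc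
  refine Summable.of_nonneg_of_le (fun k => (Real.exp_pos _).le) (fun k => ?_)
    (summable_wt_inv.mul_left D)
  exact (le_mul_of_one_le_left (Real.exp_pos _).le (one_le_pow₀ (one_le_wt k))).trans (hD k)

/-- Half the decay rate is used as Gevrey radius: the squared weight grows like `exp (c |k|)`
against `exp (-2 c |k|)`, and a summable exponential remains. -/
theorem exists_sum_gev_le {a : ℤ → ℂ} {C c : ℝ} (hc : 0 < c)
    (ha : ∀ k, ‖a k‖ ≤ C * Real.exp (-c * |(k : ℝ)|)) :
    ∃ B, 0 ≤ B ∧ ∀ F : Finset ℤ, ∑ k ∈ F, gev (c / 2) |(k : ℝ)| ^ 2 * ‖a k‖ ^ 2 ≤ B := by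
  obtain ⟨D, hD0, hD⟩ := exists_wt_pow_mul_exp_le hc
  have hs := summable_wt_inv.mul_left (C ^ 2 * D)
  refine ⟨∑' k : ℤ, C ^ 2 * D * (wt k ^ 2)⁻¹, tsum_nonneg fun k => by positivity, fun F => ?_⟩
  refine le_trans (Finset.sum_le_sum fun k _ => ?_)
    (hs.sum_le_tsum F fun k _ => by positivity)
  have h1 : gev (c / 2) |(k : ℝ)| ^ 2 * (C * Real.exp (-c * |(k : ℝ)|)) ^ 2 =
      C ^ 2 * (wt k ^ 8 * Real.exp (-c * |(k : ℝ)|)) := by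
    have h2 : Real.exp (c / 2 * |(k : ℝ)|) ^ 2 * Real.exp (-c * |(k : ℝ)|) = 1 := by
      rw [← Real.exp_nat_mul, ← Real.exp_add, Real.exp_eq_one_iff]
      push_cast; ring
    unfold gev wt
    linear_combination C ^ 2 * (1 + |(k : ℝ)|) ^ 8 * Real.exp (-c * |(k : ℝ)|) * h2
  rw [mul_assoc]
  refine le_trans ?_ (mul_le_mul_of_nonneg_left (hD k) (sq_nonneg C))
  rw [← h1]
  gcongr
  exact ha k

theorem tsum_tail_sq_le_of_exp_decay {a : ℤ → ℂ} {C c : ℝ} (hc : 0 < c)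
    (ha : ∀ k, ‖a k‖ ≤ C * Real.exp (-c * |(k : ℝ)|)) (N : ℕ) :
    ∑' k, tail N a k ^ 2 ≤
      (C * √(∑' k : ℤ, Real.exp (-c * |(k : ℝ)|) + 1) * Real.exp (-(c / 8) * N)) ^ 2 := by
  have hs := summable_exp_neg_abs hc
  have hS : 0 ≤ ∑' k : ℤ, Real.exp (-c * |(k : ℝ)|) := tsum_nonneg fun k => (Real.exp_pos _).le
  -- One of the two factors `exp (-c |k|)` is kept for summation; on `|k| ≥ N / 4` the other is at
  -- most `exp (-c N / 4)`.
  have hle : ∀ k, tail N a k ^ 2 ≤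
      C ^ 2 * Real.exp (-(c / 8) * N) ^ 2 * Real.exp (-c * |(k : ℝ)|) := fun k => by
    rw [tail]
    split_ifs with h
    · calc _ ≤ (C * Real.exp (-c * |(k : ℝ)|)) ^ 2 := by gcongr; exact ha k
        _ = C ^ 2 * Real.exp (-c * |(k : ℝ)|) * Real.exp (-c * |(k : ℝ)|) := by ring
        _ ≤ C ^ 2 * Real.exp (-(c / 8) * N) ^ 2 * Real.exp (-c * |(k : ℝ)|) := by
          gcongr
          rw [← Real.exp_nat_mul]
          refine Real.exp_le_exp.2 ?_
          push_cast
          nlinarith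
    · rw [zero_pow two_ne_zero]; positivity
  have hs' := hs.mul_left (C ^ 2 * Real.exp (-(c / 8) * N) ^ 2)
  refine ((hs'.of_nonneg_of_le (fun k => sq_nonneg _) hle).tsum_le_tsum hle hs').trans ?_
  rw [tsum_mul_left, mul_pow, mul_pow, Real.sq_sqrt (by positivity)]
  have : 0 ≤ C ^ 2 * Real.exp (-(c / 8) * N) ^ 2 := by positivity
  nlinarith

theorem norm_fc_le_l2Norm {f : ℝ → ℂ} (hf : PerL2 f) (k : ℤ) : ‖fc f k‖ ≤ l2Norm f := by
  refine le_of_sq_le_sq ?_ (Real.sqrt_nonneg _)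
  rw [l2Norm_sq hf]
  have h1 := (hasSum_sq_fc hf).summable.le_tsum k fun _ _ => sq_nonneg _
  have := Real.pi_gt_three
  nlinarith [sq_nonneg ‖fc f k‖]

/-- The Fourier coefficients of the solution decay exponentially, because those of the Galerkin
approximations do so uniformly in the degree. -/
theorem IsExactSolution.exists_fc_bound {α κ₁ κ₂ γ T r : ℝ} (hα : α ∈ Icc (1 : ℝ) 2) (hT : 0 ≤ T)
    (hr : α + 2 ≤ r) {u₀ : ℝ → ℝ} {u : ℝ → ℝ → ℝ} (hu : IsExactSolution α κ₁ κ₂ γ T r u₀ u)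
    (ha : AnalyticOnNhd ℝ u₀ univ)
    (hex : ∀ N₀ : ℕ, ∃ N ≥ N₀, ∃ uN, IsFSG α κ₁ κ₂ γ T N u₀ uN) :
    ∃ C > 0, ∃ c > 0, ∀ t ∈ Icc 0 T, ∀ k,
      ‖fc (fun x => (u t x : ℂ)) k‖ ≤ C * Real.exp (-c * |(k : ℝ)|) := by
  have hα0 : 0 ≤ α := by linarith [hα.1]
  have hr0 : 0 ≤ r := by linarith
  have hc : 0 ≤ wtC := Real.sqrt_nonneg _
  have hT0 : (0 : ℝ) ∈ Icc 0 T := ⟨le_rfl, hT⟩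
  obtain ⟨M, hM⟩ := hu.cont.exists_bound
  have hM0 : 0 ≤ M := (hsNorm_nonneg _ _).trans (hM 0 hT0)
  obtain ⟨K, hK, ε, hε, H⟩ := exists_error_bound hα hr κ₁ κ₂ γ T hM0
  obtain ⟨C₁, hC₁, H₁⟩ := exists_algebraic_error_bound hα hr κ₁ κ₂ γ hT M
  obtain ⟨C₀, hC₀, c₀, hc₀, h₀⟩ := exists_fc_bound_of_analytic (f := fun x => (u₀ x : ℂ))
    (fun x hx => (Complex.ofRealCLM.analyticAt _).comp (ha x hx))
    (by have := (hu.cont.mem 0 hT0).periodic; rwa [hu.init] at this)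
  obtain ⟨B, hB0, hB⟩ := exists_sum_gev_le hc₀ h₀
  -- The first summand of `A` bounds the exact solution in the weighted `ℓ¹` norm; the second bounds
  -- the Galerkin error there, by the inverse inequality and the smallness condition.
  obtain ⟨C, hC, c, hc', HG⟩ := ModeSol.gevrey_bound hα κ₁ κ₂ γ T
    (A := wtC * (√(2 ^ r) * M) + 16 * (K * ε)) (τ₀ := c₀ / 2) (by positivity) hB0 (by positivity)
  refine ⟨C, hC, c, hc', fun t ht k => ?_⟩
  have h4 : ∀ N : ℕ, (4 / N : ℝ) ^ r = 4 ^ r * (N : ℝ) ^ (-r) := fun N => by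
    rw [Real.div_rpow (by norm_num) (Nat.cast_nonneg _), Real.rpow_neg (Nat.cast_nonneg _),
      div_eq_mul_inv]
  have hlim : Tendsto (fun N : ℕ => ((M + 1) * 4 ^ r) * (N : ℝ) ^ (-(1 / 2 : ℝ))) atTop (𝓝 0) := by
    have := ((tendsto_rpow_neg_atTop (y := 1 / 2) (by norm_num)).comp
      tendsto_natCast_atTop_atTop).const_mul ((M + 1) * 4 ^ r)
    simpa using this
  -- The decay constants do not depend on `N`. It remains to choose `N` with `L²` error at most `η`,
  -- so that the `k`-th coefficients of `u` and `uN` differ by at most `η`.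
  refine le_of_forall_pos_le_add fun η hη => ?_
  have hlim' : Tendsto (fun N : ℕ => C₁ * (N : ℝ) ^ (-r)) atTop (𝓝 0) := by
    have := ((tendsto_rpow_neg_atTop (y := r) (by linarith)).comp
      tendsto_natCast_atTop_atTop).const_mul C₁
    simpa using this
  obtain ⟨N₀, hN₀⟩ := eventually_atTop.1 ((hlim.eventually_le_const hε).and
    ((hlim'.eventually_le_const hη).and (eventually_ge_atTop 1)))
  obtain ⟨N, hNN, uN, hN'⟩ := hex N₀
  obtain ⟨hs1, hs2, hN⟩ := hN₀ N hNN
  have hNp : (0 : ℝ) < N := by exact_mod_cast hN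
  have hsmall : (N : ℝ) ^ (α + 3 / 2) * ((4 / N : ℝ) ^ r * (M + 1)) ≤ ε := by
    refine le_trans ?_ hs1
    have h5 : (N : ℝ) ^ (α + 3 / 2) * ((4 / N : ℝ) ^ r * (M + 1)) =
        (M + 1) * 4 ^ r * (N : ℝ) ^ (α + 3 / 2 + -r) := by
      rw [h4, Real.rpow_add hNp (α + 3 / 2) (-r)]; ring
    rw [h5]
    gcongr
    · exact_mod_cast hN
    · linarith
  have herr := H u₀ u hu hM N hN uN hN' ((4 / N : ℝ) ^ r * (M + 1)) (by positivity)
    (fun t ht => by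
      refine ((hu.cont.mem t ht).tsum_tail_sq_le hr0 hN).trans ?_
      have := hsNorm_nonneg r fun x => (u t x : ℂ)
      gcongr
      linarith [hM t ht]) hsmall
  have hy := HG N _ (hN'.modeSol hα0) hN'.fc_eq_zero (hN'.fc_neg hα hN) (fun t ht => ?_) ?_ t ht k
  · have h1 := norm_fc_le_l2Norm ((hu.cont.mem t ht).memLp.sub (hN'.cont.mem t ht).memLp) k
    have h2 := (h1.trans (H₁ u₀ u hu hM N hN uN hN' t ht)).trans hs2
    have h3 : fc (fun x => (u t x : ℂ) - uN t x) k = _ :=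
      fc_sub (PerL2.perInt (hu.cont.mem t ht).memLp) (PerL2.perInt (hN'.cont.mem t ht).memLp) k
    have h5 : ‖fc (fun x => (u t x : ℂ) - uN t x) k‖ ≤ η := h2
    rw [h3] at h5
    have h6 := norm_add_le (fc (uN t) k) (fc (fun x => (u t x : ℂ)) k - fc (uN t) k)
    rw [add_sub_cancel] at h6
    linarith
  · set d : ℤ → ℂ := fun k => (cut N k : ℂ) * fc (fun x => (u t x : ℂ)) k - fc (uN t) k with hd
    have hd0 : ∀ l ∉ freq N, d l = 0 := fun l hl => by
      simp only [hd]
      rw [hN'.fc_eq_zero t ht l hl, cut_eq_zero hN (le_abs_of_notMem_freq hl)]; simp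
    have h1 := tsum_wt_mul_norm_le hα hN hd0
    have h2 : √(∑ k ∈ freq N, ‖d k‖ ^ 2) ≤ K * ((4 / N : ℝ) ^ r * (M + 1)) :=
      (Real.sqrt_le_left (by positivity)).2 (herr t ht).1
    rw [tsum_eq_sum (s := freq N) fun l hl => by rw [hd0 l hl, norm_zero, mul_zero]] at h1
    have h3 : 16 * (N : ℝ) ^ (α + 3 / 2) * √(∑ k ∈ freq N, ‖d k‖ ^ 2) ≤ 16 * (K * ε) := by
      calc _ ≤ 16 * (N : ℝ) ^ (α + 3 / 2) * (K * ((4 / N : ℝ) ^ r * (M + 1))) := by gcongr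
        _ = 16 * (K * ((N : ℝ) ^ (α + 3 / 2) * ((4 / N : ℝ) ^ r * (M + 1)))) := by ring
        _ ≤ _ := by gcongr
    have h5 : ∑ k ∈ freq N, wt k ^ (α + 1) * ‖fc (fun x => (u t x : ℂ)) k‖ ≤
        wtC * (√(2 ^ r) * M) := by
      refine ((hu.cont.mem t ht).sum_wt_le hα0 hr _).trans ?_
      gcongr
      exact hM t ht
    refine le_trans ?_ (add_le_add h5 (h1.trans h3))
    rw [← Finset.sum_add_distrib]
    refine Finset.sum_le_sum fun k _ => ?_
    rw [← mul_add]
    refine mul_le_mul_of_nonneg_left ?_ (Real.rpow_nonneg (wt_pos k).le _)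
    have h6 : fc (uN t) k = (cut N k : ℂ) * fc (fun x => (u t x : ℂ)) k - d k := by
      simp only [hd]; ring
    rw [h6]
    refine (norm_sub_le _ _).trans (add_le_add_left ?_ _)
    rw [norm_mul, Complex.norm_real, Real.norm_of_nonneg (cut_nonneg N k)]
    exact mul_le_of_le_one_left (norm_nonneg _) (cut_le_one N k)
  · refine le_trans (le_of_eq (Finset.sum_congr rfl fun k hk => ?_)) (hB (freq N))
    rw [hN'.fc_init, if_pos hk]

theorem IsExactSolution.exists_exponential_error_bound {α κ₁ κ₂ γ T r : ℝ}
    (hα : α ∈ Icc (1 : ℝ) 2) (hT : 0 ≤ T) (hr : α + 2 ≤ r) {u₀ : ℝ → ℝ} {u : ℝ → ℝ → ℝ}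
    (hu : IsExactSolution α κ₁ κ₂ γ T r u₀ u) (ha : AnalyticOnNhd ℝ u₀ univ) :
    ∃ C c : ℝ, 0 < C ∧ 0 < c ∧ ∀ N : ℕ, 1 ≤ N → ∀ uN : ℝ → ℝ → ℂ,
      IsFSG α κ₁ κ₂ γ T N u₀ uN → ∀ t ∈ Icc 0 T,
        l2Norm (fun x => (u t x : ℂ) - uN t x) ≤ C * Real.exp (-c * N) := by
  have hr0 : 0 ≤ r := by linarith [hα.1]
  obtain ⟨M, hM⟩ := hu.cont.exists_bound
  obtain ⟨C₁, hC₁, H₁⟩ := exists_uniform_error_bound hα hr κ₁ κ₂ γ hT M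
  -- Galerkin solutions on `[0,T]` are given, not constructed. If they exist only for degrees below
  -- some `N₀`, the uniform bound already suffices; otherwise arbitrarily large degrees are
  -- available for the limit.
  by_cases hex : ∀ N₀ : ℕ, ∃ N ≥ N₀, ∃ uN, IsFSG α κ₁ κ₂ γ T N u₀ uN
  · have hM0 : 0 ≤ M := (hsNorm_nonneg _ _).trans (hM 0 ⟨le_rfl, hT⟩)
    obtain ⟨K, hK, ε, hε, H⟩ := exists_error_bound hα hr κ₁ κ₂ γ T hM0
    obtain ⟨C, hC, c, hc, hb⟩ := hu.exists_fc_bound hα hT hr ha hex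
    set D := C * √(∑' k : ℤ, Real.exp (-c * |(k : ℝ)|) + 1) with hD
    have hS : 0 ≤ ∑' k : ℤ, Real.exp (-c * |(k : ℝ)|) := tsum_nonneg fun k => (Real.exp_pos _).le
    have hD0 : 0 < D := by positivity
    have hlim : Tendsto (fun N : ℕ => D * ((N : ℝ) ^ (α + 3 / 2) * Real.exp (-(c / 8) * N)))
        atTop (𝓝 0) := by
      have := ((tendsto_rpow_mul_exp_neg_mul_atTop_nhds_zero (α + 3 / 2) (c / 8)
        (by positivity)).comp tendsto_natCast_atTop_atTop).const_mul D
      simpa using this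
    obtain ⟨N₀, hN₀⟩ := eventually_atTop.1 (hlim.eventually_le_const hε)
    refine ⟨K * D + C₁ * Real.exp (c / 8 * N₀), c / 8, by positivity, by positivity, ?_⟩
    intro N hN uN hN' t ht
    rw [add_mul]
    rcases le_or_gt N₀ N with h | h
    · have := (H u₀ u hu hM N hN uN hN' (D * Real.exp (-(c / 8) * N)) (by positivity)
        (fun t ht => tsum_tail_sq_le_of_exp_decay hc (hb t ht) N)
        (le_of_eq_of_le (by ring) (hN₀ N h)) t ht).2
      have h2 : 0 ≤ C₁ * Real.exp (c / 8 * N₀) * Real.exp (-(c / 8) * N) := by positivity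
      linarith
    · have h1 : 1 ≤ Real.exp (c / 8 * N₀) * Real.exp (-(c / 8) * N) := by
        rw [← Real.exp_add, Real.one_le_exp_iff]
        have : (N : ℝ) ≤ N₀ := by exact_mod_cast h.le
        nlinarith
      have h2 := H₁ u₀ u hu hM N hN uN hN' t ht
      have h3 : 0 ≤ K * D * Real.exp (-(c / 8) * N) := by positivity
      nlinarith
  · push Not at hex
    obtain ⟨N₀, hN₀⟩ := hex
    refine ⟨C₁ * Real.exp N₀, 1, by positivity, one_pos, fun N hN uN hN' t ht => ?_⟩
    have h : N < N₀ := not_le.1 fun h => hN₀ N h uN hN'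
    refine (H₁ u₀ u hu hM N hN uN hN' t ht).trans ?_
    rw [mul_assoc]
    refine le_mul_of_one_le_right hC₁.le ?_
    rw [← Real.exp_add, Real.one_le_exp_iff]
    have : (N : ℝ) ≤ N₀ := by exact_mod_cast h.le
    linarith

end FCH

/-! ### Algebraic and exponential convergence -/

theorem theorem4p1 (α κ₁ κ₂ γ T r : ℝ) (hα : α ∈ Set.Icc (1 : ℝ) 2) (hγ : 0 < γ) (hT : 0 < T)
    (hr : α + 2 ≤ r) :
    (∀ M : ℝ, ∃ C : ℝ, 0 < C ∧
      ∀ (u₀ : ℝ → ℝ) (u : ℝ → ℝ → ℝ), FCH.IsExactSolution α κ₁ κ₂ γ T r u₀ u →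
        (∀ t ∈ Set.Icc 0 T, FCH.hsNorm r (fun x => (u t x : ℂ)) ≤ M) →
        ∀ N : ℕ, 1 ≤ N → ∀ uN : ℝ → ℝ → ℂ, FCH.IsFSG α κ₁ κ₂ γ T N u₀ uN →
          ∀ t ∈ Set.Icc 0 T,
            FCH.l2Norm (fun x => (u t x : ℂ) - uN t x) ≤ C * (N : ℝ) ^ (-r)) ∧
    (∀ (u₀ : ℝ → ℝ) (u : ℝ → ℝ → ℝ), FCH.IsExactSolution α κ₁ κ₂ γ T r u₀ u →
      AnalyticOnNhd ℝ u₀ Set.univ →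
      ∃ C c : ℝ, 0 < C ∧ 0 < c ∧
        ∀ N : ℕ, 1 ≤ N → ∀ uN : ℝ → ℝ → ℂ, FCH.IsFSG α κ₁ κ₂ γ T N u₀ uN →
          ∀ t ∈ Set.Icc 0 T,
            FCH.l2Norm (fun x => (u t x : ℂ) - uN t x) ≤ C * Real.exp (-c * N)) := by
  refine ⟨fun M => ?_, fun u₀ u hu ha => hu.exists_exponential_error_bound hα hT.le hr ha⟩
  obtain ⟨C, hC, h⟩ := FCH.exists_algebraic_error_bound hα hr κ₁ κ₂ γ hT.le M
  exact ⟨C, hC, fun u₀ u hu huM N hN uN hN' => h u₀ u hu huM N hN uN hN'⟩
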